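/- Let $n\ge 3$, let $\Omega\subset\mathbb R^n$ be a bounded domain (no regularity of $\partial\Omega$ is needed), $k>0$, and consider $$\partial_t u-\varepsilon(t)\,\partial_t\Delta u-a(l(u))\Delta u=f(u)+g(t,u_t)+h(t)\ \text{ in }\Omega\times(\tau,\infty),\qquad u=0\ \text{ on }\partial\Omega\times(\tau,\infty),\qquad u(\tau+\theta)=\phi(\theta)\ \ (\theta\in[-k,0]),\tag{1}$$ where $u_t(\theta)=u(t+\theta)$ for $\theta\in[-k,0]$. Assume: - $\varepsilon\in C^1(\mathbb R)$, $\varepsilon(t)>0$ for all $t$, $\varepsilon(t)\to1$ as $t\to+\infty$, and $|\varepsilon(t)|+|\varepsilon'(t)|\le L$ for all $t$, with $L>0$; - $a:\mathbb R\to\mathbb R$ is locally Lipschitz and $\frac12(3+L+\varepsilon'(t))<m\le a(s)\le M$ for all $s,t\in\mathbb R$, with $m,M>0$; $l(u)=\int_\Omega j\,u\,dx$ with $j\in L^2(\Omega)$; - $f\in C^1(\mathbb R)$, $(f(r)-f(s))(r-s)\le\tilde\eta (r-s)^2$ and $-C_0-C_1|r|^p\le f(r)r\le C_0-C_2|r|^p$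 for all $r,s\in\mathbb R$, with $p\ge2$ and $\tilde\eta,C_0,C_1,C_2>0$; - $g:\mathbb R\times C([-k,0];L^2(\Omega))\to L^2(\Omega)$ is such that $t\mapsto g(t,\nu)$ is measurable for every $\nu$, $g(t,0)=0$ and $\|g(t,\nu_1)-g(t,\nu_2)\|^2\le C_g\|\nu_1-\nu_2\|^2_{C([-k,0];L^2(\Omega))}$, with $C_g>0$; - $h\in L^2_{loc}(\mathbb R;H^{-1}(\Omega))$. Let $\mathcal H_t(\Omega)$ be $H^1_0(\Omega)$ with the norm $\|u\|^2_{\mathcal H_t}=\|u\|_2^2+\varepsilon(t)\|\nabla u\|_2^2$, and let $C_{\mathcal H_t(\Omega)}$ be $C([-k,0];H_0^1(\Omega))$ with the norm $$\|\phi\|^2_{C_{\mathcal H_t}}=\max_{\theta\in[-k,0]}\|\phi(\theta)\|_2^2+\max_{\theta\in[-k,0]}|\varepsilon(t+\theta)|\cdot\max_{\theta\in[-k,0]}\|\nabla\phi(\theta)\|_2^2 .$$ A weak solution of (1) with initial time $\tau\in\mathbb R$ and datum $\phi\in C_{\mathcal H_\tau(\Omega)}$ is a function $u$ on $[\tau-k,\infty)$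 with $u\in C([\tau-k,T];\mathcal H_t(\Omega))\cap L^2(\tau,T;\mathcal H_t(\Omega))\cap L^p(\tau,T;L^p(\Omega))$ for all $T>\tau$ and $u(\tau+\theta)=\phi(\theta)$ for $\theta\in[-k,0]$, such that for every $v\in H_0^1(\Omega)\cap L^p(\Omega)$, in the sense of distributions on $(\tau,\infty)$, $$\frac{d}{dt}\big[(u,v)+\varepsilon(t)(\nabla u,\nabla v)\big]+\big(a(l(u))-\varepsilon'(t)\big)(\nabla u,\nabla v)=(f(u),v)+(g(t,u_t),v)+\langle h(t),v\rangle .$$ Then: 1. For every $\tau$ and $\phi$, any two weak solutions of (1) coincide on $[\tau-k,\infty)$. 2. The weak solution depends continuously on the datum: for all $\tau,T,R\in\mathbb R$ there is $C>0$ such that, if $u_1,u_2$ are weak solutions with initial time $\tau$ and data $\phi_1,\phi_2$ with $\|\phi_i\|_{C_{\mathcal H_\tau}}\le R$, then for all $t\in[\tau,T]$ $$\|u_{1,t}-u_{2,t}\|^2_{C_{\mathcal H_t}}\le e^{C(t+k-\tau)}\,\|\phi_1-\phi_2\|^2_{C_{\mathcal H_\tau}},$$ where $u_{i,t}(\theta)=u_i(t+\theta)$.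 3. Problem (1) has a continuous process: for every $\tau$ and $\phi$ a weak solution $u$ exists, and the maps $U(t,\tau):C_{\mathcal H_\tau(\Omega)}\to C_{\mathcal H_t(\Omega)}$, $U(t,\tau)\phi=u_t$ $(t\ge\tau)$, satisfy $U(\tau,\tau)=\mathrm{Id}$ and $U(t,s)U(s,\tau)=U(t,\tau)$ for $\tau\le s\le t$, and each $U(t,\tau)$ is continuous. -/

import Mathlib

open MeasureTheory Set Filter Topology
open scoped ContDiff

/-- The space `L²(Ω)` for `Ω ⊆ ℝⁿ`. -/
abbrev L2 {n : ℕ} (Ω : Set (EuclideanSpace ℝ (Fin n))) : Type :=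
  Lp ℝ 2 (volume.restrict Ω)

/-- The space `L²(Ω; ℝⁿ)` of square integrable vector fields on `Ω`. -/
abbrev L2Vec {n : ℕ} (Ω : Set (EuclideanSpace ℝ (Fin n))) : Type :=
  Lp (EuclideanSpace ℝ (Fin n)) 2 (volume.restrict Ω)

/-- The pairs `(φ, ∇φ)`, as elements of `L²(Ω) × L²(Ω; ℝⁿ)`, with `φ ∈ C_c^∞(Ω)`. -/
def testPairs {n : ℕ} (Ω : Set (EuclideanSpace ℝ (Fin n))) :
    Set (WithLp 2 (L2 Ω × L2Vec Ω)) :=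
  {w | ∃ φ : EuclideanSpace ℝ (Fin n) → ℝ,
    ContDiff ℝ ∞ φ ∧ HasCompactSupport φ ∧ tsupport φ ⊆ Ω ∧
    (w.fst : EuclideanSpace ℝ (Fin n) → ℝ) =ᵐ[volume.restrict Ω] φ ∧
    (w.snd : EuclideanSpace ℝ (Fin n) → EuclideanSpace ℝ (Fin n))
      =ᵐ[volume.restrict Ω] gradient φ}

/-- `H₀¹(Ω)`, the closure of `C_c^∞(Ω)` in the norm `(‖u‖₂² + ‖∇u‖₂²)^{1/2}`.
An element is stored as the pair `(u, ∇u)`; the second component of a pair in this closure is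
the weak gradient of the first one and so is determined by it. -/
noncomputable def H01Sub {n : ℕ} (Ω : Set (EuclideanSpace ℝ (Fin n))) :
    Submodule ℝ (WithLp 2 (L2 Ω × L2Vec Ω)) :=
  (Submodule.span ℝ (testPairs Ω)).topologicalClosure

/-- `H₀¹(Ω)` as a type, with the inner product `(u, v) + (∇u, ∇v)`. -/
abbrev H01 {n : ℕ} (Ω : Set (EuclideanSpace ℝ (Fin n))) : Type := H01Sub Ω

/-- `H⁻¹(Ω)`, the dual of `H₀¹(Ω)`. -/
abbrev Hneg1 {n : ℕ} (Ω : Set (EuclideanSpace ℝ (Fin n))) : Type := H01 Ω →L[ℝ] ℝ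

namespace H01

/-- The function `u ∈ L²(Ω)` underlying `u ∈ H₀¹(Ω)`. -/
def val {n : ℕ} {Ω : Set (EuclideanSpace ℝ (Fin n))} (u : H01 Ω) : L2 Ω := u.1.fst

/-- The weak gradient `∇u` of `u ∈ H₀¹(Ω)`. -/
def grad {n : ℕ} {Ω : Set (EuclideanSpace ℝ (Fin n))} (u : H01 Ω) : L2Vec Ω := u.1.snd

end H01

/-- The norm of `H_t(Ω)`: `‖u‖² = ‖u‖₂² + ε(t) ‖∇u‖₂²`. For `ε(t) > 0` the space `H_t(Ω)` is
`H₀¹(Ω)` with this equivalent norm. -/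
noncomputable def normH {n : ℕ} {Ω : Set (EuclideanSpace ℝ (Fin n))} (ε : ℝ → ℝ) (t : ℝ)
    (u : H01 Ω) : ℝ :=
  Real.sqrt (‖u.val‖ ^ 2 + ε t * ‖u.grad‖ ^ 2)

/-- The underlying space `C([-k, 0]; H₀¹(Ω))` of `C_{H_t(Ω)}`, for every `t`. -/
abbrev CH {n : ℕ} (k : ℝ) (Ω : Set (EuclideanSpace ℝ (Fin n))) : Type :=
  C(Icc (-k) 0, H01 Ω)

/-- The norm of `C_{H_t(Ω)}`: `‖φ‖² = max_θ ‖φ(θ)‖₂² + |ε_t| max_θ ‖∇φ(θ)‖₂²`, where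
`|ε_t| = max_θ |ε(t + θ)|` and `θ` runs over `[-k, 0]`. -/
noncomputable def normCH {n : ℕ} {Ω : Set (EuclideanSpace ℝ (Fin n))} {k : ℝ} (ε : ℝ → ℝ)
    (t : ℝ) (φ : CH k Ω) : ℝ :=
  Real.sqrt ((⨆ θ : Icc (-k) 0, ‖(φ θ).val‖) ^ 2
    + (⨆ θ : Icc (-k) 0, |ε (t + (θ : ℝ))|) * (⨆ θ : Icc (-k) 0, ‖(φ θ).grad‖) ^ 2)

open Classical in
/-- The segment `u_t ∈ C([-k, 0]; X)`, `u_t(θ) = u(t + θ)`, of a function `u` that is continuous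
on `[t - k, t]` (and `0` if it is not). -/
noncomputable def delaySegment {X : Type} [TopologicalSpace X] [Zero X] (k : ℝ) (u : ℝ → X) (t : ℝ) :
    C(Icc (-k) 0, X) :=
  if hc : Continuous (fun θ : Icc (-k) 0 => u (t + (θ : ℝ))) then ⟨_, hc⟩ else 0

/-- Weak solutions, with initial time `τ` and initial datum `φ`, of
`∂ₜu - ε(t) ∂ₜΔu - a(l(u)) Δu = f(u) + g(t, u_t) + h(t)` in `Ω × (τ, ∞)`, `u = 0` on `∂Ω`,
`u(τ + θ) = φ(θ)` for `θ ∈ [-k, 0]`, where `l(u) = ∫_Ω j u`. Only the values of `u` on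
`[τ - k, ∞)` matter. The last clause is
`d/dt [(u, v) + ε (∇u, ∇v)] + (a(l(u)) - ε') (∇u, ∇v) = (f(u), v) + (g(t, u_t), v) + ⟨h(t), v⟩`
in the sense of distributions on `(τ, ∞)`, for every `v ∈ H₀¹(Ω) ∩ Lᵖ(Ω)`. -/
structure IsWeakSolution {n : ℕ} {Ω : Set (EuclideanSpace ℝ (Fin n))} {k : ℝ}
    (p : ℝ) (ε a f : ℝ → ℝ) (j : L2 Ω) (g : ℝ → C(Icc (-k) 0, L2 Ω) → L2 Ω) (h : ℝ → Hneg1 Ω)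
    (τ : ℝ) (φ : CH k Ω) (u : ℝ → H01 Ω) : Prop where
  /-- `u ∈ C([τ - k, T]; H_t(Ω))` for all `T > τ`. -/
  continuousOn : ContinuousOn u (Ici (τ - k))
  /-- `u ∈ L²(τ, T; H_t(Ω))` for all `T > τ`. -/
  sq_integrable : ∀ T, τ < T → IntegrableOn (fun t => normH ε t (u t) ^ 2) (Ioo τ T)
  /-- `u ∈ Lᵖ(τ, T; Lᵖ(Ω))` for all `T > τ`. -/
  pow_integrable : ∀ T, τ < T →
    ∫⁻ t in Ioo τ T, ∫⁻ x in Ω, ENNReal.ofReal (|(u t).val x| ^ p) < ⊤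
  /-- The initial condition. -/
  initial : ∀ θ : Icc (-k) 0, u (τ + (θ : ℝ)) = φ θ
  /-- The equation. -/
  equation : ∀ v : H01 Ω, MemLp v.val (ENNReal.ofReal p) (volume.restrict Ω) →
    ∀ ψ : ℝ → ℝ, ContDiff ℝ ∞ ψ → HasCompactSupport ψ → tsupport ψ ⊆ Ioi τ →
    (∫ t in Ioi τ,
        (-((inner ℝ (u t).val v.val + ε t * inner ℝ (u t).grad v.grad) * deriv ψ t)
          + (a (∫ x in Ω, j x * (u t).val x) - deriv ε t)
              * inner ℝ (u t).grad v.grad * ψ t))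
      = ∫ t in Ioi τ,
          ((∫ x in Ω, f ((u t).val x) * v.val x)
            + inner ℝ (g t (delaySegment k (fun s => (u s).val) t)) v.val + h t v) * ψ t

/-! Let `V = H₀¹(Ω)`, let `ι : V → L²(Ω)` be the embedding, `Q = 1 - ι*ι` the operator of the form
`(∇u, ∇v)`, and `B(t) = ι*ι + ε(t) Q`. With `β(r) = η r - f(r)`, which is nondecreasing of growth `p
- 1`, the equation reads `d/dt (B(t) u) = ε' Q u + F(u) - β(u)`, where the causal forcing `F(u)`
collects `-a(l(u)) Q u`, `η u`, the delay term and `h`. Because `ε > 0`, the operator `B(t)` is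
coercive on `V` itself, so even the diffusion is a bounded perturbation that is Lipschitz on bounded
sets. The only unbounded term is `β`: the exponent `p` is arbitrary and `H₀¹(Ω)` need not embed into
`Lᵖ(Ω)`.

The central estimate is `energy_inequality` for the difference `z` of two solutions. The curve `z`
belongs to `Lᵖ` only at almost every time and has no usable time derivative, so it cannot be a test
function. The equation integrated over `[t, t + h]` is tested with the fixed vector `z(t) + z(t +
h)`. By the symmetry of `B` the left side is an increment of the energy, up to a term in `ε(t + h) -
ε(t)`. The monotonicity of `β` acts up to errors that vanish after averaging in `t` and letting `h →
0`. Gronwall's inequality then makes the solution a Lipschitz function of the initial value and of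
the forcing (`IsIntegralSolution.stability`).

For a given forcing, existence comes from replacing the subdifferential of `Φ(v) = ∫ b(ι v)`, with
`b` a primitive of `β`, by its Yosida approximation; this leaves an ordinary differential equation
in `V`. If `Φ(u₀)` is finite, the gradient structure bounds the Yosida terms in `L²` in time, and
the approximations form a Cauchy sequence (`exists_yosida_bound`, `exists_yosida_stability`). A
second bound, in `Lᵖ`, depends on `u₀` only through its norm; with stability and the density of the
domain of `Φ` it reaches every `u₀` (`exists_integralSolution`).

The map sending `w` to the solution with forcing `F(w)` is then a contraction for exponentially
weighted norms on an invariant bounded set (`exists_integralSolution_causal`). The stability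
estimate, combined with a Gronwall inequality with delay (`exists_bound_of_delayed_inequality`),
gives uniqueness and Lipschitz dependence on the datum; the process property is uniqueness after a
restart. Finally `isWeakSolution_iff` identifies distributional solutions with solutions of the
integrated equation. -/

set_option linter.unusedSectionVars false

/-! ### Superposition operators of monotone functions with arbitrary polynomial growth. -/

section Nemytskii

variable {X : Type*} [MeasurableSpace X] {μ : Measure X}

lemma abs_integral_le_of_abs_le {f g : X → ℝ} (hg : Integrable g μ) (h : ∀ᵐ x ∂μ, |f x| ≤ g x) :
    |∫ x, f x ∂μ| ≤ ∫ x, g x ∂μ :=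
  norm_integral_le_of_norm_le (f := f) hg h

/-- The integral `∫ |w|ᵖ ∈ [0, ∞]` of `w ∈ L²`. -/
noncomputable def powInt (p : ℝ) (w : Lp ℝ 2 μ) : ENNReal :=
  ∫⁻ x, ENNReal.ofReal (|w x| ^ p) ∂μ

/-- A nondecreasing `C¹` function with coercive growth of order `p - 1`. -/
structure MonotoneGrowth (β : ℝ → ℝ) (p : ℝ) : Prop where
  two_le : 2 ≤ p
  contDiff : ContDiff ℝ 1 β
  mono : Monotone β
  growth : ∃ C, 0 < C ∧ ∀ r, |β r| ≤ C * (1 + |r| ^ (p - 1))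
  coercive : ∃ c C, 0 < c ∧ 0 < C ∧ ∀ r, c * |r| ^ p - C ≤ β r * r

/-- Truncation of the real line to `[-N, N]`. -/
noncomputable def clampR (N r : ℝ) : ℝ := max (-N) (min N r)

lemma abs_clampR_le {N : ℝ} (hN : 0 ≤ N) (r : ℝ) : |clampR N r| ≤ N := by
  unfold clampR
  rw [abs_le]
  exact ⟨le_max_left _ _, max_le (by linarith) (min_le_left _ _)⟩

lemma abs_clampR_le_abs {N : ℝ} (hN : 0 ≤ N) (r : ℝ) : |clampR N r| ≤ |r| := by
  unfold clampR
  rcases abs_cases r with ⟨h, h'⟩ | ⟨h, h'⟩ <;> rw [h, abs_le] <;> constructor <;> grind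

lemma clampR_of_abs_le {N r : ℝ} (h : |r| ≤ N) : clampR N r = r := by
  rw [abs_le] at h
  unfold clampR
  rw [min_eq_right h.2, max_eq_right h.1]

lemma clampR_lipschitz (N r s : ℝ) : |clampR N r - clampR N s| ≤ |r - s| := by
  unfold clampR
  refine (abs_max_sub_max_le_max _ _ _ _).trans ?_
  simp only [sub_self, abs_zero]
  refine max_le (abs_nonneg _) ((abs_min_sub_min_le_max _ _ _ _).trans ?_)
  simp

lemma continuous_clampR (N : ℝ) : Continuous (clampR N) := by
  unfold clampR; fun_prop

lemma exists_lipschitz_clampR {β : ℝ → ℝ} (hβ : LocallyLipschitz β) {N : ℝ} (hN : 0 ≤ N) :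
    ∃ K, 0 ≤ K ∧ ∀ r s, |β (clampR N r) - β (clampR N s)| ≤ K * |r - s| := by
  have hc : IsCompact (Icc (-N) N) := isCompact_Icc
  obtain ⟨K, hK⟩ := (hβ.locallyLipschitzOn (s := Icc (-N) N)).exists_lipschitzOnWith_of_compact hc
  refine ⟨K, K.2, fun r s => ?_⟩
  have h1 : ∀ r, clampR N r ∈ Icc (-N) N := fun r => abs_le.mp (abs_clampR_le hN r)
  have := hK.dist_le_mul _ (h1 r) _ (h1 s)
  rw [Real.dist_eq, Real.dist_eq] at this
  exact this.trans (mul_le_mul_of_nonneg_left (clampR_lipschitz N r s) K.2)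

/-- Fatou's lemma along an almost everywhere convergent subsequence. These integrals may be infinite
and are not continuous on `L²`; semicontinuity is what makes them Borel functions, hence measurable
along curves. -/
lemma lowerSemicontinuous_lintegral_comp {θ : ℝ → ℝ} (hθ : Continuous θ) :
    LowerSemicontinuous (fun w : Lp ℝ 2 μ => ∫⁻ x, ENNReal.ofReal (θ (w x)) ∂μ) := by
  rw [lowerSemicontinuous_iff_isClosed_preimage]
  intro y
  apply IsSeqClosed.isClosed
  intro w w₀ hw hlim
  obtain ⟨ns, hns, hae⟩ := (tendstoInMeasure_of_tendsto_Lp hlim).exists_seq_tendsto_ae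
  simp only [mem_preimage, mem_Iic] at hw ⊢
  have hmeas : ∀ v : Lp ℝ 2 μ, Measurable fun x => ENNReal.ofReal (θ (v x)) := fun v =>
    (hθ.measurable.comp (Lp.stronglyMeasurable v).measurable).ennreal_ofReal
  calc ∫⁻ x, ENNReal.ofReal (θ (w₀ x)) ∂μ
      = ∫⁻ x, liminf (fun i => ENNReal.ofReal (θ (w (ns i) x))) atTop ∂μ := by
        refine lintegral_congr_ae ?_
        filter_upwards [hae] with x hx
        exact (((ENNReal.continuous_ofReal.comp hθ).tendsto _).comp hx).liminf_eq.symm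
    _ ≤ liminf (fun i => ∫⁻ x, ENNReal.ofReal (θ (w (ns i) x)) ∂μ) atTop :=
        lintegral_liminf_le fun i => hmeas _
    _ ≤ y := by
        refine (liminf_le_liminf (Eventually.of_forall fun i => hw (ns i))).trans ?_
        simp

lemma continuous_abs_rpow {p : ℝ} (hp : 2 ≤ p) : Continuous fun r : ℝ => |r| ^ p :=
  continuous_abs.rpow_const fun _ => Or.inr (by linarith)

lemma lowerSemicontinuous_powInt {p : ℝ} (hp : 2 ≤ p) :
    LowerSemicontinuous (powInt (μ := μ) p) :=
  lowerSemicontinuous_lintegral_comp (continuous_abs_rpow hp)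

lemma aemeasurable_powInt {α : Type*} [MeasurableSpace α] {ν : Measure α} {p : ℝ} (hp : 2 ≤ p)
    {w : α → Lp ℝ 2 μ} (hw : AEStronglyMeasurable w ν) :
    AEMeasurable (fun t => powInt p (w t)) ν := by
  let _ : MeasurableSpace (Lp ℝ 2 μ) := borel _
  have : BorelSpace (Lp ℝ 2 μ) := ⟨rfl⟩
  exact (lowerSemicontinuous_powInt hp).measurable.comp_aemeasurable hw.aemeasurable

lemma integrable_powInt {α : Type*} [MeasurableSpace α] {ν : Measure α} {p : ℝ} (hp : 2 ≤ p)
    {w : α → Lp ℝ 2 μ} (hw : AEStronglyMeasurable w ν) (hfin : ∫⁻ t, powInt p (w t) ∂ν < ⊤) :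
    Integrable (fun t => (powInt p (w t)).toReal) ν :=
  integrable_toReal_of_lintegral_ne_top (aemeasurable_powInt hp hw) hfin.ne

lemma aemeas_pow {p : ℝ} (hp : 2 ≤ p) (w : Lp ℝ 2 μ) :
    AEStronglyMeasurable (fun x => |w x| ^ p) μ :=
  (continuous_abs_rpow hp).comp_aestronglyMeasurable (Lp.aestronglyMeasurable w)

lemma integrable_pow_iff {p : ℝ} (hp : 2 ≤ p) (w : Lp ℝ 2 μ) :
    Integrable (fun x => |w x| ^ p) μ ↔ powInt p w < ⊤ := by
  unfold powInt
  rw [← hasFiniteIntegral_iff_ofReal (Eventually.of_forall fun x => by positivity)]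
  exact ⟨fun h => h.2, fun h => ⟨aemeas_pow hp w, h⟩⟩

lemma integral_pow_eq {p : ℝ} (hp : 2 ≤ p) (w : Lp ℝ 2 μ) :
    ∫ x, |w x| ^ p ∂μ = (powInt p w).toReal := by
  rw [integral_eq_lintegral_of_nonneg_ae (Eventually.of_forall fun x => by positivity)
    (aemeas_pow hp w)]
  rfl

lemma rpow_add_le {p : ℝ} (hp : 2 ≤ p) (r s : ℝ) :
    |r + s| ^ p ≤ 2 ^ p * (|r| ^ p + |s| ^ p) := by
  have h0 : (0:ℝ) ≤ p := by linarith
  have h1 : |r + s| ≤ 2 * max |r| |s| := by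
    refine (abs_add_le r s).trans ?_
    linarith [le_max_left |r| |s|, le_max_right |r| |s|]
  refine (Real.rpow_le_rpow (abs_nonneg _) h1 h0).trans ?_
  rw [Real.mul_rpow (by norm_num) (by positivity)]
  gcongr
  rcases max_cases |r| |s| with ⟨h, _⟩ | ⟨h, _⟩ <;> rw [h] <;>
    linarith [Real.rpow_nonneg (abs_nonneg r) p, Real.rpow_nonneg (abs_nonneg s) p]

lemma rpow_pred_mul_le {p : ℝ} (hp : 2 ≤ p) (r s : ℝ) :
    |r| ^ (p - 1) * |s| ≤ |r| ^ p + |s| ^ p := by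
  have h0 : (0:ℝ) < p := by linarith
  have key : ∀ a b : ℝ, 0 ≤ a → 0 ≤ b → b ≤ a → a ^ (p - 1) * b ≤ a ^ p := by
    intro a b ha hb hab
    rcases ha.eq_or_lt with h | h
    · have : b = 0 := by linarith
      rw [this, mul_zero]; positivity
    · calc a ^ (p - 1) * b ≤ a ^ (p - 1) * a := by gcongr
        _ = a ^ p := by rw [← Real.rpow_add_one h.ne']; congr 1; ring
  have hr := Real.rpow_nonneg (abs_nonneg r) p
  have hs := Real.rpow_nonneg (abs_nonneg s) p
  rcases le_total |s| |r| with h | h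
  · linarith [key _ _ (abs_nonneg r) (abs_nonneg s) h]
  · have : |r| ^ (p - 1) * |s| ≤ |s| ^ (p - 1) * |s| := by
      gcongr; linarith
    linarith [key _ _ (abs_nonneg s) (abs_nonneg s) le_rfl]

lemma le_one_add_rpow {p : ℝ} (hp : 1 ≤ p) {r : ℝ} (hr : 0 ≤ r) : r ≤ 1 + r ^ p := by
  rcases le_total r 1 with h | h
  · linarith [Real.rpow_nonneg hr p]
  · have : r ^ (1:ℝ) ≤ r ^ p := Real.rpow_le_rpow_of_exponent_le h hp
    rw [Real.rpow_one] at this; linarith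

/-- Either `|v|` is small compared with `|r|`, or `|r|` is bounded by a multiple of `|v|`. -/
lemma rpow_pred_mul_le_of_lt {p δ N : ℝ} (hp : 2 ≤ p) (hδ : 0 < δ) (hN : 0 ≤ N) {r v : ℝ}
    (hr : N < |r|) :
    |r| ^ (p - 1) * |v| ≤ δ * |r| ^ p
      + δ ^ (1 - p) * (if δ * N < |v| then |v| ^ p else 0) := by
  have hr0 : 0 < |r| := hN.trans_lt hr
  have e1 : ∀ a : ℝ, 0 < a → a ^ p = a ^ (p - 1) * a := fun a ha => by
    rw [← Real.rpow_add_one ha.ne']; congr 1; ring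
  have hδp := Real.rpow_nonneg hδ.le (1 - p)
  rcases le_or_gt |v| (δ * |r|) with h | h
  · have h3 : 0 ≤ δ ^ (1 - p) * (if δ * N < |v| then |v| ^ p else 0) := by
      apply mul_nonneg hδp; split_ifs <;> positivity
    have : |r| ^ (p - 1) * |v| ≤ |r| ^ (p - 1) * (δ * |r|) := by gcongr
    rw [e1 _ hr0]; linarith
  · have hv : δ * N < |v| := (by gcongr : δ * N < δ * |r|).trans h
    have hv0 : 0 < |v| := (by positivity : 0 < δ * |r|).trans h
    rw [if_pos hv, e1 |v| hv0]
    have h4 : |r| ≤ δ⁻¹ * |v| := by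
      rw [inv_mul_eq_div, le_div_iff₀ hδ]; linarith
    have h5 : |r| ^ (p - 1) ≤ δ ^ (1 - p) * |v| ^ (p - 1) := by
      refine (Real.rpow_le_rpow hr0.le h4 (by linarith)).trans_eq ?_
      rw [Real.mul_rpow (by positivity) (by positivity), ← Real.rpow_neg_one δ,
        ← Real.rpow_mul hδ.le]
      congr 2; ring
    have h6 : 0 ≤ δ * |r| ^ p := by positivity
    have := mul_le_mul_of_nonneg_right h5 hv0.le
    linarith

lemma powInt_add_lt_top {p : ℝ} (hp : 2 ≤ p) {v w : Lp ℝ 2 μ} (hv : powInt p v < ⊤)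
    (hw : powInt p w < ⊤) : powInt p (v + w) < ⊤ := by
  rw [← integrable_pow_iff hp] at *
  refine ((hv.add hw).const_mul (2 ^ p)).mono' (aemeas_pow hp _) ?_
  filter_upwards [Lp.coeFn_add v w] with x hx
  rw [Real.norm_of_nonneg (by positivity), hx]
  exact rpow_add_le hp _ _

lemma powInt_smul_lt_top {p : ℝ} (hp : 2 ≤ p) (c : ℝ) {v : Lp ℝ 2 μ} (hv : powInt p v < ⊤) :
    powInt p (c • v) < ⊤ := by
  rw [← integrable_pow_iff hp] at *
  refine (hv.const_mul (|c| ^ p)).congr ?_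
  filter_upwards [Lp.coeFn_smul c v] with x hx
  rw [hx, Pi.smul_apply, smul_eq_mul, abs_mul, Real.mul_rpow (abs_nonneg _) (abs_nonneg _)]

lemma powInt_neg_lt_top {p : ℝ} (hp : 2 ≤ p) {v : Lp ℝ 2 μ} (hv : powInt p v < ⊤) :
    powInt p (-v) < ⊤ := by
  simpa using powInt_smul_lt_top hp (-1) hv

lemma powInt_sub_lt_top {p : ℝ} (hp : 2 ≤ p) {v w : Lp ℝ 2 μ} (hv : powInt p v < ⊤)
    (hw : powInt p w < ⊤) : powInt p (v - w) < ⊤ := by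
  rw [sub_eq_add_neg]
  exact powInt_add_lt_top hp hv (powInt_neg_lt_top hp hw)

lemma powInt_zero {p : ℝ} (hp : 2 ≤ p) : powInt p (0 : Lp ℝ 2 μ) = 0 := by
  unfold powInt
  rw [lintegral_eq_zero_iff']
  · filter_upwards [Lp.coeFn_zero ℝ 2 μ] with x hx
    rw [hx]
    simp [Real.zero_rpow (by linarith : p ≠ 0)]
  · exact (aemeas_pow hp _).aemeasurable.ennreal_ofReal

/-- The tail `∫_{|v| > N} |v|ᵖ` tends to zero. -/
lemma tendsto_tail {p : ℝ} (hp : 2 ≤ p) {v : Lp ℝ 2 μ} (hv : powInt p v < ⊤) {δ : ℝ}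
    (hδ : 0 < δ) :
    Tendsto (fun N : ℕ => ∫ x, (if δ * (N : ℝ) < |v x| then |v x| ^ p else 0) ∂μ) atTop (𝓝 0) := by
  rw [← integrable_pow_iff hp] at hv
  have : Tendsto (fun N : ℕ => ∫ x, (if δ * (N : ℝ) < |v x| then |v x| ^ p else 0) ∂μ) atTop
      (𝓝 (∫ _, (0:ℝ) ∂μ)) := by
    refine tendsto_integral_of_dominated_convergence _ (fun N => ?_) hv (fun N => ?_) ?_
    · have hms : MeasurableSet {x | δ * (N:ℝ) < |v x|} :=
        measurableSet_lt measurable_const (Lp.stronglyMeasurable v).measurable.abs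
      exact ((aemeas_pow hp v).indicator hms)
    · refine Eventually.of_forall fun x => ?_
      split_ifs
      · rw [Real.norm_of_nonneg (by positivity)]
      · simp; positivity
    · refine Eventually.of_forall fun x => ?_
      refine tendsto_const_nhds.congr' ?_
      obtain ⟨n, hn⟩ := exists_nat_gt (|v x| / δ)
      filter_upwards [eventually_ge_atTop n] with N hN
      rw [if_neg]
      rw [not_lt]
      have h1 : (n:ℝ) ≤ N := by exact_mod_cast hN
      rw [div_lt_iff₀ hδ] at hn
      nlinarith
  simpa using this

lemma integrable_tail {p : ℝ} (hp : 2 ≤ p) {v : Lp ℝ 2 μ} (hv : powInt p v < ⊤) (c : ℝ) :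
    Integrable (fun x => (if c < |v x| then |v x| ^ p else 0)) μ := by
  rw [← integrable_pow_iff hp] at hv
  have hms : MeasurableSet {x | c < |v x|} :=
    measurableSet_lt measurable_const (Lp.stronglyMeasurable v).measurable.abs
  exact hv.indicator hms

lemma integral_abs_mul_le (v w : Lp ℝ 2 μ) : ∫ x, |v x| * |w x| ∂μ ≤ ‖v‖ * ‖w‖ := by
  have h : ∫ x, |v x| * |w x| ∂μ = inner ℝ |v| |w| := by
    rw [L2.inner_def]
    refine integral_congr_ae ?_
    filter_upwards [Lp.coeFn_abs v, Lp.coeFn_abs w] with x h1 h2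
    simp [h1, h2, mul_comm]
  rw [h]
  refine (real_inner_le_norm _ _).trans_eq ?_
  rw [norm_abs_eq_norm, norm_abs_eq_norm]

lemma integrable_abs_mul (v w : Lp ℝ 2 μ) : Integrable (fun x => |v x| * |w x|) μ :=
  ((Lp.memLp v).abs.integrable_mul (Lp.memLp w).abs)

variable [IsFiniteMeasure μ]

lemma integrable_coe (w : Lp ℝ 2 μ) : Integrable (fun x => w x) μ :=
  (Lp.memLp w).integrable (by norm_num)

lemma integral_abs_le (w : Lp ℝ 2 μ) : ∫ x, |w x| ∂μ ≤ Real.sqrt (μ.real univ) * ‖w‖ := by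
  have := integral_abs_mul_le (indicatorConstLp 2 MeasurableSet.univ (measure_ne_top μ _) 1) w
  rw [norm_indicatorConstLp (by norm_num) (by norm_num)] at this
  simp only [norm_one, ENNReal.toReal_ofNat, one_mul] at this
  rw [← Real.sqrt_eq_rpow] at this
  refine le_trans (le_of_eq (integral_congr_ae ?_)) this
  filter_upwards [indicatorConstLp_coeFn (p := 2) (μ := μ) (hs := MeasurableSet.univ)
    (hμs := measure_ne_top μ _) (c := (1:ℝ))] with x hx
  rw [hx]; simp

namespace MonotoneGrowth

variable {β : ℝ → ℝ} {p : ℝ} (hβ : MonotoneGrowth β p)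
include hβ

lemma continuous : Continuous β := hβ.contDiff.continuous

lemma locallyLipschitz : LocallyLipschitz β := hβ.contDiff.locallyLipschitz

lemma exists_abs_mul_le : ∃ C, 0 < C ∧ ∀ r s, |β r| * |s| ≤ C * (1 + |r| ^ p + |s| ^ p) := by
  obtain ⟨C, hC, h⟩ := hβ.growth
  refine ⟨2 * C, by positivity, fun r s => ?_⟩
  have h1 := mul_le_mul_of_nonneg_right (h r) (abs_nonneg s)
  have h2 := rpow_pred_mul_le hβ.two_le r s
  have h3 := le_one_add_rpow (p := p) (by linarith [hβ.two_le]) (abs_nonneg s)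
  have h4 : C * (1 + |r| ^ (p - 1)) * |s| ≤ C * ((1 + |s| ^ p) + (|r| ^ p + |s| ^ p)) := by
    rw [mul_assoc]
    gcongr
    linarith
  have h5 : 0 ≤ C * (1 + |r| ^ p) := by positivity
  linarith

lemma aemeas_comp_mul (w v : Lp ℝ 2 μ) : AEStronglyMeasurable (fun x => β (w x) * v x) μ :=
  (hβ.continuous.comp_aestronglyMeasurable (Lp.aestronglyMeasurable w)).mul
    (Lp.aestronglyMeasurable v)

lemma integrable_comp_mul {w v : Lp ℝ 2 μ} (hw : powInt p w < ⊤) (hv : powInt p v < ⊤) :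
    Integrable (fun x => β (w x) * v x) μ := by
  obtain ⟨C, hC, h⟩ := hβ.exists_abs_mul_le
  rw [← integrable_pow_iff hβ.two_le] at hw hv
  refine ((((integrable_const 1).add hw).add hv).const_mul C).mono' (hβ.aemeas_comp_mul w v) ?_
  refine Eventually.of_forall fun x => ?_
  rw [norm_mul]; exact h _ _

lemma exists_abs_integral_le : ∃ C, 0 < C ∧ ∀ w v : Lp ℝ 2 μ, powInt p w < ⊤ → powInt p v < ⊤ →
    |∫ x, β (w x) * v x ∂μ| ≤ C * (1 + (powInt p w).toReal + (powInt p v).toReal) := by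
  obtain ⟨C, hC, h⟩ := hβ.exists_abs_mul_le
  refine ⟨C * (1 + μ.real univ), by positivity, fun w v hw hv => ?_⟩
  rw [← integral_pow_eq hβ.two_le, ← integral_pow_eq hβ.two_le]
  rw [← integrable_pow_iff hβ.two_le] at hw hv
  have h1 : |∫ x, β (w x) * v x ∂μ| ≤ ∫ x, C * (1 + |w x| ^ p + |v x| ^ p) ∂μ := by
    refine norm_integral_le_of_norm_le (μ := μ) (f := fun x => β (w x) * v x)
      ((((integrable_const (1:ℝ)).add hw).add hv).const_mul C) ?_
    refine Eventually.of_forall fun x => ?_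
    rw [norm_mul]; exact h _ _
  refine h1.trans ?_
  rw [integral_const_mul, integral_add, integral_add, integral_const, smul_eq_mul, mul_one,
    mul_assoc]
  · have : 0 ≤ ∫ x, |w x| ^ p ∂μ := integral_nonneg fun x => by positivity
    have : 0 ≤ ∫ x, |v x| ^ p ∂μ := integral_nonneg fun x => by positivity
    have hm : 0 ≤ μ.real univ := measureReal_nonneg
    gcongr
    nlinarith
  · exact integrable_const 1
  · exact hw
  · exact (integrable_const 1).add hw
  · exact hv

/-- The truncation changes nothing for `|r| ≤ N`. Beyond `N` both values are of order `|r| ^ (p -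
1)`, and the product with `|v|` splits into a small multiple of `|r| ^ p` and a tail of `v` alone.
As the tail does not involve `r`, the error is uniform on bounded sets of `Lᵖ`. -/
lemma exists_abs_sub_clampR_le : ∃ C, 0 < C ∧ ∀ N δ : ℝ, 1 ≤ N → 0 < δ → ∀ r v : ℝ,
    |β r - β (clampR N r)| * |v| ≤ C * (δ * |r| ^ p
      + δ ^ (1 - p) * (if δ * N < |v| then |v| ^ p else 0)) := by
  obtain ⟨C, hC, h⟩ := hβ.growth
  refine ⟨4 * C, by positivity, fun N δ hN hδ r v => ?_⟩
  have hif : 0 ≤ (if δ * N < |v| then |v| ^ p else 0) := by split_ifs <;> positivity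
  rcases le_or_gt |r| N with hr | hr
  · rw [clampR_of_abs_le hr, sub_self, abs_zero, zero_mul]
    have := Real.rpow_nonneg hδ.le (1 - p)
    positivity
  · have h1 := rpow_pred_mul_le_of_lt hβ.two_le hδ (by linarith) hr (v := v)
    have hp1 : 0 ≤ p - 1 := by linarith [hβ.two_le]
    have h2 : |clampR N r| ^ (p - 1) ≤ |r| ^ (p - 1) :=
      Real.rpow_le_rpow (abs_nonneg _) (abs_clampR_le_abs (by linarith) r) hp1
    have h3 : 1 ≤ |r| ^ (p - 1) := Real.one_le_rpow (by linarith) hp1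
    have h4 : |β r - β (clampR N r)| ≤ 4 * C * |r| ^ (p - 1) := by
      refine (abs_sub _ _).trans ?_
      have := h r
      have := h (clampR N r)
      nlinarith
    calc |β r - β (clampR N r)| * |v| ≤ 4 * C * |r| ^ (p - 1) * |v| := by gcongr
      _ = 4 * C * (|r| ^ (p - 1) * |v|) := by ring
      _ ≤ _ := by gcongr

lemma exists_bound_clampR {N : ℝ} (hN : 0 ≤ N) : ∃ C, 0 ≤ C ∧ ∀ r, |β (clampR N r)| ≤ C := by
  obtain ⟨C, hC⟩ := (isCompact_Icc (a := -N) (b := N)).exists_bound_of_continuousOn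
    hβ.continuous.continuousOn
  exact ⟨C, (norm_nonneg _).trans (hC 0 ⟨by linarith, hN⟩), fun r => hC _ (abs_le.mp (abs_clampR_le hN r))⟩

lemma integrable_clampR_mul {N : ℝ} (hN : 0 ≤ N) (w v : Lp ℝ 2 μ) :
    Integrable (fun x => β (clampR N (w x)) * v x) μ := by
  obtain ⟨C, -, h⟩ := hβ.exists_bound_clampR hN
  exact (integrable_coe v).bdd_mul ((hβ.continuous.comp (continuous_clampR N)).comp_aestronglyMeasurable
    (Lp.aestronglyMeasurable w)) (Eventually.of_forall fun x => h _)

/-- On `[-N, N]` the function `β` is Lipschitz, so the truncated functional is Lipschitz on `L²`,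
unlike the original one, which need not even be finite. -/
lemma continuous_integral_clampR {N : ℝ} (hN : 0 ≤ N) (v : Lp ℝ 2 μ) :
    Continuous fun w : Lp ℝ 2 μ => ∫ x, β (clampR N (w x)) * v x ∂μ := by
  obtain ⟨K, hK, h⟩ := exists_lipschitz_clampR hβ.locallyLipschitz hN
  have : LipschitzWith (Real.toNNReal (K * ‖v‖))
      fun w : Lp ℝ 2 μ => ∫ x, β (clampR N (w x)) * v x ∂μ := by
    refine LipschitzWith.of_dist_le_mul fun w w' => ?_
    rw [Real.coe_toNNReal _ (by positivity), dist_eq_norm, dist_eq_norm,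
      ← integral_sub (hβ.integrable_clampR_mul hN _ _) (hβ.integrable_clampR_mul hN _ _)]
    calc ‖∫ x, β (clampR N (w x)) * v x - β (clampR N (w' x)) * v x ∂μ‖
        ≤ ∫ x, K * (|(w - w') x| * |v x|) ∂μ := by
          refine norm_integral_le_of_norm_le ((integrable_abs_mul _ _).const_mul K) ?_
          filter_upwards [Lp.coeFn_sub w w'] with x hx
          rw [← sub_mul, norm_mul, ← mul_assoc, hx]
          exact mul_le_mul_of_nonneg_right (h _ _) (abs_nonneg _)
      _ ≤ K * (‖w - w'‖ * ‖v‖) := by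
          rw [integral_const_mul]; gcongr; exact integral_abs_mul_le _ _
      _ = K * ‖v‖ * ‖w - w'‖ := by ring
  exact this.continuous

/-- The order of the quantifiers matters: `κ` depends on `δ` and `v` but not on `w`. Choosing `δ`
and then `N` approximates the functional uniformly on bounded sets of `Lᵖ` by functionals continuous
on `L²`. -/
lemma exists_abs_integral_sub_clampR_le {v : Lp ℝ 2 μ} (hv : powInt p v < ⊤) :
    ∃ C, 0 < C ∧ ∀ δ, 0 < δ → ∃ κ : ℕ → ℝ, Tendsto κ atTop (𝓝 0) ∧ ∀ N : ℕ, 1 ≤ N →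
      ∀ w : Lp ℝ 2 μ, powInt p w < ⊤ →
        |∫ x, β (w x) * v x ∂μ - ∫ x, β (clampR N (w x)) * v x ∂μ|
          ≤ C * (δ * (powInt p w).toReal) + κ N := by
  obtain ⟨C, hC, h⟩ := hβ.exists_abs_sub_clampR_le
  refine ⟨C, hC, fun δ hδ => ⟨fun N => C * (δ ^ (1 - p) *
    ∫ x, (if δ * (N : ℝ) < |v x| then |v x| ^ p else 0) ∂μ), ?_, fun N hN w hw => ?_⟩⟩
  · simpa using ((tendsto_tail hβ.two_le hv hδ).const_mul (δ ^ (1 - p))).const_mul C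
  · have hN' : (1:ℝ) ≤ N := by exact_mod_cast hN
    rw [← integral_sub (hβ.integrable_comp_mul hw hv) (hβ.integrable_clampR_mul (by linarith) _ _),
      ← integral_pow_eq hβ.two_le]
    beta_reduce
    rw [← integral_const_mul, ← integral_const_mul, ← integral_const_mul,
      ← integral_const_mul, ← integral_add]
    · refine abs_integral_le_of_abs_le ?_ (Eventually.of_forall fun x => ?_)
      · rw [← integrable_pow_iff hβ.two_le] at hw
        exact ((hw.const_mul _).const_mul _).add
          (((integrable_tail hβ.two_le hv _).const_mul _).const_mul _)
      · rw [← sub_mul, abs_mul, ← mul_add]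
        exact h N δ hN' hδ _ _
    · rw [← integrable_pow_iff hβ.two_le] at hw
      exact (hw.const_mul _).const_mul _
    · exact ((integrable_tail hβ.two_le hv _).const_mul _).const_mul _

lemma tendsto_integral_clampR {w v : Lp ℝ 2 μ} (hw : powInt p w < ⊤) (hv : powInt p v < ⊤) :
    Tendsto (fun N : ℕ => ∫ x, β (clampR N (w x)) * v x ∂μ) atTop
      (𝓝 (∫ x, β (w x) * v x ∂μ)) := by
  obtain ⟨C, hC, h⟩ := hβ.exists_abs_integral_sub_clampR_le hv
  rw [Metric.tendsto_atTop]
  intro e he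
  obtain ⟨κ, hκ, hb⟩ := h (e / (2 * (C * ((powInt p w).toReal + 1)))) (by positivity)
  obtain ⟨n, hn⟩ := (Metric.tendsto_atTop.mp hκ) (e / 2) (by positivity)
  refine ⟨max n 1, fun N hN => ?_⟩
  rw [dist_comm, Real.dist_eq]
  have h1 := hb N ((le_max_right _ _).trans hN) w hw
  have h2 := hn N ((le_max_left _ _).trans hN)
  rw [Real.dist_eq, sub_zero] at h2
  have h3 : C * (e / (2 * (C * ((powInt p w).toReal + 1))) * (powInt p w).toReal) ≤ e / 2 := by
    have : 0 ≤ (powInt p w).toReal := ENNReal.toReal_nonneg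
    rw [← mul_assoc, mul_div_assoc', div_mul_eq_mul_div, div_le_div_iff₀ (by positivity) (by norm_num)]
    nlinarith [mul_pos hC he]
  linarith [le_abs_self (κ N)]

variable {α : Type*} [MeasurableSpace α] {ν : Measure α}

lemma aestronglyMeasurable_integral {w : α → Lp ℝ 2 μ} (hw : AEStronglyMeasurable w ν)
    (hfin : ∀ᵐ t ∂ν, powInt p (w t) < ⊤) {v : Lp ℝ 2 μ} (hv : powInt p v < ⊤) :
    AEStronglyMeasurable (fun t => ∫ x, β (w t x) * v x ∂μ) ν := by
  refine aestronglyMeasurable_of_tendsto_ae atTop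
    (f := fun (N : ℕ) t => ∫ x, β (clampR N (w t x)) * v x ∂μ) (fun N => ?_) ?_
  · exact (hβ.continuous_integral_clampR N.cast_nonneg v).comp_aestronglyMeasurable hw
  · filter_upwards [hfin] with t ht
    exact hβ.tendsto_integral_clampR ht hv

lemma integrable_integral [IsFiniteMeasure ν] {w : α → Lp ℝ 2 μ} (hw : AEStronglyMeasurable w ν)
    (hfin : ∫⁻ t, powInt p (w t) ∂ν < ⊤) {v : Lp ℝ 2 μ} (hv : powInt p v < ⊤) :
    Integrable (fun t => ∫ x, β (w t x) * v x ∂μ) ν := by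
  obtain ⟨C, hC, h⟩ := hβ.exists_abs_integral_le (μ := μ)
  have hae := ae_lt_top' (aemeasurable_powInt hβ.two_le hw) hfin.ne
  refine ((((integrable_const 1).add (integrable_powInt hβ.two_le hw hfin)).add
    (integrable_const (powInt p v).toReal)).const_mul C).mono'
    (hβ.aestronglyMeasurable_integral hw hae hv) ?_
  filter_upwards [hae] with t ht
  exact h _ _ ht hv

/-- Strong `L²` convergence at almost every time and a uniform `Lᵖ` bound suffice for the limit in
the nonlinear term. The truncated terms converge by dominated convergence, the `Lᵖ` bound makes the
truncation error uniformly small, and Fatou's lemma transfers the bound to the limit. -/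
lemma tendsto_integral_integral [IsFiniteMeasure ν] {w : ℕ → α → Lp ℝ 2 μ} {w₀ : α → Lp ℝ 2 μ}
    (hw : ∀ n, AEStronglyMeasurable (w n) ν)
    (hlim : ∀ᵐ t ∂ν, Tendsto (fun n => w n t) atTop (𝓝 (w₀ t))) {K : ℝ}
    (hK : ∀ n, ∫⁻ t, powInt p (w n t) ∂ν ≤ ENNReal.ofReal K) {v : Lp ℝ 2 μ}
    (hv : powInt p v < ⊤) :
    ∫⁻ t, powInt p (w₀ t) ∂ν ≤ ENNReal.ofReal K ∧
      Tendsto (fun n => ∫ t, ∫ x, β (w n t x) * v x ∂μ ∂ν) atTop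
        (𝓝 (∫ t, ∫ x, β (w₀ t x) * v x ∂μ ∂ν)) := by
  have hw₀ : AEStronglyMeasurable w₀ ν := aestronglyMeasurable_of_tendsto_ae atTop hw hlim
  have hK₀ : ∫⁻ t, powInt p (w₀ t) ∂ν ≤ ENNReal.ofReal K := by
    calc ∫⁻ t, powInt p (w₀ t) ∂ν ≤ ∫⁻ t, liminf (fun n => powInt p (w n t)) atTop ∂ν := by
          refine lintegral_mono_ae ?_
          filter_upwards [hlim] with t ht
          exact (lowerSemicontinuous_iff_le_liminf.mp (lowerSemicontinuous_powInt hβ.two_le) _).trans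
            (liminf_le_liminf_of_le (u := powInt p) ht)
      _ ≤ liminf (fun n => ∫⁻ t, powInt p (w n t) ∂ν) atTop :=
          lintegral_liminf_le' fun n => aemeasurable_powInt hβ.two_le (hw n)
      _ ≤ ENNReal.ofReal K := by
          refine (liminf_le_liminf (Eventually.of_forall hK)).trans ?_
          simp
  refine ⟨hK₀, ?_⟩
  obtain ⟨C, hC, h⟩ := hβ.exists_abs_integral_sub_clampR_le hv
  have hclamp : ∀ (N : ℕ) (u : α → Lp ℝ 2 μ), AEStronglyMeasurable u ν →
      Integrable (fun t => ∫ x, β (clampR N (u t x)) * v x ∂μ) ν := by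
    intro N u hu
    obtain ⟨M, hM, hb⟩ := hβ.exists_bound_clampR N.cast_nonneg
    refine Integrable.of_bound
      ((hβ.continuous_integral_clampR N.cast_nonneg v).comp_aestronglyMeasurable hu)
      (∫ x, M * |v x| ∂μ) (Eventually.of_forall fun t => ?_)
    refine norm_integral_le_of_norm_le ((integrable_coe v).abs.const_mul M)
      (Eventually.of_forall fun x => ?_)
    rw [norm_mul]
    exact mul_le_mul_of_nonneg_right (hb _) (abs_nonneg _)
  -- The time-integrated truncation error sees the curve only through the bound `K`, so the same
  -- estimate serves for every `w n` and for `w₀`.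
  have herr : ∀ (δ : ℝ) (κ : ℕ → ℝ), 0 < δ → (∀ N : ℕ, 1 ≤ N →
      ∀ w : Lp ℝ 2 μ, powInt p w < ⊤ →
        |∫ x, β (w x) * v x ∂μ - ∫ x, β (clampR N (w x)) * v x ∂μ|
          ≤ C * (δ * (powInt p w).toReal) + κ N) → ∀ N : ℕ, 1 ≤ N → ∀ u : α → Lp ℝ 2 μ,
      AEStronglyMeasurable u ν → ∫⁻ t, powInt p (u t) ∂ν ≤ ENNReal.ofReal K →
      |∫ t, ∫ x, β (u t x) * v x ∂μ ∂ν - ∫ t, ∫ x, β (clampR N (u t x)) * v x ∂μ ∂ν|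
        ≤ C * (δ * |K|) + ν.real univ * κ N := by
    intro δ κ hδ hb N hN u hu hK
    have hfin : ∫⁻ t, powInt p (u t) ∂ν < ⊤ := hK.trans_lt ENNReal.ofReal_lt_top
    have hint := integrable_powInt hβ.two_le hu hfin
    rw [← integral_sub (hβ.integrable_integral hu hfin hv) (hclamp N u hu)]
    calc _ ≤ ∫ t, (C * (δ * (powInt p (u t)).toReal) + κ N) ∂ν := by
          refine abs_integral_le_of_abs_le (g := fun t => C * (δ * (powInt p (u t)).toReal) + κ N)
            (((hint.const_mul δ).const_mul C).add (integrable_const _)) ?_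
          filter_upwards [ae_lt_top' (aemeasurable_powInt hβ.two_le hu) hfin.ne] with t ht
          exact hb N hN _ ht
      _ = C * (δ * (∫⁻ t, powInt p (u t) ∂ν).toReal) + ν.real univ * κ N := by
          rw [integral_add ((hint.const_mul δ).const_mul C) (integrable_const _),
            integral_const_mul, integral_const_mul, integral_const, smul_eq_mul,
            integral_toReal (aemeasurable_powInt hβ.two_le hu)
              (ae_lt_top' (aemeasurable_powInt hβ.two_le hu) hfin.ne)]
      _ ≤ _ := by
          gcongr
          refine (ENNReal.toReal_mono ENNReal.ofReal_ne_top hK).trans ?_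
          rcases le_total 0 K with hk | hk
          · rw [ENNReal.toReal_ofReal hk]; exact le_abs_self K
          · rw [ENNReal.ofReal_of_nonpos hk]; simp
  rw [Metric.tendsto_atTop]
  intro e he
  obtain ⟨κ, hκ, hb⟩ := h (e / (8 * (C * (|K| + 1)))) (by positivity)
  have hκ' : Tendsto (fun N => ν.real univ * κ N) atTop (𝓝 0) := by
    simpa using hκ.const_mul (ν.real univ)
  obtain ⟨N₁, hN₁⟩ := (Metric.tendsto_atTop.mp hκ') (e / 8) (by positivity)
  set N := max N₁ 1 with hNdef
  have hκN : ν.real univ * κ N < e / 8 := by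
    have := hN₁ N (le_max_left _ _)
    rw [Real.dist_eq, sub_zero] at this
    exact (le_abs_self _).trans_lt this
  have hsmall : C * (e / (8 * (C * (|K| + 1))) * |K|) ≤ e / 8 := by
    rw [← mul_assoc, mul_div_assoc', div_mul_eq_mul_div, div_le_div_iff₀ (by positivity) (by norm_num)]
    nlinarith [mul_pos hC he, abs_nonneg K]
  have hcl : Tendsto (fun n => ∫ t, ∫ x, β (clampR N (w n t x)) * v x ∂μ ∂ν) atTop
      (𝓝 (∫ t, ∫ x, β (clampR N (w₀ t x)) * v x ∂μ ∂ν)) := by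
    obtain ⟨M, hM, hbM⟩ := hβ.exists_bound_clampR N.cast_nonneg
    refine tendsto_integral_of_dominated_convergence (fun _ => ∫ x, M * |v x| ∂μ)
      (fun n => (hclamp N _ (hw n)).aestronglyMeasurable) (integrable_const _)
      (fun n => Eventually.of_forall fun t => ?_) ?_
    · refine norm_integral_le_of_norm_le ((integrable_coe v).abs.const_mul M)
        (Eventually.of_forall fun x => ?_)
      rw [norm_mul]
      exact mul_le_mul_of_nonneg_right (hbM _) (abs_nonneg _)
    · filter_upwards [hlim] with t ht
      exact ((hβ.continuous_integral_clampR N.cast_nonneg v).tendsto _).comp ht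
  obtain ⟨n₀, hn₀⟩ := (Metric.tendsto_atTop.mp hcl) (e / 4) (by positivity)
  refine ⟨n₀, fun n hn => ?_⟩
  have h1 := herr _ κ (by positivity) hb N (le_max_right _ _) (w n) (hw n) (hK n)
  have h2 := herr _ κ (by positivity) hb N (le_max_right _ _) w₀ hw₀ hK₀
  have h3 := hn₀ n hn
  rw [Real.dist_eq] at h3 ⊢
  rw [abs_le] at h1 h2
  rw [abs_lt] at h3 ⊢
  constructor <;> linarith

end MonotoneGrowth

end Nemytskii

/-! ### Scalar inequalities: averaged increments and Gronwall. -/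

section Scalar

/-- A continuous function whose increments are, on average, bounded by small integrals does not
increase. -/
lemma le_of_averaged_increments {G : ℝ → ℝ} (hG : Continuous G) {a b : ℝ} (hab : a ≤ b)
    (H : ∀ e > 0, ∃ h₀ > 0, ∀ h, 0 < h → h < h₀ → ∃ q : ℝ → ℝ, (∀ t, 0 ≤ q t) ∧ Integrable q ∧
      ∫ t, q t ≤ e ∧ ∀ᵐ t, t ∈ Icc a b →
        G (t + h) - G t ≤ (∫ r in t..(t + h), q r) + h * (q t + q (t + h))) :
    G b ≤ G a := by
  refine le_of_forall_pos_le_add fun e he => ?_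
  -- Five errors of size `e / 5` add up: three from `q` (the primitive, `q t` and `q (t + h)`) and
  -- one at each endpoint from the continuity of `G`.
  obtain ⟨h₀, hh₀, H⟩ := H (e / 5) (by positivity)
  obtain ⟨d₁, hd₁, hb⟩ := Metric.continuous_iff.mp hG b (e / 5) (by positivity)
  obtain ⟨d₂, hd₂, ha⟩ := Metric.continuous_iff.mp hG a (e / 5) (by positivity)
  set h := min h₀ (min d₁ d₂) / 2 with hh
  have hpos : 0 < h := by positivity
  have hm : 0 < min h₀ (min d₁ d₂) := by positivity
  have hlt0 : h < h₀ := by linarith [min_le_left h₀ (min d₁ d₂)]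
  have hlt1 : h < d₁ := by
    linarith [(min_le_right h₀ (min d₁ d₂)).trans (min_le_left _ _)]
  have hlt2 : h < d₂ := by
    linarith [(min_le_right h₀ (min d₁ d₂)).trans (min_le_right _ _)]
  obtain ⟨q, hq0, hqi, hqe, hq⟩ := H h hpos hlt0
  have hGi : ∀ x y, IntervalIntegrable G volume x y := fun x y => hG.intervalIntegrable x y
  have hqI : ∀ x y, IntervalIntegrable q volume x y := fun x y => hqi.intervalIntegrable
  set Q : ℝ → ℝ := fun t => ∫ r in a..t, q r with hQ
  have hQc : Continuous Q := intervalIntegral.continuous_primitive hqI a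
  have hQd : ∀ x y, Q y - Q x = ∫ r in x..y, q r := fun x y => by
    rw [hQ]; exact intervalIntegral.integral_interval_sub_left (hqI _ _) (hqI _ _)
  have hle : ∀ x y, x ≤ y → ∫ r in x..y, q r ≤ e / 5 := fun x y hxy => by
    rw [intervalIntegral.integral_of_le hxy]
    exact (setIntegral_le_integral hqi (Eventually.of_forall hq0)).trans hqe
  have hnn : ∀ x y, x ≤ y → 0 ≤ ∫ r in x..y, q r := fun x y hxy =>
    intervalIntegral.integral_nonneg hxy fun r _ => hq0 r
  -- Averaging the increments over `[a, b]` telescopes to the windows `[b, b + h]` and `[a, a + h]`.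
  -- This is applied to `G`, whose windows are close to `h * G b` and `h * G a`, and to the
  -- primitive of `q`.
  have hshift : ∀ K : ℝ → ℝ, Continuous K → ∫ t in a..b, (K (t + h) - K t) =
      (∫ t in b..(b + h), K t) - ∫ t in a..(a + h), K t := by
    intro K hK
    have hKi : ∀ x y, IntervalIntegrable K volume x y := fun x y => hK.intervalIntegrable x y
    have hKh : Continuous fun t => K (t + h) := hK.comp (continuous_add_const h)
    rw [intervalIntegral.integral_sub (hKh.intervalIntegrable _ _) (hKi _ _),
      intervalIntegral.integral_comp_add_right,
      ← intervalIntegral.integral_add_adjacent_intervals (hKi (a + h) b) (hKi b (b + h)),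
      ← intervalIntegral.integral_add_adjacent_intervals (hKi a (a + h)) (hKi (a + h) b)]
    ring
  have hqsh : IntervalIntegrable (fun t => q (t + h)) volume a b :=
    (hqi.comp_add_right h).intervalIntegrable
  have hmono : ∫ t in a..b, (G (t + h) - G t)
      ≤ ∫ t in a..b, ((Q (t + h) - Q t) + h * (q t + q (t + h))) := by
    refine intervalIntegral.integral_mono_ae_restrict hab ?_ ?_ ?_
    · exact ((hG.comp (continuous_add_const h)).sub hG).intervalIntegrable _ _
    · exact (((hQc.comp (continuous_add_const h)).sub hQc).intervalIntegrable _ _).add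
        (((hqI a b).add hqsh).const_mul h)
    · filter_upwards [ae_restrict_of_ae hq, ae_restrict_mem measurableSet_Icc] with t ht htm
      simpa [hQd] using ht htm
  have hR : ∫ t in a..b, ((Q (t + h) - Q t) + h * (q t + q (t + h))) ≤ h * (3 * (e / 5)) := by
    have hQh : Continuous fun t => Q (t + h) - Q t :=
      (hQc.comp (continuous_add_const h)).sub hQc
    rw [intervalIntegral.integral_add (hQh.intervalIntegrable _ _)
      (((hqI a b).add hqsh).const_mul h), hshift Q hQc, intervalIntegral.integral_const_mul,
      intervalIntegral.integral_add (hqI a b) hqsh, intervalIntegral.integral_comp_add_right]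
    have h1 : ∫ t in b..(b + h), Q t ≤ h * (e / 5) := by
      calc ∫ t in b..(b + h), Q t ≤ ∫ t in b..(b + h), e / 5 :=
            intervalIntegral.integral_mono_on (by linarith) (hQc.intervalIntegrable _ _)
              (by simp) fun t ht => hle _ _ (hab.trans ht.1)
        _ = h * (e / 5) := by rw [intervalIntegral.integral_const, smul_eq_mul]; ring
    have h2 : 0 ≤ ∫ t in a..(a + h), Q t :=
      intervalIntegral.integral_nonneg (by linarith) fun t ht => hnn _ _ ht.1
    have h3 := hle a b hab
    have h4 := hle (a + h) (b + h) (by linarith)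
    nlinarith
  rw [hshift G hG] at hmono
  have hB : h * (G b - e / 5) ≤ ∫ t in b..(b + h), G t := by
    calc h * (G b - e / 5) = ∫ t in b..(b + h), (G b - e / 5) := by
          rw [intervalIntegral.integral_const, smul_eq_mul]; ring
      _ ≤ _ := intervalIntegral.integral_mono_on (by linarith) (by simp) (hGi _ _) fun t ht => by
          have := hb t (by rw [Real.dist_eq, abs_lt]; constructor <;> linarith [ht.1, ht.2])
          rw [Real.dist_eq, abs_lt] at this; linarith
  have hA : ∫ t in a..(a + h), G t ≤ h * (G a + e / 5) := by
    calc _ ≤ ∫ t in a..(a + h), (G a + e / 5) :=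
          intervalIntegral.integral_mono_on (by linarith) (hGi _ _) (by simp) fun t ht => by
          have := ha t (by rw [Real.dist_eq, abs_lt]; constructor <;> linarith [ht.1, ht.2])
          rw [Real.dist_eq, abs_lt] at this; linarith
      _ = _ := by rw [intervalIntegral.integral_const, smul_eq_mul]; ring
  have : h * (G b) ≤ h * (G a + e) := by linarith
  exact le_of_mul_le_mul_left this hpos

/-- Gronwall's inequality in integral form. -/
lemma gronwall_integral {E : ℝ → ℝ} (hE : Continuous E) {a b A C : ℝ} (hab : a ≤ b) (hC : 0 ≤ C)
    (h : ∀ t ∈ Icc a b, E t ≤ A + C * ∫ r in a..t, E r) :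
    E b ≤ A * Real.exp (C * (b - a)) := by
  set y : ℝ → ℝ := fun t => A + C * ∫ r in a..t, E r with hy
  have hd : ∀ t, HasDerivAt y (C * E t) t := fun t =>
    ((intervalIntegral.integral_hasDerivAt_right (hE.intervalIntegrable _ _)
      hE.stronglyMeasurable.stronglyMeasurableAtFilter hE.continuousAt).const_mul C).const_add A
  have hd' : ∀ t, HasDerivAt (fun t => y t * Real.exp (-(C * (t - a))))
      (C * E t * Real.exp (-(C * (t - a))) + y t * (Real.exp (-(C * (t - a))) * -(C * 1))) t :=
    fun t => (hd t).mul ((((hasDerivAt_id t).sub_const a).const_mul C).neg.exp)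
  have hanti : AntitoneOn (fun t => y t * Real.exp (-(C * (t - a)))) (Icc a b) := by
    refine antitoneOn_of_deriv_nonpos (convex_Icc a b)
      (fun t _ => (hd' t).continuousAt.continuousWithinAt)
      (fun t _ => (hd' t).differentiableAt.differentiableWithinAt) fun t ht => ?_
    rw [interior_Icc] at ht
    rw [(hd' t).deriv]
    have h1 := h t ⟨ht.1.le, ht.2.le⟩
    have h2 := Real.exp_pos (-(C * (t - a)))
    have h3 : 0 ≤ C * Real.exp (-(C * (t - a))) * (y t - E t) :=
      mul_nonneg (by positivity) (by rw [hy]; linarith)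
    linarith
  have h1 := hanti (left_mem_Icc.mpr hab) (right_mem_Icc.mpr hab) hab
  have hya : y a = A := by simp [hy]
  simp only [hya, sub_self, mul_zero, neg_zero, Real.exp_zero, mul_one] at h1
  refine (h b (right_mem_Icc.mpr hab)).trans ?_
  rw [Real.exp_neg, ← div_eq_mul_inv, div_le_iff₀ (Real.exp_pos _)] at h1
  exact h1

end Scalar

/-! ### The quadratic forms of the gradient and of the energy. -/

section Forms

variable {X : Type*} [MeasurableSpace X] {μ : Measure X}
variable {V : Type*} [NormedAddCommGroup V] [InnerProductSpace ℝ V] [CompleteSpace V]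

/-- The operator of the form `⟨u, v⟩ - (ι u, ι v)`; for `H₀¹ ⊆ L²` this is `(∇u, ∇v)`. -/
noncomputable def gradOp (ι : V →L[ℝ] Lp ℝ 2 μ) : V →L[ℝ] V :=
  ContinuousLinearMap.id ℝ V - (ContinuousLinearMap.adjoint ι) ∘L ι

/-- The operator of the form `(ι u, ι v) + e (⟨u, v⟩ - (ι u, ι v))`. -/
noncomputable def energyOp (ι : V →L[ℝ] Lp ℝ 2 μ) (e : ℝ) : V →L[ℝ] V :=
  (ContinuousLinearMap.adjoint ι) ∘L ι + e • gradOp ι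

variable (ι : V →L[ℝ] Lp ℝ 2 μ)

lemma inner_gradOp (u v : V) :
    inner ℝ (gradOp ι u) v = inner ℝ u v - inner ℝ (ι u) (ι v) := by
  simp [gradOp, inner_sub_left, ContinuousLinearMap.adjoint_inner_left]

lemma inner_energyOp (e : ℝ) (u v : V) :
    inner ℝ (energyOp ι e u) v = inner ℝ (ι u) (ι v) + e * inner ℝ (gradOp ι u) v := by
  simp [energyOp, inner_add_left, inner_smul_left, ContinuousLinearMap.adjoint_inner_left]

lemma inner_gradOp_comm (u v : V) : inner ℝ (gradOp ι u) v = inner ℝ (gradOp ι v) u := by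
  rw [inner_gradOp, inner_gradOp, real_inner_comm u v, real_inner_comm (ι u)]

lemma inner_energyOp_comm (e : ℝ) (u v : V) :
    inner ℝ (energyOp ι e u) v = inner ℝ (energyOp ι e v) u := by
  rw [inner_energyOp, inner_energyOp, inner_gradOp_comm, real_inner_comm (ι u)]

variable {ι} (hι : ∀ v, ‖ι v‖ ≤ ‖v‖)
include hι

lemma inner_gradOp_self_nonneg (v : V) : 0 ≤ inner ℝ (gradOp ι v) v := by
  rw [inner_gradOp, real_inner_self_eq_norm_sq, real_inner_self_eq_norm_sq, sub_nonneg]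
  gcongr; exact hι v

lemma norm_gradOp_le : ‖gradOp ι‖ ≤ 2 := by
  have h1 : ‖ι‖ ≤ 1 := ι.opNorm_le_bound zero_le_one fun v => by simpa using hι v
  refine (norm_sub_le _ _).trans ?_
  have h2 : ‖ContinuousLinearMap.id ℝ V‖ ≤ 1 := ContinuousLinearMap.norm_id_le
  have h3 : ‖(ContinuousLinearMap.adjoint ι) ∘L ι‖ ≤ 1 := by
    refine (ContinuousLinearMap.opNorm_comp_le _ _).trans ?_
    rw [LinearIsometryEquiv.norm_map]
    nlinarith [norm_nonneg ι]
  linarith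

lemma abs_inner_gradOp_le (u v : V) : |inner ℝ (gradOp ι u) v| ≤ 2 * ‖u‖ * ‖v‖ := by
  refine (abs_real_inner_le_norm _ _).trans ?_
  gcongr
  exact (ContinuousLinearMap.le_opNorm _ _).trans (by gcongr; exact norm_gradOp_le hι)

/-- Both parts of `‖v‖² = ‖ι v‖² + ⟨Q v, v⟩` are nonnegative, and in the energy they carry the
weights `1` and `e`, each at least `e₀`. -/
lemma le_inner_energyOp_self {e₀ e : ℝ} (h1 : e₀ ≤ 1) (he : e₀ ≤ e) (v : V) :
    e₀ * ‖v‖ ^ 2 ≤ inner ℝ (energyOp ι e v) v := by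
  have := inner_gradOp_self_nonneg hι v
  have h2 : e₀ * inner ℝ (gradOp ι v) v ≤ e * inner ℝ (gradOp ι v) v := by gcongr
  rw [inner_energyOp]
  rw [inner_gradOp, real_inner_self_eq_norm_sq] at h2 ⊢
  rw [real_inner_self_eq_norm_sq] at *
  nlinarith [sq_nonneg ‖ι v‖]

lemma inner_energyOp_self_le {e : ℝ} (he : 0 ≤ e) (v : V) :
    inner ℝ (energyOp ι e v) v ≤ (1 + 2 * e) * ‖v‖ ^ 2 := by
  rw [inner_energyOp, real_inner_self_eq_norm_sq]
  have h1 := (abs_le.mp (abs_inner_gradOp_le hι v v)).2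
  have h2 : ‖ι v‖ ^ 2 ≤ ‖v‖ ^ 2 := by gcongr; exact hι v
  nlinarith

lemma norm_energyOp_apply_le {e : ℝ} (he : 0 ≤ e) (v : V) :
    ‖energyOp ι e v‖ ≤ (1 + 2 * e) * ‖v‖ := by
  have h1 : ‖ι‖ ≤ 1 := ι.opNorm_le_bound zero_le_one fun v => by simpa using hι v
  have h2 : ‖gradOp ι v‖ ≤ 2 * ‖v‖ :=
    (ContinuousLinearMap.le_opNorm _ _).trans (by gcongr; exact norm_gradOp_le hι)
  have h3 : ‖ContinuousLinearMap.adjoint ι (ι v)‖ ≤ ‖v‖ := by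
    refine (ContinuousLinearMap.le_opNorm _ _).trans ?_
    rw [LinearIsometryEquiv.norm_map]
    nlinarith [norm_nonneg ι, hι v, norm_nonneg v, norm_nonneg (ι v)]
  calc ‖energyOp ι e v‖ ≤ ‖ContinuousLinearMap.adjoint ι (ι v)‖ + ‖e • gradOp ι v‖ := by
        simp only [energyOp, _root_.add_apply, ContinuousLinearMap.comp_apply,
          _root_.smul_apply]
        exact norm_add_le _ _
    _ ≤ _ := by
        rw [norm_smul, Real.norm_of_nonneg he]
        nlinarith

omit hι in
lemma continuous_energyOp : Continuous fun e => energyOp ι e := by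
  unfold energyOp; fun_prop

end Forms

/-! ### Tails of the `Lᵖ` integral. -/

section TailInt

variable {X : Type*} [MeasurableSpace X] {μ : Measure X}

/-- The integral of the part of `|w|ᵖ` above the level `N`. -/
noncomputable def tailInt (p N : ℝ) (w : Lp ℝ 2 μ) : ENNReal :=
  ∫⁻ x, ENNReal.ofReal (|w x| ^ p - N) ∂μ

lemma tailInt_le_powInt {p N : ℝ} (hN : 0 ≤ N) (w : Lp ℝ 2 μ) : tailInt p N w ≤ powInt p w :=
  lintegral_mono fun x => ENNReal.ofReal_le_ofReal (by linarith)

lemma aemeasurable_tailInt {α : Type*} [MeasurableSpace α] {ν : Measure α} {p : ℝ} (hp : 2 ≤ p)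
    (N : ℝ) {w : α → Lp ℝ 2 μ} (hw : AEStronglyMeasurable w ν) :
    AEMeasurable (fun t => tailInt p N (w t)) ν := by
  let _ : MeasurableSpace (Lp ℝ 2 μ) := borel _
  have : BorelSpace (Lp ℝ 2 μ) := ⟨rfl⟩
  exact (lowerSemicontinuous_lintegral_comp
    ((continuous_abs_rpow hp).sub continuous_const)).measurable.comp_aemeasurable hw.aemeasurable

lemma tendsto_tailInt {p : ℝ} (hp : 2 ≤ p) {w : Lp ℝ 2 μ} (hw : powInt p w < ⊤) :
    Tendsto (fun N : ℕ => tailInt p N w) atTop (𝓝 0) := by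
  have : Tendsto (fun N : ℕ => tailInt p N w) atTop (𝓝 (∫⁻ _, 0 ∂μ)) := by
    refine tendsto_lintegral_of_dominated_convergence' (fun x => ENNReal.ofReal (|w x| ^ p))
      (fun N => ?_) (fun N => Eventually.of_forall fun x => ?_) hw.ne
      (Eventually.of_forall fun x => ?_)
    · exact ((aemeas_pow hp w).aemeasurable.sub_const _).ennreal_ofReal
    · exact ENNReal.ofReal_le_ofReal (by linarith [N.cast_nonneg (α := ℝ)])
    · refine tendsto_const_nhds.congr' ?_
      obtain ⟨n, hn⟩ := exists_nat_gt (|w x| ^ p)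
      filter_upwards [eventually_ge_atTop n] with N hN
      rw [ENNReal.ofReal_of_nonpos]
      have : (n:ℝ) ≤ N := by exact_mod_cast hN
      linarith
  simpa using this

lemma tendsto_integral_tailInt {α : Type*} [MeasurableSpace α] {ν : Measure α} {p : ℝ}
    (hp : 2 ≤ p) {w : α → Lp ℝ 2 μ} (hw : AEStronglyMeasurable w ν)
    (hfin : ∫⁻ t, powInt p (w t) ∂ν < ⊤) :
    Tendsto (fun N : ℕ => ∫ t, (tailInt p N (w t)).toReal ∂ν) atTop (𝓝 0) := by
  have hae := ae_lt_top' (aemeasurable_powInt hp hw) hfin.ne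
  have : Tendsto (fun N : ℕ => ∫ t, (tailInt p N (w t)).toReal ∂ν) atTop
      (𝓝 (∫ _, (0:ℝ) ∂ν)) := by
    refine tendsto_integral_of_dominated_convergence _ (fun N => ?_)
      (integrable_powInt hp hw hfin) (fun N => ?_) ?_
    · exact (aemeasurable_tailInt hp N hw).ennreal_toReal.aestronglyMeasurable
    · filter_upwards [hae] with t ht
      rw [Real.norm_of_nonneg ENNReal.toReal_nonneg]
      exact ENNReal.toReal_mono ht.ne (tailInt_le_powInt N.cast_nonneg _)
    · filter_upwards [hae] with t ht
      have := (ENNReal.tendsto_toReal ENNReal.zero_ne_top).comp (tendsto_tailInt hp ht)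
      simpa [Function.comp_def] using this
  simpa using this

lemma integral_tail_eq {p : ℝ} (hp : 2 ≤ p) (N : ℝ) (w : Lp ℝ 2 μ) :
    ∫ x, max (|w x| ^ p - N) 0 ∂μ = (tailInt p N w).toReal := by
  rw [integral_eq_lintegral_of_nonneg_ae (f := fun x => max (|w x| ^ p - N) 0)
    (Eventually.of_forall fun x => le_max_right _ _) (AEStronglyMeasurable.sup (f := fun x => |w x| ^ p - N) (g := fun _ => 0)
      ((aemeas_pow hp w).sub aestronglyMeasurable_const) aestronglyMeasurable_const)]
  congr 1
  refine lintegral_congr fun x => ?_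
  rcases le_total (|w x| ^ p - N) 0 with h | h
  · rw [max_eq_right h, ENNReal.ofReal_of_nonpos h, ENNReal.ofReal_zero]
  · rw [max_eq_left h]

/-- If `|r| ^ p ≤ 2 * N`, then `r` is bounded and the term linear in `|y|` suffices. Otherwise `|r|
^ p ≤ 2 * (|r| ^ p - N)`, and comparing `|r|` with `δ * |y|` leaves either the tail term or the term
`δ * |y| ^ p`. -/
lemma rpow_pred_mul_le_tail {p δ N : ℝ} (hp : 2 ≤ p) (hδ : 0 < δ) (hδ1 : δ ≤ 1) (hN : 0 ≤ N)
    (r y : ℝ) :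
    |r| ^ (p - 1) * |y| ≤ (1 + 2 * N) * |y| + δ * |y| ^ p + 2 / δ * max (|r| ^ p - N) 0 := by
  have e1 : ∀ a : ℝ, 0 ≤ a → a ^ p = a ^ (p - 1) * a := fun a ha => by
    rcases ha.eq_or_lt with h | h
    · rw [← h, Real.zero_rpow (by linarith), mul_zero]
    · rw [← Real.rpow_add_one h.ne']; congr 1; ring
  have hm : 0 ≤ max (|r| ^ p - N) 0 := le_max_right _ _
  have hm1 := le_max_left (|r| ^ p - N) 0
  have hy := Real.rpow_nonneg (abs_nonneg y) p
  have hyn := abs_nonneg y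
  rcases le_or_gt (|r| ^ p) (2 * N) with h | h
  · have h1 : |r| ^ (p - 1) ≤ 1 + |r| ^ p := by
      rcases le_total |r| 1 with h | h
      · have := Real.rpow_le_one (abs_nonneg r) h (by linarith : 0 ≤ p - 1)
        linarith [Real.rpow_nonneg (abs_nonneg r) p]
      · have := Real.rpow_le_rpow_of_exponent_le h (by linarith : p - 1 ≤ p)
        linarith
    have h2 : |r| ^ (p - 1) * |y| ≤ (1 + 2 * N) * |y| := by gcongr; linarith
    have h3 : 0 ≤ δ * |y| ^ p + 2 / δ * max (|r| ^ p - N) 0 := by positivity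
    linarith
  · have h0 : 0 ≤ (1 + 2 * N) * |y| := by positivity
    rcases le_or_gt (δ * |y|) |r| with h' | h'
    · have h1 : |y| ≤ |r| / δ := by rw [le_div_iff₀ hδ]; linarith
      have h2 : |r| ^ (p - 1) * |y| ≤ |r| ^ p / δ := by
        rw [e1 |r| (abs_nonneg r), mul_div_assoc]; gcongr
      have h3 : |r| ^ p / δ ≤ 2 / δ * max (|r| ^ p - N) 0 := by
        rw [div_mul_eq_mul_div]; gcongr; linarith
      have h4 : 0 ≤ δ * |y| ^ p := by positivity
      linarith
    · have h1 : |r| ^ (p - 1) ≤ δ * |y| ^ (p - 1) := by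
        refine (Real.rpow_le_rpow (abs_nonneg _) h'.le (by linarith)).trans ?_
        rw [Real.mul_rpow hδ.le hyn]
        gcongr
        calc δ ^ (p - 1) ≤ δ ^ (1:ℝ) := Real.rpow_le_rpow_of_exponent_ge hδ hδ1 (by linarith)
          _ = δ := Real.rpow_one δ
      have h2 := mul_le_mul_of_nonneg_right h1 hyn
      rw [e1 |y| hyn]
      have h4 : 0 ≤ 2 / δ * max (|r| ^ p - N) 0 := by positivity
      linarith

lemma powInt_add_toReal_le {p : ℝ} (hp : 2 ≤ p) {v w : Lp ℝ 2 μ} (hv : powInt p v < ⊤)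
    (hw : powInt p w < ⊤) :
    (powInt p (v + w)).toReal ≤ 2 ^ p * ((powInt p v).toReal + (powInt p w).toReal) := by
  have h1 := powInt_add_lt_top hp hv hw
  rw [← integral_pow_eq hp, ← integral_pow_eq hp, ← integral_pow_eq hp]
  rw [← integrable_pow_iff hp] at *
  rw [← integral_add hv hw, ← integral_const_mul]
  refine integral_mono_ae h1 ((hv.add hw).const_mul _) ?_
  filter_upwards [Lp.coeFn_add v w] with x hx
  rw [hx]
  exact rpow_add_le hp _ _

lemma powInt_neg {p : ℝ} (v : Lp ℝ 2 μ) : powInt p (-v) = powInt p v := by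
  refine lintegral_congr_ae ?_
  filter_upwards [Lp.coeFn_neg v] with x hx
  rw [hx, Pi.neg_apply, abs_neg]

lemma powInt_sub_toReal_le {p : ℝ} (hp : 2 ≤ p) {v w : Lp ℝ 2 μ} (hv : powInt p v < ⊤)
    (hw : powInt p w < ⊤) :
    (powInt p (v - w)).toReal ≤ 2 ^ p * ((powInt p v).toReal + (powInt p w).toReal) := by
  rw [sub_eq_add_neg, ← powInt_neg w]
  exact powInt_add_toReal_le hp hv (by rwa [powInt_neg])

variable [IsFiniteMeasure μ]

/-- The pairing with `y` becomes small when `y` is small in `L²` and merely bounded in `Lᵖ`. The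
three terms are made small in turn: `δ` against the `Lᵖ` integral of `y`, then `N` against the tail
of `w`, and finally the `L²` norm of `y`. -/
lemma MonotoneGrowth.exists_abs_integral_le_tail {β : ℝ → ℝ} {p : ℝ} (hβ : MonotoneGrowth β p) :
    ∃ C, 0 < C ∧ ∀ δ N : ℝ, 0 < δ → δ ≤ 1 → 0 ≤ N → ∀ w y : Lp ℝ 2 μ,
      powInt p w < ⊤ → powInt p y < ⊤ →
      |∫ x, β (w x) * y x ∂μ| ≤ C * ((2 + 2 * N) * ‖y‖ + δ * (powInt p y).toReal
        + 2 / δ * (tailInt p N w).toReal) := by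
  obtain ⟨C, hC, h⟩ := hβ.growth
  set m := Real.sqrt (μ.real univ)
  refine ⟨C * (1 + m), by positivity, fun δ N hδ hδ1 hN w y hw hy => ?_⟩
  have hp := hβ.two_le
  have hy' := (integrable_pow_iff hp y).mpr hy
  have hw' : Integrable (fun x => max (|w x| ^ p - N) 0) μ :=
    (((integrable_pow_iff hp w).mpr hw).sub (integrable_const N)).pos_part
  have hI1 := ((integrable_coe y).abs.const_mul (2 + 2 * N))
  have hI2 := (hy'.const_mul δ)
  have hI3 := (hw'.const_mul (2 / δ))
  have h1 : |∫ x, β (w x) * y x ∂μ| ≤ ∫ x, C * ((2 + 2 * N) * |y x| + δ * |y x| ^ p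
      + 2 / δ * max (|w x| ^ p - N) 0) ∂μ := by
    refine abs_integral_le_of_abs_le (((hI1.add hI2).add hI3).const_mul C)
      (Eventually.of_forall fun x => ?_)
    rw [abs_mul]
    have h2 := mul_le_mul_of_nonneg_right (h (w x)) (abs_nonneg (y x))
    have h3 := rpow_pred_mul_le_tail hp hδ hδ1 hN (w x) (y x)
    calc _ ≤ _ := h2
      _ = C * (|y x| + |w x| ^ (p - 1) * |y x|) := by ring
      _ ≤ _ := by refine mul_le_mul_of_nonneg_left ?_ hC.le; linarith
  have hI12 : Integrable (fun x => (2 + 2 * N) * |y x| + δ * |y x| ^ p) μ := hI1.add hI2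
  rw [integral_const_mul, integral_add hI12 hI3, integral_add hI1 hI2,
    integral_const_mul, integral_const_mul, integral_const_mul, integral_pow_eq hp,
    integral_tail_eq hp] at h1
  refine h1.trans ?_
  have h4 := integral_abs_le y
  have h5 : 0 ≤ (powInt p y).toReal := ENNReal.toReal_nonneg
  have h6 : 0 ≤ (tailInt p N w).toReal := ENNReal.toReal_nonneg
  have hm : 0 ≤ m := Real.sqrt_nonneg _
  rw [mul_assoc]
  gcongr
  have h7 : (2 + 2 * N) * ∫ x, |y x| ∂μ ≤ (2 + 2 * N) * (m * ‖y‖) := by gcongr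
  have h8 : 0 ≤ δ * (powInt p y).toReal := by positivity
  have h9 : 0 ≤ 2 / δ * (tailInt p N w).toReal := by positivity
  have h10 : 0 ≤ (2 + 2 * N) * ‖y‖ := by positivity
  nlinarith

end TailInt

/-! ### Locally square integrable curves. -/

section LocSq

variable {V : Type*} [NormedAddCommGroup V]

/-- Locally square integrable functions of time. -/
def LocSqIntegrable (F : ℝ → V) : Prop := ∀ b c : ℝ, MemLp F 2 (volume.restrict (Icc b c))

lemma uIoc_subset_Icc_min_max (x y : ℝ) : uIoc x y ⊆ Icc (min x y) (max x y) := Ioc_subset_Icc_self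

namespace LocSqIntegrable

variable {F F' : ℝ → V}

lemma sub (hF : LocSqIntegrable F) (hF' : LocSqIntegrable F') :
    LocSqIntegrable fun t => F t - F' t := fun b c => (hF b c).sub (hF' b c)

lemma add (hF : LocSqIntegrable F) (hF' : LocSqIntegrable F') :
    LocSqIntegrable fun t => F t + F' t := fun b c => (hF b c).add (hF' b c)

lemma integrableOn (hF : LocSqIntegrable F) (b c : ℝ) : IntegrableOn F (Icc b c) :=
  (hF b c).integrable (by norm_num)

lemma integrableOn_sq (hF : LocSqIntegrable F) (b c : ℝ) :
    IntegrableOn (fun r => ‖F r‖ ^ 2) (Icc b c) := (hF b c).integrable_norm_pow (by norm_num)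

lemma intervalIntegrable_sq (hF : LocSqIntegrable F) (x y : ℝ) :
    IntervalIntegrable (fun r => ‖F r‖ ^ 2) volume x y := by
  rw [intervalIntegrable_iff]
  exact (hF.integrableOn_sq _ _).mono_set (uIoc_subset_Icc_min_max x y)

lemma intervalIntegrable_inner [InnerProductSpace ℝ V] (hF : LocSqIntegrable F) {z : ℝ → V}
    (hz : Continuous z) (x y : ℝ) :
    IntervalIntegrable (fun r => inner ℝ (F r) (z r)) volume x y := by
  rw [intervalIntegrable_iff]
  have hI := (hF.integrableOn _ _).mono_set (uIoc_subset_Icc_min_max x y)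
  obtain ⟨M, hM⟩ := (isCompact_Icc (a := min x y) (b := max x y)).exists_bound_of_continuousOn
    hz.continuousOn
  refine (hI.norm.mul_const M).mono' (hI.aestronglyMeasurable.inner hz.aestronglyMeasurable) ?_
  filter_upwards [ae_restrict_mem measurableSet_uIoc] with r hr
  refine (norm_inner_le_norm _ _).trans ?_
  gcongr
  exact hM r (uIoc_subset_Icc_min_max x y hr)

end LocSqIntegrable

lemma Continuous.locSqIntegrable {F : ℝ → V} (hF : Continuous F) : LocSqIntegrable F := by
  intro b c
  obtain ⟨M, hM⟩ := (isCompact_Icc (a := b) (b := c)).exists_bound_of_continuousOn hF.continuousOn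
  refine MemLp.of_bound (hF.aestronglyMeasurable) M ?_
  filter_upwards [ae_restrict_mem measurableSet_Icc] with r hr
  exact hM r hr

end LocSq

/-! ### The energy inequality for the difference of two integral solutions. -/

section Energy

variable {X : Type*} [MeasurableSpace X] {μ : Measure X} [IsFiniteMeasure μ]
variable {V : Type*} [NormedAddCommGroup V] [InnerProductSpace ℝ V] [CompleteSpace V]

/-- Solutions, in integrated form, of `d/dt (B(t) u) = ε' Q u + F - β(u)` on `[τ, ∞)`, where
`Q = gradOp ι` and `B(t) = energyOp ι (ε t)`. -/
structure IsIntegralSolution (ι : V →L[ℝ] Lp ℝ 2 μ) (ε β : ℝ → ℝ) (p τ : ℝ) (F u : ℝ → V) :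
    Prop where
  cont : Continuous u
  pow : ∀ T, ∫⁻ t in Ioc τ T, powInt p (ι (u t)) < ⊤
  eq : ∀ v, powInt p (ι v) < ⊤ → ∀ s t, τ ≤ s → s ≤ t →
    inner ℝ (energyOp ι (ε t) (u t)) v - inner ℝ (energyOp ι (ε s) (u s)) v =
      ∫ r in s..t, (deriv ε r * inner ℝ (gradOp ι (u r)) v + inner ℝ (F r) v
        - ∫ x, β (ι (u r) x) * ι v x ∂μ)

variable {ι : V →L[ℝ] Lp ℝ 2 μ} {ε β : ℝ → ℝ} {p τ : ℝ} {F F₁ F₂ u u₁ u₂ : ℝ → V}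

lemma IsIntegralSolution.ae_lt_top (hp : 2 ≤ p) (hu : IsIntegralSolution ι ε β p τ F u) :
    ∀ᵐ t, τ < t → powInt p (ι (u t)) < ⊤ := by
  have h : ∀ n : ℕ, ∀ᵐ t, t ∈ Ioc τ n → powInt p (ι (u t)) < ⊤ := fun n => by
    rw [← ae_restrict_iff' measurableSet_Ioc]
    exact ae_lt_top' (aemeasurable_powInt hp
      (ι.continuous.comp hu.cont).aestronglyMeasurable) (hu.pow n).ne
  filter_upwards [ae_all_iff.mpr h] with t ht hτ
  obtain ⟨n, hn⟩ := exists_nat_ge t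
  exact ht n ⟨hτ, hn⟩

lemma IsIntegralSolution.intervalIntegrable_nonlinear (hβ : MonotoneGrowth β p)
    (hu : IsIntegralSolution ι ε β p τ F u) {v : V} (hv : powInt p (ι v) < ⊤) {s t : ℝ}
    (hs : τ ≤ s) (hst : s ≤ t) :
    IntervalIntegrable (fun r => ∫ x, β (ι (u r) x) * ι v x ∂μ) volume s t := by
  rw [intervalIntegrable_iff_integrableOn_Ioc_of_le hst]
  refine hβ.integrable_integral (ι.continuous.comp hu.cont).aestronglyMeasurable ?_ hv
  exact (lintegral_mono_set (Ioc_subset_Ioc_left hs)).trans_lt (hu.pow t)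

lemma continuous_deriv_mul_inner (hε : ContDiff ℝ 1 ε) {a b : ℝ → V} (ha : Continuous a)
    (hb : Continuous b) : Continuous fun r => deriv ε r * inner ℝ (gradOp ι (a r)) (b r) :=
  (hε.continuous_deriv le_rfl).mul (((gradOp ι).continuous.comp ha).inner hb)

lemma IsIntegralSolution.integrable_pow_Ioc (hp : 2 ≤ p)
    (hu : IsIntegralSolution ι ε β p τ F u) {s t : ℝ} (hs : τ ≤ s) :
    IntegrableOn (fun r => (powInt p (ι (u r))).toReal) (Ioc s t) :=
  integrable_powInt hp (ι.continuous.comp hu.cont).aestronglyMeasurable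
    ((lintegral_mono_set (Ioc_subset_Ioc_left hs)).trans_lt (hu.pow t))

/-- The factor `(2 ^ p) ^ 3` comes from three nested uses of `|r + s| ^ p ≤ 2 ^ p * (|r| ^ p + |s| ^
p)`, and the `2` from the two occurrences of `c - c'`. -/
lemma powInt_second_difference_le (hp : 2 ≤ p) {a b c a' b' c' : Lp ℝ 2 μ}
    (ha : powInt p a < ⊤) (hb : powInt p b < ⊤) (hc : powInt p c < ⊤)
    (ha' : powInt p a' < ⊤) (hb' : powInt p b' < ⊤) (hc' : powInt p c' < ⊤) :
    (powInt p ((a - a') - (c - c') + ((b - b') - (c - c')))).toReal ≤ 2 * (2 ^ p) ^ 3 *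
      (((powInt p a).toReal + (powInt p a').toReal) + ((powInt p b).toReal + (powInt p b').toReal)
      + ((powInt p c).toReal + (powInt p c').toReal)) := by
  have fa := powInt_sub_lt_top hp ha ha'
  have fb := powInt_sub_lt_top hp hb hb'
  have fc := powInt_sub_lt_top hp hc hc'
  have h0 := powInt_add_toReal_le hp (powInt_sub_lt_top hp fa fc) (powInt_sub_lt_top hp fb fc)
  have h1 := powInt_sub_toReal_le hp fa fc
  have h2 := powInt_sub_toReal_le hp fb fc
  have h3 := powInt_sub_toReal_le hp ha ha'
  have h4 := powInt_sub_toReal_le hp hb hb'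
  have h5 := powInt_sub_toReal_le hp hc hc'
  have hpp : (0:ℝ) < 2 ^ p := by positivity
  generalize (2:ℝ) ^ p = k at *
  have n1 : 0 ≤ (powInt p a).toReal := ENNReal.toReal_nonneg
  have n2 : 0 ≤ (powInt p a').toReal := ENNReal.toReal_nonneg
  have n3 : 0 ≤ (powInt p b).toReal := ENNReal.toReal_nonneg
  have n4 : 0 ≤ (powInt p b').toReal := ENNReal.toReal_nonneg
  calc _ ≤ _ := h0
    _ ≤ k * (k * (k * ((powInt p a).toReal + (powInt p a').toReal)
          + k * ((powInt p c).toReal + (powInt p c').toReal))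
        + k * (k * ((powInt p b).toReal + (powInt p b').toReal)
          + k * ((powInt p c).toReal + (powInt p c').toReal))) := by
        gcongr
        · exact h1.trans (by gcongr)
        · exact h2.trans (by gcongr)
    _ = k ^ 3 * (((powInt p a).toReal + (powInt p a').toReal)
      + ((powInt p b).toReal + (powInt p b').toReal)
      + 2 * ((powInt p c).toReal + (powInt p c').toReal)) := by ring
    _ ≤ k ^ 3 * (2 * (((powInt p a).toReal + (powInt p a').toReal)
      + ((powInt p b).toReal + (powInt p b').toReal)
      + ((powInt p c).toReal + (powInt p c').toReal))) := by
        gcongr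
        linarith
    _ = _ := by ring

/-- Pointwise comparison of the integrand of an increment of the energy with its diagonal value. -/
lemma nonlinear_increment_le (hβ : MonotoneGrowth β p) {C δ N σ : ℝ}
    (hC : 0 < C) (hδ : 0 < δ) (hN : 0 ≤ N) (hι : ∀ v, ‖ι v‖ ≤ ‖v‖)
    (hCb : ∀ w y : Lp ℝ 2 μ, powInt p w < ⊤ → powInt p y < ⊤ →
      |∫ x, β (w x) * y x ∂μ| ≤ C * ((2 + 2 * N) * ‖y‖ + δ * (powInt p y).toReal
        + 2 / δ * (tailInt p N w).toReal)) {a a' b b' c c' : V}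
    (ha : powInt p (ι a) < ⊤) (hb : powInt p (ι b) < ⊤) (hc : powInt p (ι c) < ⊤)
    (ha' : powInt p (ι a') < ⊤) (hb' : powInt p (ι b') < ⊤) (hc' : powInt p (ι c') < ⊤)
    (hac : ‖(a - a') - (c - c')‖ ≤ σ) (hbc : ‖(b - b') - (c - c')‖ ≤ σ) :
    -(∫ x, β (ι c x) * ι ((a - a') + (b - b')) x ∂μ
        - ∫ x, β (ι c' x) * ι ((a - a') + (b - b')) x ∂μ)
      ≤ 8 * C * (1 + N) * σ + 2 * C * δ * (2 * (2 ^ p) ^ 3) *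
        (((powInt p (ι a)).toReal + (powInt p (ι a')).toReal)
          + ((powInt p (ι b)).toReal + (powInt p (ι b')).toReal)
          + ((powInt p (ι c)).toReal + (powInt p (ι c')).toReal))
        + 2 * C / δ * ((tailInt p N (ι c)).toReal + (tailInt p N (ι c')).toReal) := by
  have hp := hβ.two_le
  -- The deviation of the test vector from `2 (c - c')`. On `c - c'` monotonicity gives a sign; `y`
  -- has norm at most `2 * σ`, so its contribution falls under the tail estimate.
  set y := (a - a') - (c - c') + ((b - b') - (c - c')) with hy
  have hdec : (a - a') + (b - b') = y + (2:ℝ) • (c - c') := by rw [hy, two_smul]; abel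
  have fy : powInt p (ι y) < ⊤ := by
    rw [hy]; simp only [map_add, map_sub]
    exact powInt_add_lt_top hp
      (powInt_sub_lt_top hp (powInt_sub_lt_top hp ha ha') (powInt_sub_lt_top hp hc hc'))
      (powInt_sub_lt_top hp (powInt_sub_lt_top hp hb hb') (powInt_sub_lt_top hp hc hc'))
  have fz : powInt p (ι (c - c')) < ⊤ := by
    rw [map_sub]; exact powInt_sub_lt_top hp hc hc'
  have hsplit : ∀ w : V, powInt p (ι w) < ⊤ →
      ∫ x, β (ι w x) * ι ((a - a') + (b - b')) x ∂μ
        = ∫ x, β (ι w x) * ι y x ∂μ + 2 * ∫ x, β (ι w x) * ι (c - c') x ∂μ := by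
    intro w hw
    rw [← integral_const_mul, ← integral_add (hβ.integrable_comp_mul hw fy)
      ((hβ.integrable_comp_mul hw fz).const_mul 2), hdec, map_add, map_smul]
    refine integral_congr_ae ?_
    filter_upwards [Lp.coeFn_add (ι y) ((2:ℝ) • ι (c - c')), Lp.coeFn_smul (2:ℝ) (ι (c - c'))]
      with x h1 h2
    rw [h1, Pi.add_apply, h2, Pi.smul_apply, smul_eq_mul]
    ring
  have hmono : 0 ≤ ∫ x, β (ι c x) * ι (c - c') x ∂μ - ∫ x, β (ι c' x) * ι (c - c') x ∂μ := by
    rw [← integral_sub (hβ.integrable_comp_mul hc fz) (hβ.integrable_comp_mul hc' fz)]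
    refine integral_nonneg_of_ae ?_
    rw [map_sub]
    filter_upwards [Lp.coeFn_sub (ι c) (ι c')] with x hx
    rw [hx, Pi.zero_apply, Pi.sub_apply, ← sub_mul]
    rcases le_total (ι c x) (ι c' x) with h | h
    · exact mul_nonneg_of_nonpos_of_nonpos (sub_nonpos.mpr (hβ.mono h)) (sub_nonpos.mpr h)
    · exact mul_nonneg (sub_nonneg.mpr (hβ.mono h)) (sub_nonneg.mpr h)
  have hyn : ‖ι y‖ ≤ 2 * σ := (hι y).trans ((norm_add_le _ _).trans (by linarith))
  have hιy : ι y = (ι a - ι a') - (ι c - ι c') + ((ι b - ι b') - (ι c - ι c')) := by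
    rw [hy]; simp only [map_add, map_sub]
  have hP := powInt_second_difference_le hp ha hb hc ha' hb' hc'
  rw [← hιy] at hP
  have h1 := (abs_le.mp (hCb _ _ hc fy)).1
  have h2 := (abs_le.mp (hCb _ _ hc' fy)).2
  rw [hsplit c hc, hsplit c' hc']
  have h3 : C * ((2 + 2 * N) * ‖ι y‖) ≤ C * ((2 + 2 * N) * (2 * σ)) := by gcongr
  have h4 := mul_le_mul_of_nonneg_left hP (by positivity : 0 ≤ C * δ)
  have e1 : 2 * C / δ * ((tailInt p N (ι c)).toReal + (tailInt p N (ι c')).toReal)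
      = C * (2 / δ * (tailInt p N (ι c)).toReal) + C * (2 / δ * (tailInt p N (ι c')).toReal) := by
    ring
  rw [e1]
  linarith

/-- A polarisation identity: with `w = a - b` the terms linear in `x - w` and `y - w` cancel, so the
error is a product of two small differences. -/
lemma grad_increment_eq (d : ℝ) (a b x y : V) :
    d * inner ℝ (gradOp ι a) (x + y) - d * inner ℝ (gradOp ι b) (x + y)
      - d * inner ℝ (gradOp ι x) y - d * inner ℝ (gradOp ι (a - b)) (a - b)
      = d * -(inner ℝ (gradOp ι (x - (a - b))) (y - (a - b))) := by
  rw [← mul_sub, ← inner_sub_left, ← map_sub]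
  generalize a - b = w
  simp only [map_sub, inner_sub_left, inner_sub_right, inner_add_right, inner_gradOp_comm ι w x]
  ring

set_option maxHeartbeats 1000000 in
-- Put `z = u₁ - u₂` and let `E` be its energy. Testing the integrated equations over `[t, t + h]`
-- with `z t + z (t + h)` gives, by the symmetry of `B`, exactly `E (t + h) - E t + (ε (t + h) - ε
-- t) ⟨Q z(t), z(t + h)⟩`. Each term under the time integral is compared with its value for the test
-- vector `2 z(r)`, where `β` contributes with a favourable sign. The errors are controlled by the
-- modulus of continuity of `z` and by `Lᵖ` integrals and tails at the times `r`, `t` and `t + h`;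
-- `le_of_averaged_increments` removes `h`.
theorem energy_inequality (hβ : MonotoneGrowth β p) (hι : ∀ v, ‖ι v‖ ≤ ‖v‖)
    (hε : ContDiff ℝ 1 ε) (hF₁ : LocSqIntegrable F₁) (hF₂ : LocSqIntegrable F₂)
    (hu₁ : IsIntegralSolution ι ε β p τ F₁ u₁) (hu₂ : IsIntegralSolution ι ε β p τ F₂ u₂)
    {s b : ℝ} (hs : τ ≤ s) (hsb : s ≤ b) :
    inner ℝ (energyOp ι (ε b) (u₁ b - u₂ b)) (u₁ b - u₂ b)
      ≤ inner ℝ (energyOp ι (ε s) (u₁ s - u₂ s)) (u₁ s - u₂ s)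
        + ∫ r in s..b, (deriv ε r * inner ℝ (gradOp ι (u₁ r - u₂ r)) (u₁ r - u₂ r)
          + 2 * inner ℝ (F₁ r - F₂ r) (u₁ r - u₂ r)) := by
  have hp := hβ.two_le
  set z : ℝ → V := fun r => u₁ r - u₂ r with hz
  set D : ℝ → V := fun r => F₁ r - F₂ r with hD
  have hzc : Continuous z := hu₁.cont.sub hu₂.cont
  have hDl : LocSqIntegrable D := hF₁.sub hF₂
  set Θ : ℝ → ℝ := fun r => deriv ε r * inner ℝ (gradOp ι (z r)) (z r) + 2 * inner ℝ (D r) (z r)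
    with hΘ
  have hΘi : ∀ x y, IntervalIntegrable Θ volume x y := fun x y =>
    ((continuous_deriv_mul_inner hε hzc hzc).intervalIntegrable x y).add
      ((hDl.intervalIntegrable_inner hzc x y).const_mul 2)
  set E : ℝ → ℝ := fun r => inner ℝ (energyOp ι (ε r) (z r)) (z r) with hE
  have hEc : Continuous E :=
    ((continuous_energyOp.comp hε.continuous).clm_apply hzc).inner hzc
  set G : ℝ → ℝ := fun r => E r - ∫ x in s..r, Θ x with hG
  have hGc : Continuous G := hEc.sub (intervalIntegral.continuous_primitive hΘi s)
  suffices hGG : G b ≤ G s by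
    simp only [hG, intervalIntegral.integral_same, sub_zero] at hGG
    linarith
  obtain ⟨Lε, hLε⟩ := (isCompact_Icc (a := s) (b := b + 1)).exists_bound_of_continuousOn
    (hε.continuous_deriv le_rfl).continuousOn
  have hLε0 : 0 ≤ Lε := (norm_nonneg _).trans (hLε s ⟨le_rfl, by linarith⟩)
  obtain ⟨C, hC, hCb⟩ := hβ.exists_abs_integral_le_tail (μ := μ)
  set Pw : ℝ → ℝ := fun r => (powInt p (ι (u₁ r))).toReal + (powInt p (ι (u₂ r))).toReal with hPw
  have hPw0 : ∀ r, 0 ≤ Pw r := fun r => add_nonneg ENNReal.toReal_nonneg ENNReal.toReal_nonneg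
  set S := Ioc s (b + 1) with hS
  have hSm : MeasurableSet S := measurableSet_Ioc
  have hPwi : IntegrableOn Pw S :=
    (hu₁.integrable_pow_Ioc hp hs).add (hu₂.integrable_pow_Ioc hp hs)
  set ρ : ℕ → ℝ → ℝ := fun N r =>
    (tailInt p N (ι (u₁ r))).toReal + (tailInt p N (ι (u₂ r))).toReal with hρ
  have hρ0 : ∀ N r, 0 ≤ ρ N r := fun N r => add_nonneg ENNReal.toReal_nonneg ENNReal.toReal_nonneg
  have hae : ∀ᵐ r, τ < r → powInt p (ι (u₁ r)) < ⊤ ∧ powInt p (ι (u₂ r)) < ⊤ := by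
    filter_upwards [hu₁.ae_lt_top hp, hu₂.ae_lt_top hp] with r h1 h2 hr using ⟨h1 hr, h2 hr⟩
  have htl : ∀ (F u : ℝ → V), IsIntegralSolution ι ε β p τ F u → ∀ N : ℕ,
      IntegrableOn (fun r => (tailInt p N (ι (u r))).toReal) S := by
    intro F u hu N
    refine (hu.integrable_pow_Ioc hp hs).mono' (aemeasurable_tailInt hp N
      (ι.continuous.comp hu.cont).aestronglyMeasurable).ennreal_toReal.aestronglyMeasurable ?_
    filter_upwards [ae_restrict_of_ae (hu.ae_lt_top hp), ae_restrict_mem hSm] with r hr hrS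
    rw [Real.norm_of_nonneg ENNReal.toReal_nonneg]
    exact ENNReal.toReal_mono (hr (hs.trans_lt hrS.1)).ne (tailInt_le_powInt N.cast_nonneg _)
  have hρi : ∀ N, IntegrableOn (ρ N) S := fun N => (htl _ _ hu₁ N).add (htl _ _ hu₂ N)
  have hρlim : Tendsto (fun N => ∫ r in S, ρ N r) atTop (𝓝 0) := by
    have h1 := tendsto_integral_tailInt (ν := volume.restrict S) hp
      (ι.continuous.comp hu₁.cont).aestronglyMeasurable
      ((lintegral_mono_set (Ioc_subset_Ioc_left hs)).trans_lt (hu₁.pow (b + 1)))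
    have h2 := tendsto_integral_tailInt (ν := volume.restrict S) hp
      (ι.continuous.comp hu₂.cont).aestronglyMeasurable
      ((lintegral_mono_set (Ioc_subset_Ioc_left hs)).trans_lt (hu₂.pow (b + 1)))
    have h3 := h1.add h2
    rw [add_zero] at h3
    refine h3.congr fun N => ?_
    exact (integral_add (htl _ _ hu₁ N) (htl _ _ hu₂ N)).symm
  have hDi : IntegrableOn (fun r => ‖D r‖) S :=
    ((hDl.integrableOn s (b + 1)).mono_set Ioc_subset_Icc_self).norm
  refine le_of_averaged_increments hGc hsb fun e he => ?_
  -- choice of the parameters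
  set K : ℝ := 2 * (2 ^ p) ^ 3 with hK
  have hK0 : 0 < K := by positivity
  have hPwI : 0 ≤ ∫ r in S, Pw r := integral_nonneg hPw0
  -- The parameters are chosen in the order `δ`, `N`, `σ`, each with a share `e / 3`: `δ` against
  -- the `Lᵖ` integrals, `N` against the tails multiplied by `2 * C / δ`, and `σ` against constants
  -- depending on `N`.
  set δ : ℝ := min 1 (e / (3 * (2 * C * K * (∫ r in S, Pw r) + 1))) with hδdef
  have hδ : 0 < δ := by positivity
  have hδ1 : δ ≤ 1 := min_le_left _ _
  have hδe : 2 * C * δ * K * (∫ r in S, Pw r) ≤ e / 3 := by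
    have h1 : δ ≤ e / (3 * (2 * C * K * (∫ r in S, Pw r) + 1)) := min_le_right _ _
    rw [le_div_iff₀ (by positivity)] at h1
    linarith
  obtain ⟨N, hN⟩ := (Metric.tendsto_atTop.mp (hρlim.const_mul (2 * C / δ))) (e / 3) (by positivity)
  have hNe : 2 * C / δ * ∫ r in S, ρ N r ≤ e / 3 := by
    have := hN N le_rfl
    rw [Real.dist_eq, mul_zero, sub_zero] at this
    exact (le_abs_self _).trans this.le
  have hN0 : (0:ℝ) ≤ N := N.cast_nonneg
  set A : ℝ := 2 * Lε + 8 * C * (1 + N) with hA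
  have hA0 : 0 ≤ A := by positivity
  have hDI : 0 ≤ ∫ r in S, ‖D r‖ := integral_nonneg fun r => norm_nonneg _
  have hlen : 0 ≤ b + 1 - s := by linarith
  set σ : ℝ := min 1 (e / (3 * (A * (b + 1 - s) + 2 * (∫ r in S, ‖D r‖) + 1))) with hσdef
  have hσ : 0 < σ := by positivity
  have hσ1 : σ ≤ 1 := min_le_left _ _
  have hσe : σ * (A * (b + 1 - s) + 2 * ∫ r in S, ‖D r‖) ≤ e / 3 := by
    have h1 : σ ≤ e / (3 * (A * (b + 1 - s) + 2 * (∫ r in S, ‖D r‖) + 1)) := min_le_right _ _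
    rw [le_div_iff₀ (by positivity)] at h1
    linarith
  obtain ⟨h₀, hh₀, hmod⟩ := Metric.uniformContinuousOn_iff.mp
    ((isCompact_Icc (a := s) (b := b + 1)).uniformContinuousOn_of_continuous hzc.continuousOn) σ hσ
  refine ⟨min h₀ 1, by positivity, fun h hh hhlt => ?_⟩
  have hh0 : h < h₀ := hhlt.trans_le (min_le_left _ _)
  have hh1 : h < 1 := hhlt.trans_le (min_le_right _ _)
  clear_value δ σ A
  -- The error at `r` involves `Lᵖ` integrals at `r`, `t` and `t + h`. It is therefore bounded by `q
  -- r + q t + q (t + h)`, the shape that `le_of_averaged_increments` asks for.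
  set q' : ℝ → ℝ := fun r => (A * σ + 2 * σ * ‖D r‖) + 2 * C * δ * K * Pw r + 2 * C / δ * ρ N r
    with hq'
  have hq'0 : ∀ r, 0 ≤ q' r := fun r => by
    have h2 : 0 ≤ 2 * C * δ * K := by positivity
    have h3 : 0 ≤ 2 * C / δ := by positivity
    exact add_nonneg (add_nonneg (by positivity) (mul_nonneg h2 (hPw0 r)))
      (mul_nonneg h3 (hρ0 N r))
  have hi0 : IntegrableOn (fun _ : ℝ => A * σ) S := integrableOn_const (by simp [hS])
  have hi0' : IntegrableOn (fun r => 2 * σ * ‖D r‖) S := hDi.const_mul (2 * σ)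
  have hi1 : IntegrableOn (fun r => A * σ + 2 * σ * ‖D r‖) S := hi0.add hi0'
  have hi2 : IntegrableOn (fun r => 2 * C * δ * K * Pw r) S := hPwi.const_mul _
  have hi3 : IntegrableOn (fun r => 2 * C / δ * ρ N r) S := (hρi N).const_mul _
  have hi12 : IntegrableOn (fun r => A * σ + 2 * σ * ‖D r‖ + 2 * C * δ * K * Pw r) S := hi1.add hi2
  have hq'i : IntegrableOn q' S := hi12.add hi3
  refine ⟨S.indicator q', fun r => indicator_nonneg (fun r _ => hq'0 r) r,
    hq'i.integrable_indicator hSm, ?_, ?_⟩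
  · rw [integral_indicator hSm, hq', integral_add hi12 hi3, integral_add hi1 hi2,
      integral_add hi0 hi0',
      integral_const_mul, integral_const_mul, integral_const_mul, integral_const_mul,
      setIntegral_const]
    have : volume.real S = b + 1 - s := by simp [hS, hlen]
    rw [this, smul_eq_mul]
    linarith
  -- the increment estimate at good times
  have hae' : ∀ᵐ r, τ < r + h → powInt p (ι (u₁ (r + h))) < ⊤ ∧ powInt p (ι (u₂ (r + h))) < ⊤ :=
    (measurePreserving_add_right volume h).quasiMeasurePreserving.ae hae
  filter_upwards [hae, hae', compl_mem_ae_iff.mpr (measure_singleton s)] with t hg hg' hne ht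
  have hst : s < t := lt_of_le_of_ne ht.1 (Ne.symm hne)
  obtain ⟨ga, ga'⟩ := hg (hs.trans_lt hst)
  obtain ⟨gb, gb'⟩ := hg' (hs.trans_lt (by linarith))
  have htS : t ∈ S := ⟨hst, by linarith [ht.2]⟩
  have htS' : t + h ∈ S := ⟨by linarith, by linarith [ht.2]⟩
  rw [indicator_of_mem htS, indicator_of_mem htS']
  set y := z t + z (t + h) with hy
  have fy : powInt p (ι y) < ⊤ := by
    simp only [hy, hz, map_add, map_sub]
    exact powInt_add_lt_top hp (powInt_sub_lt_top hp ga ga') (powInt_sub_lt_top hp gb gb')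
  have hth : t ≤ t + h := by linarith
  have hτt : τ ≤ t := hs.trans hst.le
  have hn1 := hu₁.intervalIntegrable_nonlinear hβ fy hτt hth
  have hn2 := hu₂.intervalIntegrable_nonlinear hβ fy hτt hth
  have hc1 := (continuous_deriv_mul_inner (ι := ι) hε hu₁.cont (continuous_const (y := y))).intervalIntegrable (μ := volume) t (t + h)
  have hc2 := (continuous_deriv_mul_inner (ι := ι) hε hu₂.cont (continuous_const (y := y))).intervalIntegrable (μ := volume) t (t + h)
  have hf1 := hF₁.intervalIntegrable_inner (continuous_const (y := y)) t (t + h)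
  have hf2 := hF₂.intervalIntegrable_inner (continuous_const (y := y)) t (t + h)
  have heq1 := hu₁.eq y fy t (t + h) hτt hth
  have heq2 := hu₂.eq y fy t (t + h) hτt hth
  have hεd : ε (t + h) - ε t = ∫ r in t..(t + h), deriv ε r :=
    (intervalIntegral.integral_deriv_eq_sub (fun r _ => (hε.differentiable one_ne_zero) r)
      ((hε.continuous_deriv le_rfl).intervalIntegrable _ _)).symm
  have hdc := (hε.continuous_deriv le_rfl).intervalIntegrable (μ := volume) t (t + h)
  have hEinc : E (t + h) - E t =
      (inner ℝ (energyOp ι (ε (t + h)) (u₁ (t + h))) y - inner ℝ (energyOp ι (ε t) (u₁ t)) y)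
      - (inner ℝ (energyOp ι (ε (t + h)) (u₂ (t + h))) y - inner ℝ (energyOp ι (ε t) (u₂ t)) y)
      - (ε (t + h) - ε t) * inner ℝ (gradOp ι (z t)) (z (t + h)) := by
    have e1 : ∀ e, inner ℝ (energyOp ι e (u₁ (t + h))) y - inner ℝ (energyOp ι e (u₂ (t + h))) y
        = inner ℝ (energyOp ι e (z (t + h))) (z t) + inner ℝ (energyOp ι e (z (t + h))) (z (t + h)) := by
      intro e; rw [← inner_sub_left, ← map_sub, hy, inner_add_right]
    have e2 : ∀ e, inner ℝ (energyOp ι e (u₁ t)) y - inner ℝ (energyOp ι e (u₂ t)) y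
        = inner ℝ (energyOp ι e (z t)) (z t) + inner ℝ (energyOp ι e (z t)) (z (t + h)) := by
      intro e; rw [← inner_sub_left, ← map_sub, hy, inner_add_right]
    have e3 := e1 (ε (t + h))
    have e4 := e2 (ε t)
    have e5 : inner ℝ (energyOp ι (ε (t + h)) (z (t + h))) (z t)
        - inner ℝ (energyOp ι (ε t) (z t)) (z (t + h))
        = (ε (t + h) - ε t) * inner ℝ (gradOp ι (z t)) (z (t + h)) := by
      rw [inner_energyOp_comm ι _ (z (t + h)), inner_energyOp, inner_energyOp]; ring
    simp only [hE]
    linarith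
  have hGinc : G (t + h) - G t = E (t + h) - E t - ∫ r in t..(t + h), Θ r := by
    simp only [hG]
    rw [← intervalIntegral.integral_interval_sub_left (hΘi s (t + h)) (hΘi s t)]
    ring
  have hI1 := (hc1.add hf1).sub hn1
  have hI2 := (hc2.add hf2).sub hn2
  have hI3 := hdc.mul_const (inner ℝ (gradOp ι (z t)) (z (t + h)))
  rw [hGinc, hEinc, heq1, heq2, hεd, ← intervalIntegral.integral_mul_const,
    ← intervalIntegral.integral_sub hI1 hI2, ← intervalIntegral.integral_sub (hI1.sub hI2) hI3,
    ← intervalIntegral.integral_sub ((hI1.sub hI2).sub hI3) (hΘi _ _)]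
  have hqI : IntervalIntegrable (S.indicator q') volume t (t + h) :=
    (hq'i.integrable_indicator hSm).intervalIntegrable
  have hfin : (∫ r in t..(t + h), S.indicator q' r) + h * (q' t + q' (t + h))
      = ∫ r in t..(t + h), (S.indicator q' r + (q' t + q' (t + h))) := by
    rw [intervalIntegral.integral_add hqI (by simp), intervalIntegral.integral_const, smul_eq_mul]
    ring
  rw [hfin]
  refine intervalIntegral.integral_mono_ae_restrict hth
    ((((hI1.sub hI2).sub hI3)).sub (hΘi _ _)) (hqI.add (by simp)) ?_
  filter_upwards [ae_restrict_of_ae hae, ae_restrict_of_ae (compl_mem_ae_iff.mpr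
    (measure_singleton t)), ae_restrict_mem measurableSet_Icc] with r hgr hrne hr
  have hrS : r ∈ S := ⟨hst.trans_le hr.1, by linarith [hr.2, ht.2]⟩
  obtain ⟨gc, gc'⟩ := hgr (hs.trans_lt hrS.1)
  rw [indicator_of_mem hrS]
  have hSI : S ⊆ Icc s (b + 1) := Ioc_subset_Icc_self
  have hac : ‖z t - z r‖ ≤ σ := by
    rw [← dist_eq_norm]
    refine (hmod t (hSI htS) r (hSI hrS) ?_).le
    rw [Real.dist_eq, abs_lt]; constructor <;> linarith [hr.1, hr.2]
  have hbc : ‖z (t + h) - z r‖ ≤ σ := by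
    rw [← dist_eq_norm]
    refine (hmod (t + h) (hSI htS') r (hSI hrS) ?_).le
    rw [Real.dist_eq, abs_lt]; constructor <;> linarith [hr.1, hr.2]
  have hnl := nonlinear_increment_le hβ hC hδ hN0 hι (hCb δ N hδ hδ1 hN0) ga gb gc ga' gb' gc' hac hbc
  have hgr1 : deriv ε r * inner ℝ (gradOp ι (u₁ r)) y - deriv ε r * inner ℝ (gradOp ι (u₂ r)) y
      - deriv ε r * inner ℝ (gradOp ι (z t)) (z (t + h))
      - deriv ε r * inner ℝ (gradOp ι (z r)) (z r) ≤ 2 * Lε * σ := by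
    have e1 : deriv ε r * inner ℝ (gradOp ι (u₁ r)) y - deriv ε r * inner ℝ (gradOp ι (u₂ r)) y
      - deriv ε r * inner ℝ (gradOp ι (z t)) (z (t + h))
      - deriv ε r * inner ℝ (gradOp ι (z r)) (z r)
      = deriv ε r * -(inner ℝ (gradOp ι (z t - z r)) (z (t + h) - z r)) := by
      exact grad_increment_eq _ _ _ _ _
    rw [e1]
    refine (le_abs_self _).trans ?_
    rw [abs_mul, abs_neg]
    have h1 := abs_inner_gradOp_le hι (z t - z r) (z (t + h) - z r)
    have h2 : |deriv ε r| ≤ Lε := hLε r (hSI hrS)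
    have h3 : 2 * ‖z t - z r‖ * ‖z (t + h) - z r‖ ≤ 2 * σ * 1 := by
      gcongr; linarith
    calc _ ≤ Lε * (2 * σ * 1) := by gcongr; linarith
      _ = _ := by ring
  have hDr : inner ℝ (F₁ r) y - inner ℝ (F₂ r) y - 2 * inner ℝ (D r) (z r) ≤ 2 * σ * ‖D r‖ := by
    have e1 : inner ℝ (F₁ r) y - inner ℝ (F₂ r) y - 2 * inner ℝ (D r) (z r)
        = inner ℝ (D r) (z t - z r + (z (t + h) - z r)) := by
      rw [← inner_sub_left, hy]
      simp only [inner_add_right, inner_sub_right, hD]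
      ring
    rw [e1]
    refine (real_inner_le_norm _ _).trans ?_
    have : ‖z t - z r + (z (t + h) - z r)‖ ≤ 2 * σ := (norm_add_le _ _).trans (by linarith)
    rw [mul_comm]; gcongr
  have p1 : 0 ≤ 2 * σ * ‖D t‖ := by positivity
  have p2 : 0 ≤ 2 * σ * ‖D (t + h)‖ := by positivity
  have p3 : 0 ≤ 2 * C / δ * ρ N t := mul_nonneg (by positivity) (hρ0 N t)
  have p4 : 0 ≤ 2 * C / δ * ρ N (t + h) := mul_nonneg (by positivity) (hρ0 N _)
  have p5 : 0 ≤ A * σ := by positivity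
  have e6 : A * σ = 2 * Lε * σ + 8 * C * (1 + N) * σ := by rw [hA]; ring
  simp only [hq', hΘ, hPw, hρ] at *
  have e7 : u₁ t - u₂ t + (u₁ (t + h) - u₂ (t + h)) = y := rfl
  rw [e7] at hnl
  linarith

end Energy

/-! ### Stability with respect to the initial value and the forcing. -/

section Stability

variable {X : Type*} [MeasurableSpace X] {μ : Measure X} [IsFiniteMeasure μ]
variable {V : Type*} [NormedAddCommGroup V] [InnerProductSpace ℝ V] [CompleteSpace V]
variable {ι : V →L[ℝ] Lp ℝ 2 μ} {ε β : ℝ → ℝ} {p : ℝ}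

lemma exists_pos_le_on_Icc (hε : Continuous ε) (hεpos : ∀ t, 0 < ε t) (a b : ℝ) :
    ∃ e₀, 0 < e₀ ∧ e₀ ≤ 1 ∧ ∀ t ∈ Icc a b, e₀ ≤ ε t := by
  rcases (Icc a b).eq_empty_or_nonempty with h | h
  · exact ⟨1, one_pos, le_rfl, fun t ht => by simp [h] at ht⟩
  · obtain ⟨x, hx, hmin⟩ := isCompact_Icc.exists_isMinOn h hε.continuousOn
    exact ⟨min 1 (ε x), lt_min one_pos (hεpos x), min_le_left _ _,
      fun t ht => (min_le_right _ _).trans (hmin ht)⟩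

/-- An integral inequality for the energy yields a bound for the norm. -/
lemma energy_gronwall (hι : ∀ v, ‖ι v‖ ≤ ‖v‖) (hε : ContDiff ℝ 1 ε) (hεpos : ∀ t, 0 < ε t)
    (τ T : ℝ) : ∃ C, 0 < C ∧ ∀ (z : ℝ → V) (d : ℝ → ℝ), Continuous z → (∀ r, 0 ≤ d r) →
      (∀ x y, IntervalIntegrable d volume x y) → ∀ t ∈ Icc τ T,
      (∀ s ∈ Icc τ t, inner ℝ (energyOp ι (ε s) (z s)) (z s)
        ≤ inner ℝ (energyOp ι (ε τ) (z τ)) (z τ)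
          + ∫ r in τ..s, (deriv ε r * inner ℝ (gradOp ι (z r)) (z r) + (‖z r‖ ^ 2 + d r))) →
      ‖z t‖ ^ 2 ≤ C * (‖z τ‖ ^ 2 + ∫ r in τ..t, d r) := by
  obtain ⟨e₀, he₀, he1, hle⟩ := exists_pos_le_on_Icc hε.continuous hεpos τ T
  obtain ⟨L, hL⟩ := (isCompact_Icc (a := τ) (b := T)).exists_bound_of_continuousOn
    (hε.continuous_deriv le_rfl).continuousOn
  -- On `[τ, T]` the sum of `ε' ⟨Q z, z⟩` and `‖z‖²` is at most `(2 * |L| + 1) * ‖z‖²`, and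
  -- coercivity of the energy turns this into `K` times the energy.
  set K := (2 * |L| + 1) / e₀ with hK
  have hK0 : 0 < K := by positivity
  have hετ := hεpos τ
  refine ⟨(1 + 2 * ε τ) * Real.exp (K * |T - τ|) / e₀, by positivity,
    fun z d hz hd hdi t ht h => ?_⟩
  have hEc : Continuous fun r => inner ℝ (energyOp ι (ε r) (z r)) (z r) :=
    ((continuous_energyOp.comp hε.continuous).clm_apply hz).inner hz
  have hdnn : 0 ≤ ∫ r in τ..t, d r := intervalIntegral.integral_nonneg ht.1 fun r _ => hd r
  have hg := gronwall_integral hEc (A := inner ℝ (energyOp ι (ε τ) (z τ)) (z τ) + ∫ r in τ..t, d r)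
    (C := K) ht.1 hK0.le fun s hs => by
      refine (h s hs).trans ?_
      have hi : IntervalIntegrable (fun r => deriv ε r * inner ℝ (gradOp ι (z r)) (z r)
          + ‖z r‖ ^ 2) volume τ s :=
        ((continuous_deriv_mul_inner hε hz hz).add (hz.norm.pow 2)).intervalIntegrable _ _
      simp_rw [← add_assoc]
      rw [intervalIntegral.integral_add hi (hdi _ _)]
      have h1 : ∫ r in τ..s, d r ≤ ∫ r in τ..t, d r := by
        rw [← intervalIntegral.integral_add_adjacent_intervals (hdi τ s) (hdi s t)]
        have := intervalIntegral.integral_nonneg (μ := volume) hs.2 fun r _ => hd r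
        linarith
      have h2 : ∫ r in τ..s, (deriv ε r * inner ℝ (gradOp ι (z r)) (z r) + ‖z r‖ ^ 2)
          ≤ ∫ r in τ..s, K * inner ℝ (energyOp ι (ε r) (z r)) (z r) := by
        refine intervalIntegral.integral_mono_on hs.1 hi
          ((hEc.const_mul K).intervalIntegrable _ _) fun r hr => ?_
        have hr' : r ∈ Icc τ T := ⟨hr.1, hr.2.trans (hs.2.trans ht.2)⟩
        have a1 : |deriv ε r| ≤ |L| := (hL r hr').trans (le_abs_self L)
        have a2 := abs_inner_gradOp_le hι (z r) (z r)
        have a3 := le_inner_energyOp_self hι he1 (hle r hr') (z r)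
        have a4 : deriv ε r * inner ℝ (gradOp ι (z r)) (z r) ≤ |L| * (2 * ‖z r‖ * ‖z r‖) := by
          refine (le_abs_self _).trans ?_
          rw [abs_mul]; gcongr
        rw [hK, div_mul_eq_mul_div, le_div_iff₀ he₀]
        have a5 : 0 ≤ 2 * |L| + 1 := by positivity
        nlinarith [mul_le_mul_of_nonneg_left a3 a5]
      rw [intervalIntegral.integral_const_mul] at h2
      linarith
  have h3 := le_inner_energyOp_self hι he1 (hle t ht) (z t)
  have h4 := inner_energyOp_self_le hι hετ.le (z τ)
  have h5 : Real.exp (K * (t - τ)) ≤ Real.exp (K * |T - τ|) := by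
    gcongr
    exact (by linarith [ht.2] : t - τ ≤ T - τ).trans (le_abs_self _)
  rw [div_mul_eq_mul_div, le_div_iff₀ he₀, mul_comm]
  refine h3.trans (hg.trans ?_)
  calc _ ≤ ((1 + 2 * ε τ) * (‖z τ‖ ^ 2 + ∫ r in τ..t, d r)) * Real.exp (K * |T - τ|) := by
        gcongr
        nlinarith
    _ = _ := by ring

/-- The energy inequality with `2 ⟨F, z⟩ ≤ ‖F‖² + ‖z‖²`, followed by Gronwall. The monotone term has
already been discarded, so the constant does not see `β`, nor the size of the solutions; this allows
the forcing to be treated by iteration later. -/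
theorem IsIntegralSolution.stability (hβ : MonotoneGrowth β p) (hι : ∀ v, ‖ι v‖ ≤ ‖v‖)
    (hε : ContDiff ℝ 1 ε) (hεpos : ∀ t, 0 < ε t) (τ T : ℝ) :
    ∃ C, 0 < C ∧ ∀ F₁ F₂ u₁ u₂ : ℝ → V, LocSqIntegrable F₁ → LocSqIntegrable F₂ →
      IsIntegralSolution ι ε β p τ F₁ u₁ → IsIntegralSolution ι ε β p τ F₂ u₂ →
      ∀ t ∈ Icc τ T, ‖u₁ t - u₂ t‖ ^ 2
        ≤ C * (‖u₁ τ - u₂ τ‖ ^ 2 + ∫ r in τ..t, ‖F₁ r - F₂ r‖ ^ 2) := by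
  obtain ⟨C, hC, h⟩ := energy_gronwall hι hε hεpos τ T
  refine ⟨C, hC, fun F₁ F₂ u₁ u₂ hF₁ hF₂ hu₁ hu₂ t ht => ?_⟩
  have hD : LocSqIntegrable fun r => F₁ r - F₂ r := hF₁.sub hF₂
  have hz : Continuous fun r => u₁ r - u₂ r := hu₁.cont.sub hu₂.cont
  refine h (fun r => u₁ r - u₂ r) (fun r => ‖F₁ r - F₂ r‖ ^ 2) hz (fun r => by positivity)
    hD.intervalIntegrable_sq t ht fun s hs => ?_
  refine (energy_inequality hβ hι hε hF₁ hF₂ hu₁ hu₂ le_rfl hs.1).trans ?_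
  refine add_le_add_right ?_ _
  have hc := (continuous_deriv_mul_inner (ι := ι) hε hz hz).intervalIntegrable (μ := volume) τ s
  refine intervalIntegral.integral_mono_on hs.1
    (hc.add ((hD.intervalIntegrable_inner hz τ s).const_mul 2))
    (hc.add ((Continuous.intervalIntegrable (by fun_prop : Continuous fun r => ‖u₁ r - u₂ r‖ ^ 2) _ _).add (hD.intervalIntegrable_sq τ s)))
    fun r _ => ?_
  have h1 := real_inner_le_norm (F₁ r - F₂ r) (u₁ r - u₂ r)
  nlinarith [sq_nonneg (‖F₁ r - F₂ r‖ - ‖u₁ r - u₂ r‖)]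

end Stability

/-! ### Moreau–Yosida regularisation of a convex potential on a Hilbert space. -/

section MoreauYosida

variable {V : Type*} [NormedAddCommGroup V] [InnerProductSpace ℝ V] [CompleteSpace V]

/-- A nonnegative convex function on `D` with closed sublevel sets. -/
structure ConvexPotential (D : Set V) (Φ : V → ℝ) : Prop where
  convexOn : ConvexOn ℝ D Φ
  nonneg : ∀ x ∈ D, 0 ≤ Φ x
  nonempty : D.Nonempty
  isClosed_sublevel : ∀ c, IsClosed {x | x ∈ D ∧ Φ x ≤ c}

namespace ConvexPotential

variable {D : Set V} {Φ : V → ℝ} (hΦ : ConvexPotential D Φ)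
include hΦ

/-- The parallelogram law makes a minimising sequence Cauchy, without any weak compactness, and the
closed sublevel sets keep the limit in `D` with the right value. -/
lemma exists_minimizer {l : ℝ} (hl : 0 < l) (u : V) :
    ∃ v ∈ D, ∀ w ∈ D, Φ v + ‖u - v‖ ^ 2 / (2 * l) ≤ Φ w + ‖u - w‖ ^ 2 / (2 * l) := by
  set Ψ : V → ℝ := fun v => Φ v + ‖u - v‖ ^ 2 / (2 * l) with hΨ
  have hbdd : BddBelow (Ψ '' D) := ⟨0, by
    rintro _ ⟨v, hv, rfl⟩
    have := hΦ.nonneg v hv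
    simp only [hΨ]; positivity⟩
  have hne : (Ψ '' D).Nonempty := hΦ.nonempty.image Ψ
  set I := sInf (Ψ '' D) with hI
  have hIle : ∀ w ∈ D, I ≤ Ψ w := fun w hw => csInf_le hbdd (mem_image_of_mem _ hw)
  have hseq : ∀ n : ℕ, ∃ v ∈ D, Ψ v < I + 1 / ((n:ℝ) + 1) := by
    intro n
    obtain ⟨_, ⟨v, hv, rfl⟩, h⟩ := exists_lt_of_csInf_lt hne
      (lt_add_of_pos_right I (by positivity : 0 < 1 / ((n:ℝ) + 1)))
    exact ⟨v, hv, h⟩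
  choose v hvD hv using hseq
  have hcau : CauchySeq v := by
    refine cauchySeq_of_le_tendsto_0 (fun N : ℕ => Real.sqrt (8 * l * (1 / ((N:ℝ) + 1))))
      (fun n m N hn hm => ?_) ?_
    · rw [dist_eq_norm]
      refine Real.le_sqrt_of_sq_le ?_
      have hmid : (1/2:ℝ) • v n + (1/2:ℝ) • v m ∈ D :=
        hΦ.convexOn.1 (hvD n) (hvD m) (by norm_num) (by norm_num) (by norm_num)
      have h1 := hIle _ hmid
      have h2 := hΦ.convexOn.2 (hvD n) (hvD m) (by norm_num : (0:ℝ) ≤ 1/2)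
        (by norm_num : (0:ℝ) ≤ 1/2) (by norm_num)
      have h3 : ‖u - ((1/2:ℝ) • v n + (1/2:ℝ) • v m)‖ ^ 2
          = ‖u - v n‖ ^ 2 / 2 + ‖u - v m‖ ^ 2 / 2 - ‖v n - v m‖ ^ 2 / 4 := by
        have e1 : u - ((1/2:ℝ) • v n + (1/2:ℝ) • v m)
            = (1/2:ℝ) • ((u - v n) + (u - v m)) := by module
        have e2 : v n - v m = (u - v m) - (u - v n) := by abel
        have e3 := parallelogram_law_with_norm ℝ (u - v m) (u - v n)
        rw [← e2] at e3
        rw [e1, norm_smul, add_comm (u - v n), mul_pow]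
        norm_num
        linarith
      have h4 := (hv n).le
      have h5 := (hv m).le
      have h6 : ∀ k, N ≤ k → 1 / ((k:ℝ) + 1) ≤ 1 / ((N:ℝ) + 1) := fun k hk => by
        have : (N:ℝ) ≤ k := by exact_mod_cast hk
        gcongr
      have h7 := h6 n hn
      have h8 := h6 m hm
      simp only [hΨ, smul_eq_mul] at h1 h2 h4 h5
      rw [h3] at h1
      have h9 : ‖v n - v m‖ ^ 2 / 4 / (2 * l) ≤ 1 / ((N:ℝ) + 1) := by
        have : (‖u - v n‖ ^ 2 / 2 + ‖u - v m‖ ^ 2 / 2 - ‖v n - v m‖ ^ 2 / 4) / (2 * l)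
          = (‖u - v n‖ ^ 2 / (2 * l)) / 2 + (‖u - v m‖ ^ 2 / (2 * l)) / 2
            - ‖v n - v m‖ ^ 2 / 4 / (2 * l) := by ring
        rw [this] at h1
        linarith
      rw [div_div, div_le_iff₀ (by positivity)] at h9
      linarith
    · have : Tendsto (fun N : ℕ => 8 * l * (1 / ((N:ℝ) + 1))) atTop (𝓝 (8 * l * 0)) :=
        tendsto_one_div_add_atTop_nhds_zero_nat.const_mul _
      rw [mul_zero] at this
      simpa [Function.comp_def] using (Real.continuous_sqrt.tendsto 0).comp this
  obtain ⟨v₀, hlim⟩ := cauchySeq_tendsto_of_complete hcau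
  have hq : Tendsto (fun n => ‖u - v n‖ ^ 2 / (2 * l)) atTop (𝓝 (‖u - v₀‖ ^ 2 / (2 * l))) :=
    (((tendsto_const_nhds.sub hlim).norm).pow 2).div_const _
  -- For each `e > 0` the sequence eventually enters the closed sublevel set at this level, since `Φ
  -- (v n)` is nearly `I` minus the convergent quadratic term.
  have hmem : ∀ e > 0, v₀ ∈ D ∧ Φ v₀ ≤ I - ‖u - v₀‖ ^ 2 / (2 * l) + e := by
    intro e he
    refine (hΦ.isClosed_sublevel (I - ‖u - v₀‖ ^ 2 / (2 * l) + e)).mem_of_tendsto hlim ?_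
    have h1 : Tendsto (fun n : ℕ => I + 1 / ((n:ℝ) + 1) - ‖u - v n‖ ^ 2 / (2 * l)) atTop
        (𝓝 (I + 0 - ‖u - v₀‖ ^ 2 / (2 * l))) :=
      (tendsto_const_nhds.add tendsto_one_div_add_atTop_nhds_zero_nat).sub hq
    filter_upwards [h1.eventually_lt_const (u := I - ‖u - v₀‖ ^ 2 / (2 * l) + e) (by linarith)]
      with n hn
    have := (hv n).le
    simp only [hΨ] at this
    exact ⟨hvD n, by linarith⟩
  refine ⟨v₀, (hmem 1 one_pos).1, fun w hw => ?_⟩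
  refine le_trans ?_ (hIle w hw)
  refine le_of_forall_pos_le_add fun e he => ?_
  linarith [(hmem e he).2]

/-- First variation at the minimiser `v`: comparison with `(1 - s) • v + s • w` for small `s > 0`,
where the quadratic remainder is of order `s²`. -/
lemma exists_proxMap {l : ℝ} (hl : 0 < l) (u : V) :
    ∃ v ∈ D, ∀ w ∈ D, Φ v + inner ℝ (l⁻¹ • (u - v)) (w - v) ≤ Φ w := by
  obtain ⟨v, hv, hmin⟩ := hΦ.exists_minimizer hl u
  refine ⟨v, hv, fun w hw => ?_⟩
  refine le_of_forall_pos_le_add fun e he => ?_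
  set c := ‖w - v‖ ^ 2 / (2 * l) with hc
  have hc0 : 0 ≤ c := by positivity
  set s := min 1 (e / (c + 1)) with hs
  have hs0 : 0 < s := by positivity
  have hs1 : s ≤ 1 := min_le_left _ _
  have hsc : s * c ≤ e := by
    have h1 : s ≤ e / (c + 1) := min_le_right _ _
    rw [le_div_iff₀ (by positivity)] at h1
    nlinarith
  have hD : (1 - s) • v + s • w ∈ D :=
    hΦ.convexOn.1 hv hw (by linarith) hs0.le (by ring)
  have h1 := hmin _ hD
  have h2 := hΦ.convexOn.2 hv hw (by linarith : 0 ≤ 1 - s) hs0.le (by ring)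
  have e1 : u - ((1 - s) • v + s • w) = (u - v) - s • (w - v) := by module
  rw [e1, norm_sub_sq_real (u - v) (s • (w - v)), norm_smul, inner_smul_right, Real.norm_of_nonneg hs0.le] at h1
  rw [inner_smul_left]
  simp only [smul_eq_mul, conj_trivial] at h2 ⊢
  have e2 : (‖u - v‖ ^ 2 - 2 * (s * inner ℝ (u - v) (w - v)) + (s * ‖w - v‖) ^ 2) / (2 * l)
      = ‖u - v‖ ^ 2 / (2 * l) - s * (l⁻¹ * inner ℝ (u - v) (w - v)) + s * (s * c) := by
    rw [hc]; field_simp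
  rw [e2] at h1
  have h3 : s * (Φ v + l⁻¹ * inner ℝ (u - v) (w - v)) ≤ s * (Φ w + e) := by
    have := mul_le_mul_of_nonneg_left hsc hs0.le
    linarith
  exact le_of_mul_le_mul_left h3 hs0

end ConvexPotential

open Classical in
/-- The proximal map `(1 + l ∂Φ)⁻¹`. -/
noncomputable def proxMap (D : Set V) (Φ : V → ℝ) (l : ℝ) (u : V) : V :=
  if h : ∃ v ∈ D, ∀ w ∈ D, Φ v + inner ℝ (l⁻¹ • (u - v)) (w - v) ≤ Φ w then h.choose else 0

/-- The Yosida approximation of `∂Φ`. -/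
noncomputable def yosida (D : Set V) (Φ : V → ℝ) (l : ℝ) (u : V) : V :=
  l⁻¹ • (u - proxMap D Φ l u)

/-- The Moreau envelope of `Φ`. -/
noncomputable def moreauEnvelope (D : Set V) (Φ : V → ℝ) (l : ℝ) (u : V) : ℝ :=
  Φ (proxMap D Φ l u) + l / 2 * ‖yosida D Φ l u‖ ^ 2

namespace ConvexPotential

variable {D : Set V} {Φ : V → ℝ} (hΦ : ConvexPotential D Φ) {l m : ℝ} (hl : 0 < l) (hm : 0 < m)
include hΦ hl

lemma proxMap_mem (u : V) : proxMap D Φ l u ∈ D := by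
  unfold proxMap
  rw [dif_pos (hΦ.exists_proxMap hl u)]
  exact (hΦ.exists_proxMap hl u).choose_spec.1

lemma yosida_subgradient (u : V) {w : V} (hw : w ∈ D) :
    Φ (proxMap D Φ l u) + inner ℝ (yosida D Φ l u) (w - proxMap D Φ l u) ≤ Φ w := by
  have h := (hΦ.exists_proxMap hl u).choose_spec.2 w hw
  unfold yosida proxMap
  rw [dif_pos (hΦ.exists_proxMap hl u)]
  exact h

omit hΦ [CompleteSpace V] in
lemma sub_proxMap (u : V) : u - proxMap D Φ l u = l • yosida D Φ l u := by
  rw [yosida, smul_smul, mul_inv_cancel₀ hl.ne', one_smul]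

include hm in
-- The sum of two subgradient inequalities. The two parameters may differ, because approximations at
-- different levels are compared when the regularisation is removed.
lemma yosida_monotone (u v : V) : 0 ≤ inner ℝ (yosida D Φ l u - yosida D Φ m v)
    (proxMap D Φ l u - proxMap D Φ m v) := by
  have h1 := hΦ.yosida_subgradient hl u (hΦ.proxMap_mem hm v)
  have h2 := hΦ.yosida_subgradient hm v (hΦ.proxMap_mem hl u)
  have h3 : inner ℝ (yosida D Φ l u) (proxMap D Φ m v - proxMap D Φ l u)
      = - inner ℝ (yosida D Φ l u) (proxMap D Φ l u - proxMap D Φ m v) := by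
    rw [← inner_neg_right, neg_sub]
  rw [inner_sub_left]
  linarith

include hm in
lemma inner_yosida_sub_ge (u v : V) :
    inner ℝ (yosida D Φ l u - yosida D Φ m v) (l • yosida D Φ l u - m • yosida D Φ m v)
      ≤ inner ℝ (yosida D Φ l u - yosida D Φ m v) (u - v) := by
  have h := hΦ.yosida_monotone hl hm u v
  rw [← sub_proxMap hl u, ← sub_proxMap hm v]
  have e : u - proxMap D Φ l u - (v - proxMap D Φ m v)
      = (u - v) - (proxMap D Φ l u - proxMap D Φ m v) := by abel
  rw [e, inner_sub_right]
  linarith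

include hm in
-- Since `u - J u` equals `l` times the Yosida term, monotonicity at the proximal points costs only
-- `⟨a - b, l a - m b⟩`, which is bounded below by Young's inequality. The loss is `l + m` times
-- squares whose time integrals stay bounded, so it disappears in the limit.
lemma neg_le_inner_yosida_sub (u v : V) :
    -((l + m) / 2 * (‖yosida D Φ l u‖ ^ 2 + ‖yosida D Φ m v‖ ^ 2))
      ≤ inner ℝ (yosida D Φ l u - yosida D Φ m v) (u - v) := by
  refine le_trans ?_ (hΦ.inner_yosida_sub_ge hl hm u v)
  set a := yosida D Φ l u
  set b := yosida D Φ m v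
  have e : inner ℝ (a - b) (l • a - m • b) = l * ‖a‖ ^ 2 + m * ‖b‖ ^ 2 - (l + m) * inner ℝ a b := by
    rw [inner_sub_left, inner_sub_right, inner_sub_right, inner_smul_right, inner_smul_right,
      inner_smul_right, inner_smul_right, real_inner_self_eq_norm_sq, real_inner_self_eq_norm_sq,
      real_inner_comm a b]
    ring
  rw [e]
  have h1 : inner ℝ a b ≤ (‖a‖ ^ 2 + ‖b‖ ^ 2) / 2 := by
    have := real_inner_le_norm a b
    nlinarith [sq_nonneg (‖a‖ - ‖b‖)]
  have h2 := mul_le_mul_of_nonneg_left h1 (add_pos hl hm).le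
  have h3 : 0 ≤ l * ‖a‖ ^ 2 := by positivity
  have h4 : 0 ≤ m * ‖b‖ ^ 2 := by positivity
  linarith

/-- For equal parameters `inner_yosida_sub_ge` is cocoercivity, which implies the Lipschitz bound.
-/
lemma norm_yosida_sub_le (u v : V) :
    ‖yosida D Φ l u - yosida D Φ l v‖ ≤ l⁻¹ * ‖u - v‖ := by
  have h := hΦ.inner_yosida_sub_ge hl hl u v
  rw [← smul_sub, inner_smul_right, real_inner_self_eq_norm_sq] at h
  have h2 := h.trans (real_inner_le_norm _ _)
  rcases (norm_nonneg (yosida D Φ l u - yosida D Φ l v)).eq_or_lt with h0 | h0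
  · rw [← h0]; positivity
  · rw [inv_mul_eq_div, le_div_iff₀ hl]
    nlinarith

lemma moreauEnvelope_nonneg (u : V) : 0 ≤ moreauEnvelope D Φ l u :=
  add_nonneg (hΦ.nonneg _ (hΦ.proxMap_mem hl u)) (by positivity)

lemma moreauEnvelope_le {u : V} (hu : u ∈ D) : moreauEnvelope D Φ l u ≤ Φ u := by
  have h := hΦ.yosida_subgradient hl u hu
  rw [sub_proxMap hl, inner_smul_right, real_inner_self_eq_norm_sq] at h
  have : 0 ≤ l * ‖yosida D Φ l u‖ ^ 2 := by positivity
  unfold moreauEnvelope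
  linarith

/-- The subgradient inequality at the proximal point of `u`, applied to that of `v`; what remains is
the square `l / 2 * ‖A u - A v‖²`, with `A` the Yosida approximation. -/
lemma moreauEnvelope_subgradient (u v : V) :
    moreauEnvelope D Φ l u + inner ℝ (yosida D Φ l u) (v - u) ≤ moreauEnvelope D Φ l v := by
  have h := hΦ.yosida_subgradient hl u (hΦ.proxMap_mem hl v)
  have e : proxMap D Φ l v - proxMap D Φ l u
      = (v - u) - (l • yosida D Φ l v - l • yosida D Φ l u) := by
    rw [← sub_proxMap hl u, ← sub_proxMap hl v]; abel
  rw [e, inner_sub_right _ (v - u), inner_sub_right _ (l • _), inner_smul_right, inner_smul_right,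
    real_inner_self_eq_norm_sq] at h
  unfold moreauEnvelope
  have h2 := norm_sub_sq_real (yosida D Φ l u) (yosida D Φ l v)
  have h3 : 0 ≤ l / 2 * ‖yosida D Φ l u - yosida D Φ l v‖ ^ 2 := by positivity
  rw [h2] at h3
  linarith

/-- The subgradient inequalities at `u` and at `v` enclose the first order remainder between `0` and
`⟨A v - A u, v - u⟩`, which is at most `l⁻¹ * ‖v - u‖²`. -/
lemma hasFDerivAt_moreauEnvelope (u : V) :
    HasFDerivAt (moreauEnvelope D Φ l) (innerSL ℝ (yosida D Φ l u)) u := by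
  refine HasFDerivAt.of_isLittleO ?_
  have hO : (fun v => moreauEnvelope D Φ l v - moreauEnvelope D Φ l u
      - innerSL ℝ (yosida D Φ l u) (v - u)) =O[𝓝 u] fun v => ‖v - u‖ ^ 2 := by
    refine Asymptotics.IsBigO.of_bound l⁻¹ (Eventually.of_forall fun v => ?_)
    have h1 := hΦ.moreauEnvelope_subgradient hl u v
    have h2 := hΦ.moreauEnvelope_subgradient hl v u
    have h3 : inner ℝ (yosida D Φ l v) (u - v) = -inner ℝ (yosida D Φ l v) (v - u) := by
      rw [← inner_neg_right, neg_sub]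
    have h4 : inner ℝ (yosida D Φ l v) (v - u) - inner ℝ (yosida D Φ l u) (v - u)
        ≤ l⁻¹ * ‖v - u‖ ^ 2 := by
      rw [← inner_sub_left]
      refine (real_inner_le_norm _ _).trans ?_
      have := mul_le_mul_of_nonneg_right (hΦ.norm_yosida_sub_le hl v u) (norm_nonneg (v - u))
      linarith
    rw [innerSL_apply_apply, Real.norm_of_nonneg (by linarith), Real.norm_of_nonneg (by positivity)]
    linarith
  refine hO.trans_isLittleO ?_
  have : (fun v => ‖v - u‖ ^ 2) =o[𝓝 u] fun v => ‖v - u‖ := by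
    have h0 : Tendsto (fun v => ‖v - u‖) (𝓝 u) (𝓝 0) := by
      have : Continuous fun v : V => ‖v - u‖ := by fun_prop
      simpa using this.tendsto u
    have := Asymptotics.IsLittleO.mul_isBigO
      ((Asymptotics.isLittleO_one_iff ℝ).mpr h0) (Asymptotics.isBigO_refl (fun v => ‖v - u‖) (𝓝 u))
    simpa [sq] using this
  exact this.of_norm_right

end ConvexPotential

end MoreauYosida

/-! ### Convex primitives of a monotone function. -/

section Primitive

/-- A convex primitive of `β`, normalised to dominate a multiple of `|r|ᵖ`. -/
structure IsPrimitive (β b : ℝ → ℝ) (p : ℝ) : Prop where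
  continuous : Continuous b
  subgradient : ∀ r s, b r + β r * (s - r) ≤ b s
  lower : ∃ c, 0 < c ∧ ∀ r, c * |r| ^ p ≤ b r
  upper : ∃ C, 0 < C ∧ ∀ r, b r ≤ C * (1 + |r| ^ p)

lemma MonotoneGrowth.exists_primitive {β : ℝ → ℝ} {p : ℝ} (hβ : MonotoneGrowth β p) :
    ∃ b, IsPrimitive β b p := by
  have hp := hβ.two_le
  set b₀ : ℝ → ℝ := fun r => ∫ x in (0:ℝ)..r, β x with hb₀
  have hi : ∀ x y, IntervalIntegrable β volume x y := fun x y =>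
    hβ.continuous.intervalIntegrable x y
  have hsub : ∀ r s, b₀ r + β r * (s - r) ≤ b₀ s := by
    intro r s
    have h1 : b₀ s - b₀ r = ∫ x in r..s, β x :=
      intervalIntegral.integral_interval_sub_left (hi _ _) (hi _ _)
    rcases le_total r s with h | h
    · have h2 : ∫ _ in r..s, β r ≤ ∫ x in r..s, β x :=
        intervalIntegral.integral_mono_on h (by simp) (hi _ _) fun x hx => hβ.mono hx.1
      rw [intervalIntegral.integral_const, smul_eq_mul] at h2
      linarith
    · have h2 : ∫ x in s..r, β x ≤ ∫ _ in s..r, β r :=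
        intervalIntegral.integral_mono_on h (hi _ _) (by simp) fun x hx => hβ.mono hx.2
      rw [intervalIntegral.integral_const, smul_eq_mul] at h2
      rw [intervalIntegral.integral_symm] at h1
      linarith
  have hzero : b₀ 0 = 0 := by simp [hb₀]
  obtain ⟨c, C, hc, hC, hco⟩ := hβ.coercive
  obtain ⟨C', hC', hgr⟩ := hβ.exists_abs_mul_le
  -- lower bound
  set k := c / 2 ^ p with hk
  have hk0 : 0 < k := by positivity
  -- Convexity at `r / 2` gives `b₀ r ≥ b₀ (r / 2) + β (r / 2) * (r / 2)`. The last product is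
  -- coercive with constant `k = c / 2 ^ p`; the first summand is bounded below by a linear
  -- function, absorbed by half of `k * |r| ^ p`.
  have hlow : ∃ C₁, 0 < C₁ ∧ ∀ r, k / 2 * |r| ^ p - C₁ ≤ b₀ r := by
    set A := |β 0| / 2 with hA
    have hA0 : 0 ≤ A := by positivity
    refine ⟨C + A * (1 + (2 * A / k)) + 1, by positivity, fun r => ?_⟩
    have h1 := hsub (r / 2) r
    have h2 := hsub 0 (r / 2)
    have h3 := hco (r / 2)
    have e1 : |r / 2| ^ p = |r| ^ p / 2 ^ p := by
      rw [abs_div, abs_two, Real.div_rpow (abs_nonneg _) (by norm_num)]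
    have h4 : -(A * |r|) ≤ β 0 * (r / 2 - 0) := by
      have : |β 0 * (r / 2 - 0)| = A * |r| := by
        rw [sub_zero, abs_mul, abs_div, abs_two, hA]; ring
      linarith [neg_abs_le (β 0 * (r / 2 - 0))]
    have h5 : k * |r| ^ p - C ≤ β (r / 2) * (r / 2) := by
      rw [e1] at h3
      have : k * |r| ^ p = c * (|r| ^ p / 2 ^ p) := by rw [hk]; ring
      linarith
    have h6 : A * |r| ≤ k / 2 * |r| ^ p + A * (1 + 2 * A / k) := by
      rcases le_or_gt |r| (1 + 2 * A / k) with h | h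
      · have := mul_le_mul_of_nonneg_left h hA0
        have : 0 ≤ k / 2 * |r| ^ p := by positivity
        linarith
      · have hr1 : 1 ≤ |r| := by
          have : 0 ≤ 2 * A / k := by positivity
          linarith
        have h7 : |r| ^ (2:ℝ) ≤ |r| ^ p := Real.rpow_le_rpow_of_exponent_le hr1 hp
        have h8 : |r| ^ (2:ℝ) = |r| * |r| := by rw [Real.rpow_two]; ring
        have h9 : A ≤ k / 2 * |r| := by
          have : 2 * A / k ≤ |r| := by linarith
          rw [div_le_iff₀ hk0] at this
          linarith
        have h10 : A * |r| ≤ k / 2 * |r| ^ p := by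
          calc A * |r| ≤ k / 2 * |r| * |r| := by gcongr
            _ = k / 2 * (|r| * |r|) := by ring
            _ ≤ _ := by rw [← h8]; gcongr
        have : 0 ≤ A * (1 + 2 * A / k) := by positivity
        linarith
    have e2 : r - r / 2 = r / 2 := by ring
    rw [e2] at h1
    linarith
  obtain ⟨C₁, hC₁, hlow⟩ := hlow
  refine ⟨fun r => b₀ r + C₁, ⟨?_, fun r s => ?_, ⟨k / 2, by positivity, fun r => ?_⟩,
    ⟨2 * C' + C₁, by positivity, fun r => ?_⟩⟩⟩
  · exact (intervalIntegral.continuous_primitive hi 0).add continuous_const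
  · linarith [hsub r s]
  · linarith [hlow r]
  · have h1 := hsub r 0
    have h2 := hgr r r
    have h3 : β r * r ≤ |β r| * |r| := by rw [← abs_mul]; exact le_abs_self _
    have h4 : 0 ≤ |r| ^ p := by positivity
    rw [hzero] at h1
    nlinarith

end Primitive

/-! ### The integral functional and its subdifferential. -/

section Potential

variable {X : Type*} [MeasurableSpace X] {μ : Measure X} [IsFiniteMeasure μ]
variable {V : Type*} [NormedAddCommGroup V] [InnerProductSpace ℝ V] [CompleteSpace V]

/-- The elements of `V` whose image in `L²` belongs to `Lᵖ`. -/
def powDomain (ι : V →L[ℝ] Lp ℝ 2 μ) (p : ℝ) : Set V := {v | powInt p (ι v) < ⊤}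

/-- The integral functional `v ↦ ∫ b(ι v)`. -/
noncomputable def integralPotential (ι : V →L[ℝ] Lp ℝ 2 μ) (b : ℝ → ℝ) (v : V) : ℝ :=
  ∫ x, b (ι v x) ∂μ

variable {ι : V →L[ℝ] Lp ℝ 2 μ} {β b : ℝ → ℝ} {p : ℝ}

lemma IsPrimitive.nonneg (hb : IsPrimitive β b p) (r : ℝ) : 0 ≤ b r := by
  obtain ⟨c, hc, h⟩ := hb.lower
  exact (by positivity : 0 ≤ c * |r| ^ p).trans (h r)

lemma IsPrimitive.aestronglyMeasurable (hb : IsPrimitive β b p) (w : Lp ℝ 2 μ) :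
    AEStronglyMeasurable (fun x => b (w x)) μ :=
  hb.continuous.comp_aestronglyMeasurable (Lp.aestronglyMeasurable w)

lemma IsPrimitive.integrable (hb : IsPrimitive β b p) (hp : 2 ≤ p) {w : Lp ℝ 2 μ}
    (hw : powInt p w < ⊤) : Integrable (fun x => b (w x)) μ := by
  obtain ⟨C, hC, h⟩ := hb.upper
  rw [← integrable_pow_iff hp] at hw
  refine (((integrable_const 1).add hw).const_mul C).mono' (hb.aestronglyMeasurable w)
    (Eventually.of_forall fun x => ?_)
  rw [Real.norm_of_nonneg (hb.nonneg _)]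
  exact h _

lemma convex_powDomain (hp : 2 ≤ p) : Convex ℝ (powDomain ι p) := by
  intro u hu v hv a b _ _ _
  simp only [powDomain, mem_ofPred_eq, map_add, map_smul] at *
  exact powInt_add_lt_top hp (powInt_smul_lt_top hp a hu) (powInt_smul_lt_top hp b hv)

lemma IsPrimitive.convex (hb : IsPrimitive β b p) {r s x y : ℝ} (hx : 0 ≤ x) (hy : 0 ≤ y)
    (hxy : x + y = 1) : b (x * r + y * s) ≤ x * b r + y * b s := by
  have h1 := hb.subgradient (x * r + y * s) r
  have h2 := hb.subgradient (x * r + y * s) s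
  have h3 := mul_le_mul_of_nonneg_left h1 hx
  have h4 := mul_le_mul_of_nonneg_left h2 hy
  have e : x * (β (x * r + y * s) * (r - (x * r + y * s)))
      + y * (β (x * r + y * s) * (s - (x * r + y * s))) = 0 := by
    have : y = 1 - x := by linarith
    rw [this]; ring
  have e2 : x * b (x * r + y * s) + y * b (x * r + y * s) = b (x * r + y * s) := by
    rw [← add_mul, hxy, one_mul]
  linarith

/-- Sublevel sets are closed by Fatou's lemma; the lower bound `c * |r| ^ p ≤ b r` ensures that a
limit with finite integral still belongs to the domain. -/
lemma convexPotential (hp : 2 ≤ p) (hb : IsPrimitive β b p) :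
    ConvexPotential (powDomain ι p) (integralPotential ι b) where
  convexOn := by
    refine ⟨convex_powDomain hp, fun u hu v hv x y hx hy hxy => ?_⟩
    have hc := convex_powDomain hp hu hv hx hy hxy
    simp only [integralPotential, smul_eq_mul]
    rw [← integral_const_mul, ← integral_const_mul,
      ← integral_add ((hb.integrable hp hu).const_mul x) ((hb.integrable hp hv).const_mul y)]
    refine integral_mono_ae (hb.integrable hp hc)
      (((hb.integrable hp hu).const_mul x).add ((hb.integrable hp hv).const_mul y)) ?_
    rw [map_add, map_smul, map_smul]
    filter_upwards [Lp.coeFn_add (x • ι u) (y • ι v), Lp.coeFn_smul x (ι u),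
      Lp.coeFn_smul y (ι v)] with a h1 h2 h3
    rw [h1, Pi.add_apply, h2, h3]
    exact hb.convex hx hy hxy
  nonneg u _ := integral_nonneg fun x => hb.nonneg _
  nonempty := ⟨0, by
    simp only [powDomain, mem_ofPred_eq, map_zero, powInt_zero hp]; exact ENNReal.zero_lt_top⟩
  isClosed_sublevel c := by
    obtain ⟨k, hk, hlow⟩ := hb.lower
    -- The extended integral, unlike the real one, is infinite outside the domain, so it detects
    -- membership. The condition `0 ≤ c` excludes negative levels, for which `ENNReal.ofReal c` is
    -- `0`.
    have hset : {v | v ∈ powDomain ι p ∧ integralPotential ι b v ≤ c}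
        = ι ⁻¹' ((fun w : Lp ℝ 2 μ => ∫⁻ x, ENNReal.ofReal (b (w x)) ∂μ) ⁻¹'
            Iic (ENNReal.ofReal c)) ∩ {_v | 0 ≤ c} := by
      ext v
      simp only [mem_ofPred_eq, mem_inter_iff, mem_preimage, mem_Iic]
      have hpow : ∫⁻ x, ENNReal.ofReal (b (ι v x)) ∂μ < ⊤ → v ∈ powDomain ι p := by
        intro h
        have hbi : Integrable (fun x => b (ι v x)) μ :=
          ⟨hb.aestronglyMeasurable _, by
            rwa [hasFiniteIntegral_iff_ofReal (Eventually.of_forall fun x => hb.nonneg _)]⟩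
        rw [powDomain, mem_ofPred_eq, ← integrable_pow_iff hp]
        refine (hbi.const_mul k⁻¹).mono' (aemeas_pow hp _) (Eventually.of_forall fun x => ?_)
        rw [Real.norm_of_nonneg (by positivity), inv_mul_eq_div, le_div_iff₀ hk, mul_comm]
        exact hlow _
      constructor
      · rintro ⟨hv, hle⟩
        have h0 : 0 ≤ integralPotential ι b v := integral_nonneg fun x => hb.nonneg _
        refine ⟨?_, h0.trans hle⟩
        rw [← ofReal_integral_eq_lintegral_ofReal (hb.integrable hp hv)
          (Eventually.of_forall fun x => hb.nonneg _)]
        exact ENNReal.ofReal_le_ofReal hle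
      · rintro ⟨hle, hc⟩
        have hv := hpow (hle.trans_lt ENNReal.ofReal_lt_top)
        refine ⟨hv, ?_⟩
        rw [← ofReal_integral_eq_lintegral_ofReal (hb.integrable hp hv)
          (Eventually.of_forall fun x => hb.nonneg _), ENNReal.ofReal_le_ofReal_iff hc] at hle
        exact hle
    rw [hset]
    exact (((lowerSemicontinuous_iff_isClosed_preimage.mp
      (lowerSemicontinuous_lintegral_comp hb.continuous) _).preimage ι.continuous)).inter
      isClosed_const

/-- The subgradients of the integral functional are represented by `β`. -/
lemma inner_subgradient_eq (hβ : MonotoneGrowth β p) (hb : IsPrimitive β b p) {v g : V}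
    (hv : v ∈ powDomain ι p)
    (hg : ∀ w ∈ powDomain ι p, integralPotential ι b v + inner ℝ g (w - v)
      ≤ integralPotential ι b w) {w : V} (hw : w ∈ powDomain ι p) :
    inner ℝ g w = ∫ x, β (ι v x) * ι w x ∂μ := by
  have hp := hβ.two_le
  -- Difference quotients along `v + s • w`: the subgradient inequality for `g` at `v` and the one
  -- for `b` at the shifted point give an upper bound for `⟨g, w⟩`, and `s → 0` by dominated
  -- convergence. Equality follows by applying this to `-w`.
  have key : ∀ w ∈ powDomain ι p, inner ℝ g w ≤ ∫ x, β (ι v x) * ι w x ∂μ := by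
    intro w hw
    obtain ⟨C, hC, hgr⟩ := hβ.exists_abs_mul_le
    have hD : ∀ s : ℝ, v + s • w ∈ powDomain ι p := fun s => by
      simp only [powDomain, mem_ofPred_eq, map_add, map_smul] at *
      exact powInt_add_lt_top hp hv (powInt_smul_lt_top hp s hw)
    have hcoe : ∀ s : ℝ, ∀ᵐ x ∂μ, ι (v + s • w) x = ι v x + s * ι w x := fun s => by
      rw [map_add, map_smul]
      filter_upwards [Lp.coeFn_add (ι v) (s • ι w), Lp.coeFn_smul s (ι w)] with x h1 h2
      rw [h1, Pi.add_apply, h2, Pi.smul_apply, smul_eq_mul]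
    have hle : ∀ s : ℝ, 0 < s → inner ℝ g w ≤ ∫ x, β (ι v x + s * ι w x) * ι w x ∂μ := by
      intro s hs
      have h1 := hg _ (hD s)
      rw [add_sub_cancel_left, inner_smul_right] at h1
      have hI := hβ.integrable_comp_mul (hD s) hw
      have h2 : integralPotential ι b (v + s • w) - integralPotential ι b v
          ≤ s * ∫ x, β (ι v x + s * ι w x) * ι w x ∂μ := by
        unfold integralPotential
        rw [← integral_sub (hb.integrable hp (hD s)) (hb.integrable hp hv), ← integral_const_mul]
        refine integral_mono_ae ((hb.integrable hp (hD s)).sub (hb.integrable hp hv))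
          ((hI.const_mul s).congr ?_) ?_
        · filter_upwards [hcoe s] with x hx
          rw [hx]
        · filter_upwards [hcoe s] with x hx
          rw [hx]
          have := hb.subgradient (ι v x + s * ι w x) (ι v x)
          linarith
      have h3 : s * inner ℝ g w ≤ s * ∫ x, β (ι v x + s * ι w x) * ι w x ∂μ := by linarith
      exact le_of_mul_le_mul_left h3 hs
    have hlim : Tendsto (fun n : ℕ => ∫ x, β (ι v x + (1 / ((n:ℝ) + 1)) * ι w x) * ι w x ∂μ) atTop
        (𝓝 (∫ x, β (ι v x) * ι w x ∂μ)) := by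
      have hv' := (integrable_pow_iff hp _).mpr hv
      have hw' := (integrable_pow_iff hp _).mpr hw
      refine tendsto_integral_of_dominated_convergence
        (fun x => C * (1 + 2 ^ p * (|ι v x| ^ p + |ι w x| ^ p) + |ι w x| ^ p))
        (fun n => ?_) ?_ (fun n => Eventually.of_forall fun x => ?_)
        (Eventually.of_forall fun x => ?_)
      · exact (hβ.continuous.comp_aestronglyMeasurable ((Lp.aestronglyMeasurable _).add
          ((Lp.aestronglyMeasurable _).const_mul _))).mul (Lp.aestronglyMeasurable _)
      · exact (((integrable_const 1).add ((hv'.add hw').const_mul _)).add hw').const_mul C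
      · have h1 : |1 / ((n:ℝ) + 1)| ≤ 1 := by
          rw [abs_of_nonneg (by positivity), div_le_one (by positivity)]
          linarith [n.cast_nonneg (α := ℝ)]
        have h2 : |1 / ((n:ℝ) + 1) * ι w x| ≤ |ι w x| := by
          rw [abs_mul]
          nlinarith [abs_nonneg (ι w x)]
        have h3 : |1 / ((n:ℝ) + 1) * ι w x| ^ p ≤ |ι w x| ^ p :=
          Real.rpow_le_rpow (abs_nonneg _) h2 (by linarith)
        rw [norm_mul]
        refine (hgr _ _).trans ?_
        gcongr
        exact (rpow_add_le hp _ _).trans (by gcongr)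
      · have h1 : Tendsto (fun n : ℕ => ι v x + (1 / ((n:ℝ) + 1)) * ι w x) atTop
            (𝓝 (ι v x + 0 * ι w x)) :=
          tendsto_const_nhds.add (tendsto_one_div_add_atTop_nhds_zero_nat.mul_const _)
        rw [zero_mul, add_zero] at h1
        exact ((hβ.continuous.tendsto _).comp h1).mul_const _
    exact ge_of_tendsto' hlim fun n => hle _ (by positivity)
  refine le_antisymm (key w hw) ?_
  have hnw : -w ∈ powDomain ι p := by
    simp only [powDomain, mem_ofPred_eq, map_neg] at *
    exact powInt_neg_lt_top hp hw
  have h := key (-w) hnw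
  rw [inner_neg_right] at h
  have e : ∫ x, β (ι v x) * ι (-w) x ∂μ = -∫ x, β (ι v x) * ι w x ∂μ := by
    rw [← integral_neg]
    refine integral_congr_ae ?_
    rw [map_neg]
    filter_upwards [Lp.coeFn_neg (ι w)] with x hx
    rw [hx, Pi.neg_apply, mul_neg]
  linarith

end Potential

/-! ### A fixed point theorem for causal maps. -/

section Volterra

variable {V : Type*} [NormedAddCommGroup V] [CompleteSpace V]

/-- A fixed point theorem for causal maps of functions on the line that are contractions for
exponentially weighted norms on each half line `(-∞, T]`. -/
theorem exists_fixedPoint_of_causal {S : (ℝ → V) → ℝ → V} {Y : Set (ℝ → V)} {τ : ℝ}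
    {u₀ : ℝ → V} (hu₀ : u₀ ∈ Y) (hYc : ∀ u ∈ Y, Continuous u)
    (hYτ : ∀ u ∈ Y, ∀ t ≤ τ, u t = u₀ t)
    (hclosed : ∀ (v : ℕ → ℝ → V) (u : ℝ → V), (∀ n, v n ∈ Y) → Continuous u →
      (∀ t, Tendsto (fun n => v n t) atTop (𝓝 (u t))) → u ∈ Y)
    (hmaps : ∀ u ∈ Y, S u ∈ Y)
    (hcontr : ∀ T, ∃ γ : ℝ, 0 ≤ γ ∧ ∀ u ∈ Y, ∀ v ∈ Y, ∀ d, 0 ≤ d →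
      (∀ s ≤ T, ‖u s - v s‖ ≤ d * Real.exp (γ * (s - τ))) →
      ∀ t ≤ T, ‖S u t - S v t‖ ≤ d / 2 * Real.exp (γ * (t - τ))) :
    ∃ u ∈ Y, S u = u := by
  -- Picard iteration. The weight `γ` depends on `T`, so there is no single norm in which `S`
  -- contracts; the geometric rate is established on each half line and the limit is locally
  -- uniform.
  set v : ℕ → ℝ → V := fun n => S^[n] u₀ with hv
  have hvs : ∀ n, v (n + 1) = S (v n) := fun n => Function.iterate_succ_apply' S n u₀
  have hvY : ∀ n, v n ∈ Y := fun n => by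
    induction n with
    | zero => exact hu₀
    | succ n ih => rw [hvs]; exact hmaps _ ih
  have hbound : ∀ T, ∃ γ d, 0 ≤ γ ∧ 0 ≤ d ∧ ∀ n, ∀ t ≤ T,
      ‖v (n + 1) t - v n t‖ ≤ d * (1 / 2) ^ n * Real.exp (γ * (t - τ)) := by
    intro T
    obtain ⟨γ, hγ, hc⟩ := hcontr T
    obtain ⟨d, hd⟩ := (isCompact_Icc (a := τ) (b := T)).exists_bound_of_continuousOn
      ((hYc _ (hvY 1)).sub (hYc _ (hvY 0))).continuousOn
    refine ⟨γ, |d|, hγ, abs_nonneg _, fun n => ?_⟩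
    induction n with
    | zero =>
      intro t ht
      rcases le_total t τ with h | h
      · rw [hYτ _ (hvY _) t h, hYτ _ (hvY _) t h, sub_self, norm_zero]; positivity
      · have h1 := hd t ⟨h, ht⟩
        have h2 : 1 ≤ Real.exp (γ * (t - τ)) := Real.one_le_exp (mul_nonneg hγ (by linarith))
        have h3 := le_abs_self d
        simp only [pow_zero, mul_one]
        have h4 : ‖v (0 + 1) t - v 0 t‖ ≤ |d| := h1.trans h3
        nlinarith [abs_nonneg d]
    | succ n ih =>
      intro t ht
      have := hc (v (n + 1)) (hvY _) (v n) (hvY _) (|d| * (1 / 2) ^ n) (by positivity) ih t ht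
      rw [← hvs, ← hvs] at this
      refine this.trans_eq ?_
      ring
  have hloc : ∀ T, ∃ A, 0 ≤ A ∧ ∀ n, ∀ t ≤ T, ‖v (n + 1) t - v n t‖ ≤ A * (1 / 2) ^ n := by
    intro T
    obtain ⟨γ, d, hγ, hd, h⟩ := hbound T
    refine ⟨d * Real.exp (γ * (T - τ)), by positivity, fun n t ht => (h n t ht).trans ?_⟩
    calc d * (1 / 2) ^ n * Real.exp (γ * (t - τ))
        ≤ d * (1 / 2) ^ n * Real.exp (γ * (T - τ)) := by gcongr
      _ = _ := by ring
  have hlim : ∀ t, ∃ w, Tendsto (fun n => v n t) atTop (𝓝 w) := by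
    intro t
    obtain ⟨A, hA, h⟩ := hloc t
    refine cauchySeq_tendsto_of_complete (cauchySeq_of_le_geometric (1 / 2) A (by norm_num)
      fun n => ?_)
    rw [dist_comm, dist_eq_norm]; exact h n t le_rfl
  choose u hu using hlim
  have hrate : ∀ T, ∃ A, 0 ≤ A ∧ ∀ n, ∀ t ≤ T, ‖v n t - u t‖ ≤ A * (1 / 2) ^ n := by
    intro T
    obtain ⟨A, hA, h⟩ := hloc T
    refine ⟨2 * A, by positivity, fun n t ht => ?_⟩
    have := dist_le_of_le_geometric_of_tendsto (1 / 2) A (by norm_num)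
      (f := fun n => v n t) (fun n => by rw [dist_comm, dist_eq_norm]; exact h n t ht) (hu t) n
    rw [dist_eq_norm] at this
    refine this.trans_eq ?_
    ring
  have hpow : ∀ A : ℝ, Tendsto (fun n : ℕ => A * (1 / 2) ^ n) atTop (𝓝 0) := fun A => by
    simpa using (tendsto_pow_atTop_nhds_zero_of_lt_one (by norm_num : (0:ℝ) ≤ 1 / 2)
      (by norm_num)).const_mul A
  have huc : Continuous u := by
    have : TendstoLocallyUniformly v u atTop := by
      rw [Metric.tendstoLocallyUniformly_iff]
      intro e he t
      obtain ⟨A, hA, h⟩ := hrate (t + 1)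
      refine ⟨Iio (t + 1), Iio_mem_nhds (by linarith), ?_⟩
      filter_upwards [(hpow A).eventually_lt_const he] with n hn s hs
      rw [dist_comm, dist_eq_norm]
      exact (h n s (le_of_lt hs)).trans_lt hn
    exact this.continuous (Eventually.of_forall fun n => hYc _ (hvY n)).frequently
  have huY : u ∈ Y := hclosed v u hvY huc hu
  refine ⟨u, huY, funext fun t => ?_⟩
  refine tendsto_nhds_unique ?_ ((tendsto_add_atTop_iff_nat 1).mpr (hu t))
  obtain ⟨γ, hγ, hc⟩ := hcontr t
  -- the distance to the limit is controlled by the exponential weight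
  obtain ⟨A, hA, h⟩ := hrate t
  have h1 : ∀ n, ‖S (v n) t - S u t‖ ≤ A * (1 / 2) ^ n / 2 * Real.exp (γ * (t - τ)) := by
    intro n
    refine hc (v n) (hvY n) u huY _ (by positivity) (fun s hs => ?_) t le_rfl
    rcases le_total s τ with h' | h'
    · rw [hYτ _ (hvY _) s h', hYτ _ huY s h', sub_self, norm_zero]; positivity
    · refine (h n s hs).trans ?_
      have : 1 ≤ Real.exp (γ * (s - τ)) := Real.one_le_exp (mul_nonneg hγ (by linarith))
      exact le_mul_of_one_le_right (by positivity) this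
  simp only [hvs]
  rw [tendsto_iff_norm_sub_tendsto_zero]
  refine squeeze_zero (fun n => norm_nonneg _) h1 ?_
  have := (hpow A).div_const 2 |>.mul_const (Real.exp (γ * (t - τ)))
  simpa using this

end Volterra

/-- The factor `1 / γ` gained by integrating the weight is what turns integral operators into
contractions for large `γ`. -/
lemma integral_exp_mul_sub_le {γ : ℝ} (hγ : 0 < γ) (τ t : ℝ) :
    ∫ r in τ..t, Real.exp (γ * (r - τ)) ≤ Real.exp (γ * (t - τ)) / γ := by
  have hd : ∀ r, HasDerivAt (fun r => Real.exp (γ * (r - τ)) / γ) (Real.exp (γ * (r - τ))) r := by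
    intro r
    have := ((((hasDerivAt_id r).sub_const τ).const_mul γ).exp).div_const γ
    refine this.congr_deriv ?_
    simp only [id]
    field_simp
  rw [intervalIntegral.integral_eq_sub_of_hasDerivAt (fun r _ => hd r)
    ((by fun_prop : Continuous fun r => Real.exp (γ * (r - τ))).intervalIntegrable _ _)]
  have : 0 ≤ Real.exp (γ * (τ - τ)) / γ := by positivity
  linarith

/-! ### Inversion of the energy operator and ordinary differential equations in `V`. -/

section Inverse

variable {X : Type*} [MeasurableSpace X] {μ : Measure X} [IsFiniteMeasure μ]
variable {V : Type*} [NormedAddCommGroup V] [InnerProductSpace ℝ V] [CompleteSpace V]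
variable {ι : V →L[ℝ] Lp ℝ 2 μ} {ε : ℝ → ℝ}

/-- Lax–Milgram for the coercive form of `energyOp ι e`. -/
lemma isUnit_energyOp (hι : ∀ v, ‖ι v‖ ≤ ‖v‖) {e : ℝ} (he : 0 < e) : IsUnit (energyOp ι e) := by
  have hco : IsCoercive ((innerSL ℝ (E := V)) ∘L energyOp ι e) := by
    refine ⟨min 1 e, lt_min one_pos he, fun v => ?_⟩
    have := le_inner_energyOp_self hι (min_le_left 1 e) (min_le_right 1 e) v
    rw [mul_assoc, ← sq]
    exact this
  have : energyOp ι e = hco.continuousLinearEquivOfBilin := by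
    ext v
    refine ext_inner_right ℝ fun w => ?_
    have := hco.continuousLinearEquivOfBilin_apply v w
    simp only [ContinuousLinearEquiv.coe_coe]
    rw [this]
    rfl
  rw [this]
  exact ⟨hco.continuousLinearEquivOfBilin.toUnit, rfl⟩

lemma continuous_inverse_energyOp (hι : ∀ v, ‖ι v‖ ≤ ‖v‖) (hε : Continuous ε)
    (hεpos : ∀ t, 0 < ε t) : Continuous fun t => Ring.inverse (energyOp ι (ε t)) := by
  rw [continuous_iff_continuousAt]
  intro t
  obtain ⟨U, hU⟩ := isUnit_energyOp hι (hεpos t)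
  have h := NormedRing.inverse_continuousAt U
  rw [hU] at h
  exact ContinuousAt.comp (f := fun t => energyOp ι (ε t)) h
    (continuous_energyOp.comp hε).continuousAt

lemma energyOp_inverse_apply (hι : ∀ v, ‖ι v‖ ≤ ‖v‖) {e : ℝ} (he : 0 < e) (v : V) :
    energyOp ι e (Ring.inverse (energyOp ι e) v) = v := by
  have := Ring.mul_inverse_cancel _ (isUnit_energyOp hι he)
  exact DFunLike.congr_fun this v

/-- Global solvability of `B(t) u' = F(t) - A(u)` for Lipschitz continuous `A`. -/
theorem exists_ode_solution (hι : ∀ v, ‖ι v‖ ≤ ‖v‖) (hε : Continuous ε) (hεpos : ∀ t, 0 < ε t)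
    {A : V → V} {K : ℝ} (hK : 0 ≤ K) (hA : ∀ u v, ‖A u - A v‖ ≤ K * ‖u - v‖) {F : ℝ → V}
    (hF : Continuous F) (τ : ℝ) (u₀ : V) :
    ∃ u u' : ℝ → V, Continuous u ∧ Continuous u' ∧ (∀ t ≤ τ, u t = u₀) ∧
      (∀ t, τ < t → HasDerivAt u (u' t) t) ∧ ∀ t, energyOp ι (ε t) (u' t) = F t - A (u t) := by
  have hAc : Continuous A := by
    refine (LipschitzWith.of_dist_le_mul (K := K.toNNReal) fun u v => ?_).continuous
    rw [Real.coe_toNNReal _ hK, dist_eq_norm, dist_eq_norm]; exact hA u v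
  set Bi : ℝ → V →L[ℝ] V := fun t => Ring.inverse (energyOp ι (ε t)) with hBi
  have hBic : Continuous Bi := continuous_inverse_energyOp hι hε hεpos
  set G : (ℝ → V) → ℝ → V := fun u r => Bi r (F r - A (u r)) with hG
  have hGc : ∀ u, Continuous u → Continuous (G u) := fun u hu =>
    hBic.clm_apply (hF.sub (hAc.comp hu))
  -- Integrating only up to `max t τ` keeps the curve constant before `τ`, so the iteration can take
  -- place on the whole line.
  set S : (ℝ → V) → ℝ → V := fun u t => u₀ + ∫ r in τ..(max t τ), G u r with hS
  have hSc : ∀ u, Continuous u → Continuous (S u) := fun u hu =>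
    continuous_const.add ((intervalIntegral.continuous_primitive
      (fun x y => (hGc u hu).intervalIntegrable x y) τ).comp (continuous_id.max continuous_const))
  have hSτ : ∀ u, ∀ t ≤ τ, S u t = u₀ := fun u t ht => by
    simp [hS, max_eq_right ht]
  obtain ⟨u, ⟨hu, hu0⟩, hfix⟩ := exists_fixedPoint_of_causal (S := S) (τ := τ)
    (Y := {u | Continuous u ∧ ∀ t ≤ τ, u t = u₀}) (u₀ := fun _ => u₀)
    ⟨continuous_const, fun _ _ => rfl⟩ (fun u hu => hu.1) (fun u hu => hu.2)
    (fun v u hv hu hlim => ⟨hu, fun t ht => tendsto_nhds_unique (hlim t)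
      (tendsto_const_nhds.congr fun n => ((hv n).2 t ht).symm)⟩)
    (fun u hu => ⟨hSc u hu.1, hSτ u⟩) (fun T => by
      obtain ⟨M, hM⟩ := (isCompact_Icc (a := τ) (b := T)).exists_bound_of_continuousOn
        hBic.continuousOn
      -- The Lipschitz constant of the integrand is `|M| * K`, so this rate makes the contraction
      -- factor `|M| * K / γ` at most `1 / 2`.
      set γ := 2 * |M| * K + 1 with hγ
      have hγ0 : 0 < γ := by positivity
      refine ⟨γ, hγ0.le, fun u hu v hv d hd huv t ht => ?_⟩
      rcases le_total t τ with h | h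
      · rw [hSτ u t h, hSτ v t h, sub_self, norm_zero]; positivity
      · simp only [hS, max_eq_left h]
        rw [add_sub_add_left_eq_sub, ← intervalIntegral.integral_sub
          ((hGc u hu.1).intervalIntegrable _ _) ((hGc v hv.1).intervalIntegrable _ _)]
        have h1 : ‖∫ r in τ..t, (G u r - G v r)‖
            ≤ ∫ r in τ..t, |M| * K * d * Real.exp (γ * (r - τ)) := by
          refine intervalIntegral.norm_integral_le_of_norm_le h (Eventually.of_forall fun r hr => ?_)
            ((by fun_prop : Continuous fun r => |M| * K * d * Real.exp (γ * (r - τ))).intervalIntegrable _ _)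
          have e : G u r - G v r = Bi r (A (v r) - A (u r)) := by
            simp only [hG]; rw [← map_sub]; congr 1; abel
          rw [e]
          calc ‖Bi r (A (v r) - A (u r))‖ ≤ |M| * (K * (d * Real.exp (γ * (r - τ)))) := by
                refine (ContinuousLinearMap.le_opNorm _ _).trans ?_
                have h2 := (hM r ⟨hr.1.le, hr.2.trans ht⟩).trans (le_abs_self M)
                have h3 := huv r (hr.2.trans ht)
                rw [norm_sub_rev] at h3
                have h4 := hA (v r) (u r)
                gcongr
                exact h4.trans (by gcongr)
            _ = _ := by ring
        refine h1.trans ?_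
        rw [intervalIntegral.integral_const_mul]
        calc |M| * K * d * ∫ r in τ..t, Real.exp (γ * (r - τ))
            ≤ |M| * K * d * (Real.exp (γ * (t - τ)) / γ) := by
              gcongr; exact integral_exp_mul_sub_le hγ0 τ t
          _ = (|M| * K / γ) * (d * Real.exp (γ * (t - τ))) := by ring
          _ ≤ (1 / 2) * (d * Real.exp (γ * (t - τ))) := by
              refine mul_le_mul_of_nonneg_right ?_ (by positivity)
              rw [div_le_iff₀ hγ0, hγ]; linarith
          _ = _ := by ring)
  refine ⟨u, G u, hu, hGc u hu, hu0, fun t ht => ?_, fun t => energyOp_inverse_apply hι (hεpos t) _⟩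
  have hd : HasDerivAt (fun t => u₀ + ∫ r in τ..t, G u r) (G u t) t :=
    (intervalIntegral.integral_hasDerivAt_right ((hGc u hu).intervalIntegrable _ _)
      (hGc u hu).stronglyMeasurable.stronglyMeasurableAtFilter (hGc u hu).continuousAt).const_add _
  refine hd.congr_of_eventuallyEq ?_
  filter_upwards [Ioi_mem_nhds ht] with s hs
  conv_lhs => rw [← hfix]
  simp only [hS, max_eq_left (le_of_lt (mem_Ioi.mp hs))]

lemma hasDerivAt_energyOp (e : ℝ) : HasDerivAt (fun e => energyOp ι e) (gradOp ι) e := by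
  have := ((hasDerivAt_id e).smul_const (gradOp ι)).const_add
    ((ContinuousLinearMap.adjoint ι) ∘L ι)
  simpa [energyOp] using this

lemma hasDerivAt_energyOp_apply (hε : ContDiff ℝ 1 ε) {u : ℝ → V} {u' : V} {t : ℝ}
    (hu : HasDerivAt u u' t) :
    HasDerivAt (fun t => energyOp ι (ε t) (u t))
      (deriv ε t • gradOp ι (u t) + energyOp ι (ε t) u') t := by
  have h1 : HasDerivAt (fun t => energyOp ι (ε t)) (deriv ε t • gradOp ι) t := by
    have := (hasDerivAt_energyOp (ι := ι) (ε t)).scomp t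
      ((hε.differentiable one_ne_zero) t).hasDerivAt
    exact this
  exact h1.clm_apply hu

lemma hasDerivAt_energy (hε : ContDiff ℝ 1 ε) {u : ℝ → V} {u' : V} {t : ℝ}
    (hu : HasDerivAt u u' t) :
    HasDerivAt (fun t => inner ℝ (energyOp ι (ε t) (u t)) (u t))
      (deriv ε t * inner ℝ (gradOp ι (u t)) (u t)
        + 2 * inner ℝ (energyOp ι (ε t) u') (u t)) t := by
  have := (hasDerivAt_energyOp_apply (ι := ι) hε hu).inner ℝ hu
  refine this.congr_deriv ?_
  rw [inner_add_left, inner_smul_left, inner_energyOp_comm ι _ (u t) u']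
  simp only [conj_trivial]
  ring

end Inverse

/-! ### Yosida approximations of the evolution equation and their uniform bounds. -/

section Approximation

variable {X : Type*} [MeasurableSpace X] {μ : Measure X} [IsFiniteMeasure μ]
variable {V : Type*} [NormedAddCommGroup V] [InnerProductSpace ℝ V] [CompleteSpace V]

/-- Solutions of the regularised equation `B(t) u' = F - A_l(u)`, with `A_l` the Yosida
approximation of the subdifferential of `v ↦ ∫ b(ι v)`. -/
structure IsYosidaSolution (ι : V →L[ℝ] Lp ℝ 2 μ) (ε b : ℝ → ℝ) (p l τ : ℝ) (F : ℝ → V)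
    (u u' : ℝ → V) : Prop where
  pos : 0 < l
  contF : Continuous F
  cont : Continuous u
  cont' : Continuous u'
  const : ∀ t ≤ τ, u t = u τ
  hasDeriv : ∀ t, τ < t → HasDerivAt u (u' t) t
  eq : ∀ t, energyOp ι (ε t) (u' t) = F t
    - yosida (powDomain ι p) (integralPotential ι b) l (u t)

variable {ι : V →L[ℝ] Lp ℝ 2 μ} {ε β b : ℝ → ℝ} {p l τ : ℝ} {F u u' : ℝ → V}

lemma ConvexPotential.continuous_yosida {D : Set V} {Φ : V → ℝ} (hΦ : ConvexPotential D Φ)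
    (hl : 0 < l) : Continuous (yosida D Φ l) := by
  refine (LipschitzWith.of_dist_le_mul (K := l⁻¹.toNNReal) fun u v => ?_).continuous
  rw [Real.coe_toNNReal _ (inv_nonneg.mpr hl.le), dist_eq_norm, dist_eq_norm]
  exact hΦ.norm_yosida_sub_le hl u v

theorem exists_yosidaSolution (hp : 2 ≤ p) (hb : IsPrimitive β b p) (hι : ∀ v, ‖ι v‖ ≤ ‖v‖)
    (hε : Continuous ε) (hεpos : ∀ t, 0 < ε t) (hl : 0 < l) (hF : Continuous F) (τ : ℝ) (u₀ : V) :
    ∃ u u', IsYosidaSolution ι ε b p l τ F u u' ∧ u τ = u₀ := by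
  obtain ⟨u, u', hu, hu', h0, hd, he⟩ := exists_ode_solution hι hε hεpos (inv_nonneg.mpr hl.le)
    ((convexPotential (ι := ι) hp hb).norm_yosida_sub_le hl) hF τ u₀
  exact ⟨u, u', ⟨hl, hF, hu, hu', fun t ht => by rw [h0 t ht, h0 τ le_rfl], hd, he⟩, h0 τ le_rfl⟩

lemma IsYosidaSolution.continuous_yosida (hp : 2 ≤ p) (hb : IsPrimitive β b p)
    (hu : IsYosidaSolution ι ε b p l τ F u u') :
    Continuous fun t => yosida (powDomain ι p) (integralPotential ι b) l (u t) :=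
  ((convexPotential (ι := ι) hp hb).continuous_yosida hu.pos).comp hu.cont

lemma IsYosidaSolution.continuous_proxMap (hp : 2 ≤ p) (hb : IsPrimitive β b p)
    (hu : IsYosidaSolution ι ε b p l τ F u u') :
    Continuous fun t => proxMap (powDomain ι p) (integralPotential ι b) l (u t) := by
  have : ∀ t, proxMap (powDomain ι p) (integralPotential ι b) l (u t)
      = u t - l • yosida (powDomain ι p) (integralPotential ι b) l (u t) := fun t => by
    rw [← ConvexPotential.sub_proxMap hu.pos]; abel
  simp_rw [this]
  exact hu.cont.sub ((hu.continuous_yosida hp hb).const_smul l)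

/-- The gradient structure bounds the Yosida term uniformly in the regularisation parameter. -/
lemma exists_yosida_bound (hp : 2 ≤ p) (hb : IsPrimitive β b p) (hι : ∀ v, ‖ι v‖ ≤ ‖v‖)
    (hε : Continuous ε) (hεpos : ∀ t, 0 < ε t) (τ T : ℝ) :
    ∃ C, 0 < C ∧ ∀ l F u u', IsYosidaSolution ι ε b p l τ F u u' → u τ ∈ powDomain ι p →
      ∀ t ∈ Icc τ T,
        l * ‖yosida (powDomain ι p) (integralPotential ι b) l (u t)‖ ^ 2
          ≤ C * (integralPotential ι b (u τ) + ∫ r in τ..t, ‖F r‖ ^ 2) ∧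
        ∫ r in τ..t, ‖yosida (powDomain ι p) (integralPotential ι b) l (u r)‖ ^ 2
          ≤ C * (integralPotential ι b (u τ) + ∫ r in τ..t, ‖F r‖ ^ 2) := by
  obtain ⟨e₀, he₀, he1, hle⟩ := exists_pos_le_on_Icc hε hεpos τ T
  obtain ⟨M, hM⟩ := (isCompact_Icc (a := τ) (b := T)).exists_bound_of_continuousOn hε.continuousOn
  set k := 1 + 2 * |M| with hk
  have hk0 : 0 < k := by positivity
  refine ⟨2 + 2 / e₀ + 4 * k ^ 2 / e₀ + 2 * k ^ 2 / e₀ ^ 2, by positivity,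
    fun l F u u' hu hu₀ t ht => ?_⟩
  set D := powDomain ι p
  set Φ := integralPotential ι b with hΦdef
  have hΦ : ConvexPotential D Φ := convexPotential hp hb
  have hl := hu.pos
  set A : ℝ → V := fun r => yosida D Φ l (u r) with hA
  have hAc : Continuous A := hu.continuous_yosida hp hb
  set m : ℝ → ℝ := fun r => moreauEnvelope D Φ l (u r) with hm
  have hmc : Continuous m :=
    (continuous_iff_continuousAt.mpr fun v => (hΦ.hasFDerivAt_moreauEnvelope hl v).continuousAt).comp
      hu.cont
  have hmd : ∀ r, τ < r → HasDerivAt m (inner ℝ (A r) (u' r)) r := fun r hr => by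
    have := (hΦ.hasFDerivAt_moreauEnvelope hl (u r)).comp_hasDerivAt r (hu.hasDeriv r hr)
    exact this
  have hint : ∫ r in τ..t, inner ℝ (A r) (u' r) = m t - m τ :=
    intervalIntegral.integral_eq_sub_of_hasDerivAt_of_le ht.1 hmc.continuousOn
      (fun r hr => hmd r hr.1) ((hAc.inner hu.cont').intervalIntegrable _ _)
  have hF2 : Continuous fun r => ‖F r‖ ^ 2 := hu.contF.norm.pow 2
  have hu2 : Continuous fun r => ‖u' r‖ ^ 2 := hu.cont'.norm.pow 2
  -- The regularised equation tested with `u'`: the Yosida term becomes the derivative of the Moreau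
  -- envelope and coercivity of `B` controls `‖u'‖²`. The bound for the Yosida term `A` itself is
  -- then read off from the equation, `A = F - B u'`.
  have hpt : ∀ r ∈ Icc τ t, e₀ / 2 * ‖u' r‖ ^ 2 + inner ℝ (A r) (u' r) ≤ ‖F r‖ ^ 2 / (2 * e₀) := by
    intro r hr
    have h1 := congrArg (fun w => inner ℝ w (u' r)) (hu.eq r)
    simp only [inner_sub_left] at h1
    have h2 := le_inner_energyOp_self hι he1 (hle r ⟨hr.1, hr.2.trans ht.2⟩) (u' r)
    have h3 := real_inner_le_norm (F r) (u' r)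
    have h4 : ‖F r‖ * ‖u' r‖ ≤ ‖F r‖ ^ 2 / (2 * e₀) + e₀ / 2 * ‖u' r‖ ^ 2 := by
      rw [div_add' _ _ _ (by positivity), le_div_iff₀ (by positivity)]
      nlinarith [sq_nonneg (‖F r‖ - e₀ * ‖u' r‖)]
    change inner ℝ (energyOp ι (ε r) (u' r)) (u' r) = inner ℝ (F r) (u' r) - inner ℝ (A r) (u' r) at h1
    linarith
  have hsum : e₀ / 2 * (∫ r in τ..t, ‖u' r‖ ^ 2) + (m t - m τ)
      ≤ (∫ r in τ..t, ‖F r‖ ^ 2) / (2 * e₀) := by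
    rw [← hint, ← intervalIntegral.integral_const_mul, ← intervalIntegral.integral_add
      ((hu2.const_mul _).intervalIntegrable _ _) ((hAc.inner hu.cont').intervalIntegrable _ _),
      ← intervalIntegral.integral_div]
    exact intervalIntegral.integral_mono_on ht.1
      (((hu2.const_mul _).add (hAc.inner hu.cont')).intervalIntegrable _ _)
      ((hF2.div_const _).intervalIntegrable _ _) hpt
  have hmτ : m τ ≤ Φ (u τ) := hΦ.moreauEnvelope_le hl hu₀
  have hmt : 0 ≤ m t := hΦ.moreauEnvelope_nonneg hl _
  have hIu : 0 ≤ ∫ r in τ..t, ‖u' r‖ ^ 2 :=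
    intervalIntegral.integral_nonneg ht.1 fun r _ => by positivity
  have hIF : 0 ≤ ∫ r in τ..t, ‖F r‖ ^ 2 :=
    intervalIntegral.integral_nonneg ht.1 fun r _ => by positivity
  have hΦ0 : 0 ≤ Φ (u τ) := hΦ.nonneg _ hu₀
  set IF := ∫ r in τ..t, ‖F r‖ ^ 2
  set IU := ∫ r in τ..t, ‖u' r‖ ^ 2
  have hmbound : m t ≤ Φ (u τ) + IF / (2 * e₀) := by
    have : 0 ≤ e₀ / 2 * IU := by positivity
    linarith
  have hUbound : IU ≤ 2 / e₀ * Φ (u τ) + IF / e₀ ^ 2 := by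
    have h1 : e₀ / 2 * IU ≤ Φ (u τ) + IF / (2 * e₀) := by linarith
    have h2 : IU = 2 / e₀ * (e₀ / 2 * IU) := by field_simp
    rw [h2]
    refine (mul_le_mul_of_nonneg_left h1 (by positivity)).trans_eq ?_
    field_simp
  have hx1 : 0 ≤ 2 / e₀ := by positivity
  have hx2 : 0 ≤ 4 * k ^ 2 / e₀ := by positivity
  have hx3 : 0 ≤ 2 * k ^ 2 / e₀ ^ 2 := by positivity
  constructor
  · have h1 : l / 2 * ‖A t‖ ^ 2 ≤ m t := by
      have := hΦ.nonneg _ (hΦ.proxMap_mem hl (u t))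
      simp only [hm, moreauEnvelope, hA]
      linarith
    have h2 : IF / (2 * e₀) = 2 / e₀ * IF / 4 := by field_simp; ring
    rw [h2] at hmbound
    have h3 : 0 ≤ 2 / e₀ * IF := by positivity
    have h4 : 0 ≤ 2 / e₀ * Φ (u τ) := by positivity
    have h5 : 0 ≤ (4 * k ^ 2 / e₀ + 2 * k ^ 2 / e₀ ^ 2) * (Φ (u τ) + IF) := by positivity
    change l * ‖A t‖ ^ 2 ≤ _
    nlinarith
  · have hA2 : Continuous fun r => ‖A r‖ ^ 2 := hAc.norm.pow 2
    have h1 : ∫ r in τ..t, ‖A r‖ ^ 2 ≤ ∫ r in τ..t, (2 * ‖F r‖ ^ 2 + 2 * k ^ 2 * ‖u' r‖ ^ 2) := by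
      refine intervalIntegral.integral_mono_on ht.1 (hA2.intervalIntegrable _ _)
        (((hF2.const_mul 2).add (hu2.const_mul _)).intervalIntegrable _ _) fun r hr => ?_
      have h2 : A r = F r - energyOp ι (ε r) (u' r) := by rw [hu.eq r]; simp [hA, D, hΦdef]
      have h3 : ‖energyOp ι (ε r) (u' r)‖ ≤ k * ‖u' r‖ := by
        refine (norm_energyOp_apply_le hι (hεpos r).le _).trans ?_
        have h4 : ε r ≤ |M| := (le_abs_self _).trans
          ((hM r ⟨hr.1, hr.2.trans ht.2⟩).trans (le_abs_self M))
        rw [hk]; gcongr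
      have h5 : ‖A r‖ ≤ ‖F r‖ + k * ‖u' r‖ := by
        rw [h2]; exact (norm_sub_le _ _).trans (by linarith)
      have h6 : ‖A r‖ ^ 2 ≤ (‖F r‖ + k * ‖u' r‖) ^ 2 := by gcongr
      nlinarith [sq_nonneg (‖F r‖ - k * ‖u' r‖)]
    rw [intervalIntegral.integral_add ((hF2.const_mul 2).intervalIntegrable _ _)
      ((hu2.const_mul _).intervalIntegrable _ _), intervalIntegral.integral_const_mul,
      intervalIntegral.integral_const_mul] at h1
    change ∫ r in τ..t, ‖A r‖ ^ 2 ≤ _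
    have h2 : 2 * k ^ 2 * IU ≤ 4 * k ^ 2 / e₀ * Φ (u τ) + 2 * k ^ 2 / e₀ ^ 2 * IF := by
      refine (mul_le_mul_of_nonneg_left hUbound (by positivity)).trans_eq ?_
      field_simp
      ring
    have h3 : 0 ≤ 2 / e₀ * (Φ (u τ) + IF) := by positivity
    have h4 : 0 ≤ 4 * k ^ 2 / e₀ * IF := by positivity
    have h5 : 0 ≤ 2 * k ^ 2 / e₀ ^ 2 * Φ (u τ) := by positivity
    change _ ≤ 2 * IF + 2 * k ^ 2 * IU at h1
    nlinarith

lemma IsYosidaSolution.energy_eq (hp : 2 ≤ p) (hb : IsPrimitive β b p) (hε : ContDiff ℝ 1 ε)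
    {l₂ : ℝ} {F₂ u₂ u₂' : ℝ → V} (hu : IsYosidaSolution ι ε b p l τ F u u')
    (hu₂ : IsYosidaSolution ι ε b p l₂ τ F₂ u₂ u₂') {t : ℝ} (ht : τ ≤ t) :
    inner ℝ (energyOp ι (ε t) (u t - u₂ t)) (u t - u₂ t)
      = inner ℝ (energyOp ι (ε τ) (u τ - u₂ τ)) (u τ - u₂ τ)
        + ∫ r in τ..t, (deriv ε r * inner ℝ (gradOp ι (u r - u₂ r)) (u r - u₂ r)
          + 2 * inner ℝ ((F r - yosida (powDomain ι p) (integralPotential ι b) l (u r))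
            - (F₂ r - yosida (powDomain ι p) (integralPotential ι b) l₂ (u₂ r))) (u r - u₂ r)) := by
  have hz := hu.cont.sub hu₂.cont
  have hc : Continuous fun r => inner ℝ (energyOp ι (ε r) (u r - u₂ r)) (u r - u₂ r) :=
    ((continuous_energyOp.comp hε.continuous).clm_apply hz).inner hz
  rw [intervalIntegral.integral_eq_sub_of_hasDerivAt_of_le ht hc.continuousOn (fun r hr => ?_)]
  · ring
  · refine Continuous.intervalIntegrable ((continuous_deriv_mul_inner hε hz hz).add
      (Continuous.const_mul (Continuous.inner ((hu.contF.sub (hu.continuous_yosida hp hb)).sub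
        (hu₂.contF.sub (hu₂.continuous_yosida hp hb))) hz) 2)) _ _
  · have := hasDerivAt_energy (ι := ι) hε ((hu.hasDeriv r hr.1).sub (hu₂.hasDeriv r hr.1))
    rw [map_sub (energyOp ι (ε r)), hu.eq, hu₂.eq] at this
    exact this

/-- Two levels of regularisation are compared by `neg_le_inner_yosida_sub` and Gronwall. Against the
`L²` bound on the Yosida terms the factor `l + l₂` makes the approximations Cauchy. -/
lemma exists_yosida_stability (hp : 2 ≤ p) (hb : IsPrimitive β b p) (hι : ∀ v, ‖ι v‖ ≤ ‖v‖)
    (hε : ContDiff ℝ 1 ε) (hεpos : ∀ t, 0 < ε t) (τ T : ℝ) :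
    ∃ C, 0 < C ∧ ∀ l F u u' l₂ F₂ u₂ u₂', IsYosidaSolution ι ε b p l τ F u u' →
      IsYosidaSolution ι ε b p l₂ τ F₂ u₂ u₂' → ∀ t ∈ Icc τ T,
      ‖u t - u₂ t‖ ^ 2 ≤ C * (‖u τ - u₂ τ‖ ^ 2 + ∫ r in τ..t, (‖F r - F₂ r‖ ^ 2
        + (l + l₂) * (‖yosida (powDomain ι p) (integralPotential ι b) l (u r)‖ ^ 2
          + ‖yosida (powDomain ι p) (integralPotential ι b) l₂ (u₂ r)‖ ^ 2))) := by
  obtain ⟨C, hC, h⟩ := energy_gronwall hι hε hεpos τ T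
  refine ⟨C, hC, fun l F u u' l₂ F₂ u₂ u₂' hu hu₂ t ht => ?_⟩
  have hl := hu.pos
  have hl₂ := hu₂.pos
  have hz := hu.cont.sub hu₂.cont
  have hA := hu.continuous_yosida hp hb
  have hA₂ := hu₂.continuous_yosida hp hb
  have hdc : Continuous fun r => (‖F r - F₂ r‖ ^ 2
        + (l + l₂) * (‖yosida (powDomain ι p) (integralPotential ι b) l (u r)‖ ^ 2
          + ‖yosida (powDomain ι p) (integralPotential ι b) l₂ (u₂ r)‖ ^ 2)) :=
    ((hu.contF.sub hu₂.contF).norm.pow 2).add (((hA.norm.pow 2).add (hA₂.norm.pow 2)).const_mul _)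
  refine h (fun r => u r - u₂ r) _ hz (fun r => by positivity)
    (fun x y => hdc.intervalIntegrable x y) t ht fun s hs => ?_
  rw [hu.energy_eq hp hb hε hu₂ hs.1]
  refine add_le_add_right (intervalIntegral.integral_mono_on hs.1 ?_ ?_ fun r _ => ?_) _
  · exact Continuous.intervalIntegrable ((continuous_deriv_mul_inner hε hz hz).add
      (Continuous.const_mul (Continuous.inner ((hu.contF.sub hA).sub (hu₂.contF.sub hA₂)) hz) 2)) _ _
  · exact Continuous.intervalIntegrable ((continuous_deriv_mul_inner hε hz hz).add
      ((hz.norm.pow 2).add hdc)) _ _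
  · have h1 := (convexPotential (ι := ι) hp hb).neg_le_inner_yosida_sub hl hl₂ (u r) (u₂ r)
    have h2 := real_inner_le_norm (F r - F₂ r) (u r - u₂ r)
    set a := yosida (powDomain ι p) (integralPotential ι b) l (u r)
    set a₂ := yosida (powDomain ι p) (integralPotential ι b) l₂ (u₂ r)
    have e : F r - a - (F₂ r - a₂) = (F r - F₂ r) - (a - a₂) := by abel
    rw [e, inner_sub_left (F r - F₂ r)]
    nlinarith [sq_nonneg (‖F r - F₂ r‖ - ‖u r - u₂ r‖)]

/-- A bound in `Lᵖ` that depends on the data only through their natural norms. -/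
lemma exists_yosida_pow_bound (hβ : MonotoneGrowth β p) (hb : IsPrimitive β b p)
    (hι : ∀ v, ‖ι v‖ ≤ ‖v‖) (hε : ContDiff ℝ 1 ε) (hεpos : ∀ t, 0 < ε t) (τ T : ℝ) :
    ∃ C, 0 < C ∧ ∀ l F u u', IsYosidaSolution ι ε b p l τ F u u' →
      ∫⁻ t in Ioc τ T, powInt p (ι (proxMap (powDomain ι p) (integralPotential ι b) l (u t)))
        ≤ ENNReal.ofReal (C * (1 + ‖u τ‖ ^ 2 + ∫ r in τ..T, ‖F r‖ ^ 2)) := by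
  have hp := hβ.two_le
  rcases lt_or_ge T τ with hT | hT
  · exact ⟨1, one_pos, fun l F u u' _ => by rw [Ioc_eq_empty (not_lt.mpr hT.le)]; simp⟩
  obtain ⟨C, hC, hG⟩ := energy_gronwall hι hε hεpos τ T
  obtain ⟨L, hL⟩ := (isCompact_Icc (a := τ) (b := T)).exists_bound_of_continuousOn
    (hε.continuous_deriv le_rfl).continuousOn
  obtain ⟨c, C', hc, hC', hco⟩ := hβ.coercive
  set m := μ.real univ with hm
  have hm0 : 0 ≤ m := measureReal_nonneg
  have hετ := hεpos τ
  set Λ := 2 * |L| + 1 with hΛ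
  -- The first bracket pays for the terms of the energy identity. The second is the Gronwall bound
  -- for `‖u‖²`, multiplied by `Λ` and integrated over `[τ, T]`.
  set K := (2 * C' * m * (T - τ) + 1 + 2 * ε τ) + (T - τ) * Λ * (C * (1 + 2 * C' * m * (T - τ))) + 1
    with hK
  have hTτ : 0 ≤ T - τ := by linarith
  have hK0 : 0 < K := by positivity
  refine ⟨K / (2 * c), by positivity, fun l F u u' hu => ?_⟩
  set D := powDomain ι p with hDdef
  set Φ := integralPotential ι b with hΦdef
  have hΦ : ConvexPotential D Φ := convexPotential hp hb
  have hl := hu.pos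
  have hAc : Continuous fun r => yosida D Φ l (u r) := hu.continuous_yosida hp hb
  have hJc : Continuous fun r => proxMap D Φ l (u r) := hu.continuous_proxMap hp hb
  have hJD : ∀ r, powInt p (ι (proxMap D Φ l (u r))) < ⊤ := fun r => hΦ.proxMap_mem hl _
  have hF2 : Continuous fun r => ‖F r‖ ^ 2 := hu.contF.norm.pow 2
  have hu2 : Continuous fun r => ‖u r‖ ^ 2 := hu.cont.norm.pow 2
  -- coercivity of the Yosida approximation
  have hcoer : ∀ r, c * (powInt p (ι (proxMap D Φ l (u r)))).toReal - C' * m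
      ≤ inner ℝ (yosida D Φ l (u r)) (u r) := by
    intro r
    have h1 : inner ℝ (yosida D Φ l (u r)) (proxMap D Φ l (u r))
        = ∫ x, β (ι (proxMap D Φ l (u r)) x) * ι (proxMap D Φ l (u r)) x ∂μ :=
      inner_subgradient_eq hβ hb (hΦ.proxMap_mem hl _)
        (fun w hw => hΦ.yosida_subgradient hl _ hw) (hΦ.proxMap_mem hl _)
    -- Coercivity of `β` is available only at the proximal point, since `u r` itself need not lie in
    -- `Lᵖ`; passing from one to the other adds a nonnegative square.
    have h2 : inner ℝ (yosida D Φ l (u r)) (u r)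
        = inner ℝ (yosida D Φ l (u r)) (proxMap D Φ l (u r)) + l * ‖yosida D Φ l (u r)‖ ^ 2 := by
      rw [← real_inner_self_eq_norm_sq, ← inner_smul_right, ← ConvexPotential.sub_proxMap hl, ← inner_add_right]
      congr 1; abel
    have h3 : c * (powInt p (ι (proxMap D Φ l (u r)))).toReal - C' * m
        ≤ ∫ x, β (ι (proxMap D Φ l (u r)) x) * ι (proxMap D Φ l (u r)) x ∂μ := by
      have hi := (integrable_pow_iff hp _).mpr (hJD r)
      rw [← integral_pow_eq hp, ← integral_const_mul]
      have h4 : C' * m = ∫ _, C' ∂μ := by rw [integral_const, smul_eq_mul, mul_comm]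
      rw [h4, ← integral_sub (hi.const_mul c) (integrable_const _)]
      exact integral_mono ((hi.const_mul c).sub (integrable_const _))
        (hβ.integrable_comp_mul (hJD r) (hJD r)) fun x => hco _
    have h5 : 0 ≤ l * ‖yosida D Φ l (u r)‖ ^ 2 := by positivity
    linarith
  -- the energy identity
  set E : ℝ → ℝ := fun r => inner ℝ (energyOp ι (ε r) (u r)) (u r) with hE
  have hEc : Continuous E := ((continuous_energyOp.comp hε.continuous).clm_apply hu.cont).inner hu.cont
  set E' : ℝ → ℝ := fun r => deriv ε r * inner ℝ (gradOp ι (u r)) (u r)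
    + 2 * inner ℝ (F r - yosida D Φ l (u r)) (u r) with hE'
  have hE'c : Continuous E' := (continuous_deriv_mul_inner hε hu.cont hu.cont).add
    (((hu.contF.sub hAc).inner hu.cont).const_mul 2)
  have hEeq : ∀ t, τ ≤ t → ∫ r in τ..t, E' r = E t - E τ := fun t ht =>
    intervalIntegral.integral_eq_sub_of_hasDerivAt_of_le ht hEc.continuousOn (fun r hr => by
      have := hasDerivAt_energy (ι := ι) hε (hu.hasDeriv r hr.1)
      rw [hu.eq] at this
      exact this) (hE'c.intervalIntegrable _ _)
  have hP0 : ∀ r, 0 ≤ (powInt p (ι (proxMap D Φ l (u r)))).toReal := fun r => ENNReal.toReal_nonneg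
  have hE'le : ∀ r, E' r + 2 * c * (powInt p (ι (proxMap D Φ l (u r)))).toReal
      ≤ deriv ε r * inner ℝ (gradOp ι (u r)) (u r) + (‖u r‖ ^ 2 + (‖F r‖ ^ 2 + 2 * C' * m)) := by
    intro r
    have h1 := hcoer r
    have h2 := real_inner_le_norm (F r) (u r)
    simp only [hE', inner_sub_left (F r)]
    nlinarith [sq_nonneg (‖F r‖ - ‖u r‖)]
  set IF := ∫ r in τ..T, ‖F r‖ ^ 2 with hIF
  have hIF0 : 0 ≤ IF := intervalIntegral.integral_nonneg hT fun r _ => by positivity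
  have hdc : Continuous fun r => ‖F r‖ ^ 2 + 2 * C' * m := hF2.add continuous_const
  have hnorm : ∀ t ∈ Icc τ T, ‖u t‖ ^ 2 ≤ C * (1 + 2 * C' * m * (T - τ)) * (1 + ‖u τ‖ ^ 2 + IF) := by
    intro t ht
    have h1 := hG u (fun r => ‖F r‖ ^ 2 + 2 * C' * m) hu.cont (fun r => by positivity)
      (fun x y => hdc.intervalIntegrable x y) t ht fun s hs => by
        have h2 := hEeq s hs.1
        have h3 : ∫ r in τ..s, E' r ≤ ∫ r in τ..s, (deriv ε r * inner ℝ (gradOp ι (u r)) (u r)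
            + (‖u r‖ ^ 2 + (‖F r‖ ^ 2 + 2 * C' * m))) := by
          refine intervalIntegral.integral_mono_on hs.1 (hE'c.intervalIntegrable _ _)
            (((continuous_deriv_mul_inner hε hu.cont hu.cont).add
              (hu2.add hdc)).intervalIntegrable _ _) fun r _ => ?_
          have := hE'le r
          have := hP0 r
          have : 0 ≤ 2 * c * (powInt p (ι (proxMap D Φ l (u r)))).toReal := by positivity
          linarith
        simp only [hE] at h2
        linarith
    have h4 : ∫ r in τ..t, (‖F r‖ ^ 2 + 2 * C' * m) ≤ IF + 2 * C' * m * (T - τ) := by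
      have h5 : ∫ r in τ..t, (‖F r‖ ^ 2 + 2 * C' * m) ≤ ∫ r in τ..T, (‖F r‖ ^ 2 + 2 * C' * m) := by
        rw [← intervalIntegral.integral_add_adjacent_intervals (hdc.intervalIntegrable τ t)
          (hdc.intervalIntegrable t T)]
        have := intervalIntegral.integral_nonneg (μ := volume) (f := fun r => ‖F r‖ ^ 2 + 2 * C' * m)
          ht.2 fun r _ => by positivity
        linarith
      have h7 : ∫ r in τ..T, (‖F r‖ ^ 2 + 2 * C' * m) = IF + (T - τ) * (2 * C' * m) := by
        rw [intervalIntegral.integral_add (hF2.intervalIntegrable _ _) (by simp),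
          intervalIntegral.integral_const, smul_eq_mul]
      linarith
    have h6 : 0 ≤ 2 * C' * m * (T - τ) := by positivity
    refine h1.trans ?_
    rw [mul_assoc C]
    refine mul_le_mul_of_nonneg_left ?_ hC.le
    nlinarith [sq_nonneg ‖u τ‖]
  -- integration of the bound
  set φ : ℝ → ℝ := fun r => (Λ * (C * (1 + 2 * C' * m * (T - τ)) * (1 + ‖u τ‖ ^ 2 + IF))
    + (‖F r‖ ^ 2 + 2 * C' * m) - E' r) / (2 * c) with hφ
  have hφc : Continuous φ := ((continuous_const.add hdc).sub hE'c).div_const _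
  have hPφ : ∀ r ∈ Ioc τ T, (powInt p (ι (proxMap D Φ l (u r)))).toReal ≤ φ r := by
    intro r hr
    have hr' : r ∈ Icc τ T := Ioc_subset_Icc_self hr
    have h1 := hE'le r
    have h2 := hnorm r hr'
    have h3 : deriv ε r * inner ℝ (gradOp ι (u r)) (u r) ≤ 2 * |L| * ‖u r‖ ^ 2 := by
      refine (le_abs_self _).trans ?_
      rw [abs_mul]
      have := abs_inner_gradOp_le hι (u r) (u r)
      have h4 : |deriv ε r| ≤ |L| := (hL r hr').trans (le_abs_self L)
      calc _ ≤ |L| * (2 * ‖u r‖ * ‖u r‖) := by gcongr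
        _ = _ := by ring
    have h5 := mul_le_mul_of_nonneg_left h2 (by positivity : 0 ≤ Λ)
    simp only [hφ]
    rw [le_div_iff₀ (by positivity)]
    have h6 : Λ * ‖u r‖ ^ 2 = 2 * |L| * ‖u r‖ ^ 2 + ‖u r‖ ^ 2 := by rw [hΛ]; ring
    linarith
  have hφ0 : ∀ r ∈ Ioc τ T, 0 ≤ φ r := fun r hr => (hP0 r).trans (hPφ r hr)
  have hφI : ∫ r in τ..T, φ r ≤ K / (2 * c) * (1 + ‖u τ‖ ^ 2 + IF) := by
    simp only [hφ]
    rw [intervalIntegral.integral_div, div_mul_eq_mul_div]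
    refine div_le_div_of_nonneg_right ?_ (by positivity)
    have hc1 : Continuous fun r => Λ * (C * (1 + 2 * C' * m * (T - τ)) * (1 + ‖u τ‖ ^ 2 + IF))
        + (‖F r‖ ^ 2 + 2 * C' * m) := continuous_const.add hdc
    rw [intervalIntegral.integral_sub (hc1.intervalIntegrable _ _)
      (hE'c.intervalIntegrable _ _), intervalIntegral.integral_add (by simp)
      (hdc.intervalIntegrable _ _), intervalIntegral.integral_add (hF2.intervalIntegrable _ _)
      (by simp), hEeq T hT, intervalIntegral.integral_const, intervalIntegral.integral_const,
      smul_eq_mul, smul_eq_mul]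
    have h1 : 0 ≤ E T := by
      obtain ⟨e₀, he₀, he1, hle⟩ := exists_pos_le_on_Icc hε.continuous hεpos T T
      have := le_inner_energyOp_self hι he1 (hle T ⟨le_rfl, le_rfl⟩) (u T)
      exact (by positivity : 0 ≤ e₀ * ‖u T‖ ^ 2).trans this
    have h2 : E τ ≤ (1 + 2 * ε τ) * ‖u τ‖ ^ 2 := inner_energyOp_self_le hι hετ.le (u τ)
    have h3 : 0 ≤ ‖u τ‖ ^ 2 := by positivity
    have h4 : 0 ≤ 2 * C' * m * (T - τ) := by positivity
    have h5 : 0 ≤ ε τ * (1 + IF) := by positivity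
    have h6 : 0 ≤ 2 * C' * m * (T - τ) * (‖u τ‖ ^ 2 + IF) := by positivity
    rw [hK]
    nlinarith
  calc ∫⁻ t in Ioc τ T, powInt p (ι (proxMap D Φ l (u t)))
      ≤ ∫⁻ t in Ioc τ T, ENNReal.ofReal (φ t) := by
        refine setLIntegral_mono' measurableSet_Ioc fun t ht => ?_
        rw [← ENNReal.ofReal_toReal (hJD t).ne]
        exact ENNReal.ofReal_le_ofReal (hPφ t ht)
    _ = ENNReal.ofReal (∫ t in τ..T, φ t) := by
        rw [intervalIntegral.integral_of_le hT, ofReal_integral_eq_lintegral_ofReal]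
        · exact (hφc.integrableOn_Icc).mono_set Ioc_subset_Icc_self
        · exact (ae_restrict_iff' measurableSet_Ioc).mpr (Eventually.of_forall hφ0)
    _ ≤ _ := ENNReal.ofReal_le_ofReal hφI

/-- The Yosida term is a subgradient at the proximal point, hence given by `β` evaluated there and
not at `u`. Passing to the limit thus involves two sequences, the solutions and their proximal
points. -/
lemma IsYosidaSolution.integral_eq (hβ : MonotoneGrowth β p) (hb : IsPrimitive β b p)
    (hε : ContDiff ℝ 1 ε) (hu : IsYosidaSolution ι ε b p l τ F u u') {v : V}
    (hv : powInt p (ι v) < ⊤) {s t : ℝ} (hs : τ ≤ s) (hst : s ≤ t) :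
    inner ℝ (energyOp ι (ε t) (u t)) v - inner ℝ (energyOp ι (ε s) (u s)) v =
      ∫ r in s..t, (deriv ε r * inner ℝ (gradOp ι (u r)) v + inner ℝ (F r) v
        - ∫ x, β (ι (proxMap (powDomain ι p) (integralPotential ι b) l (u r)) x) * ι v x ∂μ) := by
  have hp := hβ.two_le
  have hΦ : ConvexPotential (powDomain ι p) (integralPotential ι b) := convexPotential hp hb
  have hA := hu.continuous_yosida hp hb
  have hc : Continuous fun r => inner ℝ (energyOp ι (ε r) (u r)) v :=
    ((continuous_energyOp.comp hε.continuous).clm_apply hu.cont).inner continuous_const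
  have hrep : ∀ r, ∫ x, β (ι (proxMap (powDomain ι p) (integralPotential ι b) l (u r)) x) * ι v x ∂μ
      = inner ℝ (yosida (powDomain ι p) (integralPotential ι b) l (u r)) v := fun r =>
    (inner_subgradient_eq hβ hb (hΦ.proxMap_mem hu.pos _)
      (fun w hw => hΦ.yosida_subgradient hu.pos _ hw) hv).symm
  simp_rw [hrep]
  rw [intervalIntegral.integral_eq_sub_of_hasDerivAt_of_le hst hc.continuousOn (fun r hr => ?_)]
  · exact (((continuous_deriv_mul_inner hε hu.cont continuous_const).add
      (hu.contF.inner continuous_const)).sub (hA.inner continuous_const)).intervalIntegrable _ _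
  · have h1 := (hasDerivAt_energyOp_apply (ι := ι) hε (hu.hasDeriv r (hs.trans_lt hr.1))).inner ℝ
      (hasDerivAt_const r v)
    rw [hu.eq] at h1
    refine h1.congr_deriv ?_
    rw [inner_add_left, inner_smul_left, inner_sub_left]
    simp only [conj_trivial, inner_zero_right]
    ring

end Approximation

/-! ### Limits of curves and approximation of the forcing. -/

section Limits

variable {V : Type*} [NormedAddCommGroup V]

/-- The threshold on the indices may depend on `T`, because the approximation of the forcing is
controlled on `[τ, T]` only from `n ≥ T` on. -/
lemma exists_continuous_limit [CompleteSpace V] {u : ℕ → ℝ → V} (hu : ∀ n, Continuous (u n))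
    (hc : ∀ T : ℝ, ∃ d : ℕ → ℝ, Tendsto d atTop (𝓝 0) ∧ ∃ N, ∀ m n, N ≤ m → N ≤ n → ∀ t ≤ T,
      ‖u m t - u n t‖ ^ 2 ≤ d m + d n) :
    ∃ u₀, Continuous u₀ ∧ ∀ T, TendstoUniformlyOn u u₀ atTop (Iic T) := by
  have hunif : ∀ T, UniformCauchySeqOn u atTop (Iic T) := by
    intro T
    obtain ⟨d, hd, N', h⟩ := hc T
    rw [Metric.uniformCauchySeqOn_iff]
    intro e he
    obtain ⟨N, hN⟩ := (Metric.tendsto_atTop.mp hd) (e ^ 2 / 2) (by positivity)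
    refine ⟨max N N', fun m hm n hn t ht => ?_⟩
    have h1 := hN m ((le_max_left _ _).trans hm)
    have h2 := hN n ((le_max_left _ _).trans hn)
    rw [Real.dist_eq, sub_zero] at h1 h2
    have h3 := h m n ((le_max_right _ _).trans hm) ((le_max_right _ _).trans hn) t ht
    rw [dist_eq_norm]
    refine lt_of_pow_lt_pow_left₀ 2 he.le ?_
    linarith [le_abs_self (d m), le_abs_self (d n)]
  have hpt : ∀ t, ∃ x, Tendsto (fun n => u n t) atTop (𝓝 x) := fun t =>
    cauchySeq_tendsto_of_complete ((hunif t).cauchySeq (by simp))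
  choose u₀ hu₀ using hpt
  have hlim : ∀ T, TendstoUniformlyOn u u₀ atTop (Iic T) := fun T =>
    (hunif T).tendstoUniformlyOn_of_tendsto fun t _ => hu₀ t
  refine ⟨u₀, continuous_iff_continuousAt.mpr fun t => ?_, hlim⟩
  exact ((hlim (t + 1)).continuousOn (Frequently.of_forall fun n => (hu n).continuousOn)).continuousAt
    (Iic_mem_nhds (by linarith))

variable [InnerProductSpace ℝ V]

/-- Continuous functions are dense in `L²` of `[τ, n]`; letting the interval grow with `n` yields
one sequence for all `T`. -/
lemma LocSqIntegrable.exists_continuous_approx {F : ℝ → V} (hF : LocSqIntegrable F) (τ : ℝ) :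
    ∃ Fn : ℕ → ℝ → V, (∀ n, Continuous (Fn n)) ∧ ∀ (n : ℕ) (T : ℝ), τ ≤ T → T ≤ n →
      ∫ r in τ..T, ‖Fn n r - F r‖ ^ 2 ≤ 1 / ((n : ℝ) + 1) := by
  have h : ∀ n : ℕ, ∃ G : ℝ → V, Continuous G ∧ ∀ T : ℝ, τ ≤ T → T ≤ n →
      ∫ r in τ..T, ‖G r - F r‖ ^ 2 ≤ 1 / ((n : ℝ) + 1) := by
    intro n
    have hn : (0 : ℝ) < 1 / ((n : ℝ) + 1) := by positivity
    obtain ⟨G, -, hG, hGc, hGm⟩ := (hF τ n).exists_hasCompactSupport_eLpNorm_sub_le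
      (by norm_num) (ε := ENNReal.ofReal (Real.sqrt (1 / ((n : ℝ) + 1))))
      (by simpa using hn)
    refine ⟨G, hGc, fun T h1 h2 => ?_⟩
    have hd : LocSqIntegrable fun r => G r - F r := hGc.locSqIntegrable.sub hF
    have hm : MemLp (F - G) 2 (volume.restrict (Icc τ n)) := (hF τ n).sub hGm
    rw [hm.eLpNorm_eq_integral_rpow_norm (by norm_num) (by norm_num)] at hG
    have hI0 : 0 ≤ ∫ r in Icc τ n, ‖G r - F r‖ ^ 2 :=
      setIntegral_nonneg measurableSet_Icc fun r _ => by positivity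
    have e1 : ∫ a in Icc τ (n : ℝ), ‖(F - G) a‖ ^ ENNReal.toReal 2
        = ∫ r in Icc τ n, ‖G r - F r‖ ^ 2 := by
      refine integral_congr_ae (Eventually.of_forall fun r => ?_)
      simp only [ENNReal.toReal_ofNat, Real.rpow_ofNat, Pi.sub_apply]
      rw [norm_sub_rev]
    rw [e1, ENNReal.ofReal_le_ofReal_iff (Real.sqrt_nonneg _), ENNReal.toReal_ofNat] at hG
    have h3 : (∫ r in Icc τ n, ‖G r - F r‖ ^ 2) ≤ 1 / ((n : ℝ) + 1) := by
      have : (2 : ℝ)⁻¹ = 1 / 2 := by norm_num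
      rw [this, ← Real.sqrt_eq_rpow] at hG
      exact (Real.sqrt_le_sqrt_iff hn.le).mp hG
    refine le_trans ?_ h3
    rw [intervalIntegral.integral_of_le h1]
    exact setIntegral_mono_set (hd.integrableOn_sq τ n)
      (Eventually.of_forall fun r => by positivity)
      (LE.le.eventuallyLE fun r hr => ⟨hr.1.le, hr.2.trans h2⟩)
  choose G hGc hG using h
  exact ⟨G, hGc, hG⟩

lemma tendsto_integral_inner {Fn : ℕ → ℝ → V} {F : ℝ → V} (hFn : ∀ n, LocSqIntegrable (Fn n))
    (hF : LocSqIntegrable F) {s t : ℝ} (hst : s ≤ t)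
    (hlim : Tendsto (fun n => ∫ r in s..t, ‖Fn n r - F r‖ ^ 2) atTop (𝓝 0)) (v : V) :
    Tendsto (fun n => ∫ r in s..t, inner ℝ (Fn n r) v) atTop (𝓝 (∫ r in s..t, inner ℝ (F r) v)) := by
  rw [tendsto_iff_norm_sub_tendsto_zero]
  -- The summand `1 / (n + 1)` keeps `q n` positive, so that `x ≤ x² / √q + √q` can replace the
  -- Cauchy–Schwarz inequality.
  set q : ℕ → ℝ := fun n => (∫ r in s..t, ‖Fn n r - F r‖ ^ 2) + 1 / ((n : ℝ) + 1) with hq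
  have hq0 : Tendsto q atTop (𝓝 0) := by
    have := hlim.add (tendsto_one_div_add_atTop_nhds_zero_nat (𝕜 := ℝ))
    rwa [add_zero] at this
  have hs : Tendsto (fun n => (1 + (t - s)) * ‖v‖ * Real.sqrt (q n)) atTop (𝓝 0) := by
    have h1 := ((Real.continuous_sqrt.tendsto 0).comp hq0).const_mul ((1 + (t - s)) * ‖v‖)
    rw [Real.sqrt_zero, mul_zero] at h1
    exact h1
  refine squeeze_zero (fun n => norm_nonneg _) (fun n => ?_) hs
  have hd : LocSqIntegrable fun r => Fn n r - F r := (hFn n).sub hF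
  have hI0 : 0 ≤ ∫ r in s..t, ‖Fn n r - F r‖ ^ 2 :=
    intervalIntegral.integral_nonneg hst fun r _ => by positivity
  have hn : (0 : ℝ) < 1 / ((n : ℝ) + 1) := by positivity
  have hqn : 0 < q n := by simp only [hq]; linarith
  have hsq := Real.sqrt_pos.mpr hqn
  rw [← intervalIntegral.integral_sub ((hFn n).intervalIntegrable_inner continuous_const _ _)
    (hF.intervalIntegrable_inner continuous_const _ _)]
  have hb : ∀ r ∈ Ioc s t, ‖inner ℝ (Fn n r) v - inner ℝ (F r) v‖
      ≤ (‖Fn n r - F r‖ ^ 2 / Real.sqrt (q n) + Real.sqrt (q n)) * ‖v‖ := by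
    intro r _
    rw [← inner_sub_left]
    refine (norm_inner_le_norm _ _).trans (mul_le_mul_of_nonneg_right ?_ (norm_nonneg _))
    rw [div_add' _ _ _ hsq.ne', le_div_iff₀ hsq]
    nlinarith [sq_nonneg (‖Fn n r - F r‖ - Real.sqrt (q n)), sq_nonneg (‖Fn n r - F r‖ + Real.sqrt (q n))]
  have hint : IntervalIntegrable (fun r => (‖Fn n r - F r‖ ^ 2 / Real.sqrt (q n) + Real.sqrt (q n))
      * ‖v‖) volume s t :=
    (((hd.intervalIntegrable_sq s t).div_const _).add (by simp)).mul_const _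
  refine (intervalIntegral.norm_integral_le_of_norm_le hst
    (Eventually.of_forall hb) hint).trans ?_
  rw [intervalIntegral.integral_mul_const, intervalIntegral.integral_add
    ((hd.intervalIntegrable_sq s t).div_const _) (by simp), intervalIntegral.integral_div,
    intervalIntegral.integral_const, smul_eq_mul]
  have h2 : (∫ r in s..t, ‖Fn n r - F r‖ ^ 2) / Real.sqrt (q n) ≤ Real.sqrt (q n) := by
    rw [div_le_iff₀ hsq, Real.mul_self_sqrt hqn.le]
    simp only [hq]; linarith
  nlinarith [norm_nonneg v, mul_le_mul_of_nonneg_right h2 (norm_nonneg v)]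

end Limits

/-! ### Existence for a prescribed forcing. -/

section Existence

variable {X : Type*} [MeasurableSpace X] {μ : Measure X} [IsFiniteMeasure μ]
variable {V : Type*} [NormedAddCommGroup V] [InnerProductSpace ℝ V] [CompleteSpace V]
variable {ι : V →L[ℝ] Lp ℝ 2 μ} {ε β : ℝ → ℝ} {p τ : ℝ}

/-- Passage to the limit in the integrated equation. -/
lemma IsIntegralSolution.of_tendsto (hβ : MonotoneGrowth β p) (hι : ∀ v, ‖ι v‖ ≤ ‖v‖)
    (hε : ContDiff ℝ 1 ε) {un w Fn : ℕ → ℝ → V} {u F : ℝ → V} {K : ℝ → ℝ}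
    (hun : ∀ n, Continuous (un n)) (hu : Continuous u)
    (hlim : ∀ T, TendstoUniformlyOn un u atTop (Iic T))
    (hw : ∀ n, Continuous (w n)) (hwlim : ∀ t, τ < t → Tendsto (fun n => w n t) atTop (𝓝 (u t)))
    (hK : ∀ T, ∀ᶠ n in atTop, ∫⁻ t in Ioc τ T, powInt p (ι (w n t)) ≤ ENNReal.ofReal (K T))
    (hFn : ∀ n, LocSqIntegrable (Fn n)) (hF : LocSqIntegrable F)
    (hFlim : ∀ s t, τ ≤ s → s ≤ t →
      Tendsto (fun n => ∫ r in s..t, ‖Fn n r - F r‖ ^ 2) atTop (𝓝 0))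
    (heq : ∀ n v, powInt p (ι v) < ⊤ → ∀ s t, τ ≤ s → s ≤ t →
      inner ℝ (energyOp ι (ε t) (un n t)) v - inner ℝ (energyOp ι (ε s) (un n s)) v =
        ∫ r in s..t, (deriv ε r * inner ℝ (gradOp ι (un n r)) v + inner ℝ (Fn n r) v
          - ∫ x, β (ι (w n r) x) * ι v x ∂μ)) :
    IsIntegralSolution ι ε β p τ F u ∧
      ∀ T, ∫⁻ t in Ioc τ T, powInt p (ι (u t)) ≤ ENNReal.ofReal (K T) := by
  have hwι : ∀ n, Continuous fun t => ι (w n t) := fun n => ι.continuous.comp (hw n)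
  have hpt : ∀ t, Tendsto (fun n => un n t) atTop (𝓝 (u t)) := fun t =>
    (hlim t).tendsto_at (by simp)
  have hz : powInt p (ι (0 : V)) < ⊤ := by rw [map_zero, powInt_zero hβ.two_le]; simp
  -- The `Lᵖ` bound holds only for large indices, so the limit theorem is applied to the shifted
  -- sequence.
  have key : ∀ s t, τ ≤ s → ∀ v, powInt p (ι v) < ⊤ →
      ∫⁻ r in Ioc s t, powInt p (ι (u r)) ≤ ENNReal.ofReal (K t) ∧
      Tendsto (fun n => ∫ r in Ioc s t, ∫ x, β (ι (w n r) x) * ι v x ∂μ) atTop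
        (𝓝 (∫ r in Ioc s t, ∫ x, β (ι (u r) x) * ι v x ∂μ)) := by
    intro s t hs v hv
    obtain ⟨N, hN⟩ := eventually_atTop.mp (hK t)
    have h1 := hβ.tendsto_integral_integral (ν := volume.restrict (Ioc s t))
      (w := fun n r => ι (w (n + N) r)) (w₀ := fun r => ι (u r))
      (fun n => (hwι _).aestronglyMeasurable)
      ((ae_restrict_iff' measurableSet_Ioc).mpr (Eventually.of_forall fun r hr =>
        ((ι.continuous.tendsto _).comp (hwlim r (hs.trans_lt hr.1))).comp (tendsto_add_atTop_nat N)))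
      (K := K t) (fun n => (lintegral_mono_set (Ioc_subset_Ioc_left hs)).trans
        (hN _ (Nat.le_add_left _ _))) hv
    exact ⟨h1.1, (tendsto_add_atTop_iff_nat N).mp h1.2⟩
  have hKu : ∀ T, ∫⁻ t in Ioc τ T, powInt p (ι (u t)) ≤ ENNReal.ofReal (K T) := fun T =>
    (key τ T le_rfl 0 hz).1
  refine ⟨⟨hu, fun T => (hKu T).trans_lt ENNReal.ofReal_lt_top, fun v hv s t hs hst => ?_⟩, hKu⟩
  have hL : Tendsto (fun n => inner ℝ (energyOp ι (ε t) (un n t)) v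
      - inner ℝ (energyOp ι (ε s) (un n s)) v) atTop
      (𝓝 (inner ℝ (energyOp ι (ε t) (u t)) v - inner ℝ (energyOp ι (ε s) (u s)) v)) :=
    ((((energyOp ι (ε t)).continuous.tendsto _).comp (hpt t)).inner tendsto_const_nhds).sub
      ((((energyOp ι (ε s)).continuous.tendsto _).comp (hpt s)).inner tendsto_const_nhds)
  refine tendsto_nhds_unique hL ?_
  have hAc : ∀ x : ℝ → V, Continuous x →
      Continuous fun r => deriv ε r * inner ℝ (gradOp ι (x r)) v := fun x hx =>
    continuous_deriv_mul_inner hε hx continuous_const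
  have hA : Tendsto (fun n => ∫ r in s..t, deriv ε r * inner ℝ (gradOp ι (un n r)) v) atTop
      (𝓝 (∫ r in s..t, deriv ε r * inner ℝ (gradOp ι (u r)) v)) := by
    refine intervalIntegral.tendsto_integral_filter_of_dominated_convergence
      (fun r => |deriv ε r| * (2 * (‖u r‖ + 1) * ‖v‖))
      (Eventually.of_forall fun n => (hAc _ (hun n)).aestronglyMeasurable) ?_ ?_ ?_
    · filter_upwards [Metric.tendstoUniformlyOn_iff.mp (hlim t) 1 one_pos] with n hn
      refine Eventually.of_forall fun r hr => ?_
      rw [uIoc_of_le hst] at hr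
      have h1 := hn r hr.2
      rw [dist_eq_norm, norm_sub_rev] at h1
      have h2 : ‖un n r‖ ≤ ‖u r‖ + 1 := by
        have := norm_add_le (u r) (un n r - u r)
        rw [add_sub_cancel] at this
        linarith
      rw [Real.norm_eq_abs, abs_mul]
      refine mul_le_mul_of_nonneg_left ((abs_inner_gradOp_le hι _ _).trans ?_) (abs_nonneg _)
      gcongr
    · exact ((hε.continuous_deriv le_rfl).abs.mul
        ((continuous_const.mul (hu.norm.add continuous_const)).mul
          continuous_const)).intervalIntegrable _ _
    · exact Eventually.of_forall fun r _ =>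
        ((((gradOp ι).continuous.tendsto _).comp (hpt r)).inner tendsto_const_nhds).const_mul _
  have hB := tendsto_integral_inner hFn hF hst (hFlim s t hs hst) v
  have hC := (key s t hs v hv).2
  simp_rw [← intervalIntegral.integral_of_le hst] at hC
  have hBi := fun G (hG : LocSqIntegrable G) =>
    hG.intervalIntegrable_inner (z := fun _ => v) continuous_const s t
  have hCi : ∀ x : ℝ → V, Continuous x → ∫⁻ r in Ioc τ t, powInt p (ι (x r)) < ⊤ →
      IntervalIntegrable (fun r => ∫ y, β (ι (x r) y) * ι v y ∂μ) volume s t := by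
    intro x hx hfin
    rw [intervalIntegrable_iff_integrableOn_Ioc_of_le hst]
    exact hβ.integrable_integral (ι.continuous.comp hx).aestronglyMeasurable
      ((lintegral_mono_set (Ioc_subset_Ioc_left hs)).trans_lt hfin) hv
  have hABi : ∀ x G : ℝ → V, Continuous x → LocSqIntegrable G → IntervalIntegrable (fun r =>
      deriv ε r * inner ℝ (gradOp ι (x r)) v + inner ℝ (G r) v) volume s t := fun x G hx hG =>
    ((hAc x hx).intervalIntegrable _ _).add (hBi G hG)
  rw [intervalIntegral.integral_sub (hABi u F hu hF) (hCi u hu ((hKu t).trans_lt ENNReal.ofReal_lt_top)),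
    intervalIntegral.integral_add ((hAc u hu).intervalIntegrable _ _) (hBi F hF)]
  refine ((hA.add hB).sub hC).congr' ?_
  filter_upwards [hK t] with n hn
  rw [heq n v hv s t hs hst, intervalIntegral.integral_sub (hABi _ _ (hun n) (hFn n))
    (hCi _ (hw n) (hn.trans_lt ENNReal.ofReal_lt_top)),
    intervalIntegral.integral_add ((hAc _ (hun n)).intervalIntegrable _ _) (hBi _ (hFn n))]

/-- Solvability of the integrated equation for data in the domain of the potential. -/
lemma exists_integralSolution_of_mem (hβ : MonotoneGrowth β p) (hι : ∀ v, ‖ι v‖ ≤ ‖v‖)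
    (hε : ContDiff ℝ 1 ε) (hεpos : ∀ t, 0 < ε t) (τ : ℝ) {F : ℝ → V} (hF : LocSqIntegrable F) :
    ∃ C : ℝ → ℝ, (∀ T, 0 < C T) ∧ ∀ u₀ ∈ powDomain ι p,
      ∃ u, IsIntegralSolution ι ε β p τ F u ∧ (∀ t ≤ τ, u t = u₀) ∧
        ∀ T, ∫⁻ t in Ioc τ T, powInt p (ι (u t)) ≤ ENNReal.ofReal (C T * (1 + ‖u₀‖ ^ 2)) := by
  have hp := hβ.two_le
  obtain ⟨b, hb⟩ := hβ.exists_primitive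
  have hpow := fun T => exists_yosida_pow_bound hβ hb hι hε hεpos τ T
  choose c hc hcb using hpow
  have hIF : ∀ T, 0 ≤ max (∫ r in τ..T, ‖F r‖ ^ 2) 0 := fun T => le_max_right _ _
  set IF : ℝ → ℝ := fun T => max (∫ r in τ..T, ‖F r‖ ^ 2) 0 with hIFd
  -- The constant depends on `F` and `T` but not on `u₀`, and in particular not on the value of the
  -- potential there. The final `Lᵖ` bound therefore survives the approximation of an arbitrary
  -- initial value.
  refine ⟨fun T => c T * (3 + 2 * IF T), fun T => mul_pos (hc T) (by linarith [hIF T]),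
    fun u₀ hu₀ => ?_⟩
  obtain ⟨Fn, hFc, hFa⟩ := hF.exists_continuous_approx τ
  have hlpos : ∀ n : ℕ, (0 : ℝ) < 1 / ((n : ℝ) + 1) := fun n => by positivity
  have hsol := fun n : ℕ => exists_yosidaSolution (ι := ι) hp hb hι hε.continuous hεpos (hlpos n)
    (hFc n) τ u₀
  choose un un' hun hun0 using hsol
  set Φ := integralPotential ι b
  have hΦ : ConvexPotential (powDomain ι p) Φ := convexPotential hp hb
  set A : ℕ → ℝ → V := fun n t => yosida (powDomain ι p) Φ (1 / ((n : ℝ) + 1)) (un n t) with hA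
  have hAc : ∀ n, Continuous (A n) := fun n => (hun n).continuous_yosida hp hb
  have hle1 : ∀ n : ℕ, 1 / ((n : ℝ) + 1) ≤ 1 := fun n => by
    rw [div_le_one (by positivity)]; linarith [n.cast_nonneg (α := ℝ)]
  have hFnT : ∀ (n : ℕ) (T : ℝ), τ ≤ T → T ≤ n → ∫ r in τ..T, ‖Fn n r‖ ^ 2 ≤ 2 * IF T + 2 := by
    intro n T hT hn
    have h1 : ∫ r in τ..T, ‖Fn n r‖ ^ 2 ≤ ∫ r in τ..T, (2 * ‖F r‖ ^ 2 + 2 * ‖Fn n r - F r‖ ^ 2) := by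
      refine intervalIntegral.integral_mono_on hT
        (((hFc n).norm.pow 2).intervalIntegrable _ _)
        (((hF.intervalIntegrable_sq _ _).const_mul 2).add
          ((((hFc n).locSqIntegrable.sub hF).intervalIntegrable_sq _ _).const_mul 2)) fun r _ => ?_
      have h2 := norm_add_le (F r) (Fn n r - F r)
      rw [add_sub_cancel] at h2
      have h3 : ‖Fn n r‖ ^ 2 ≤ (‖F r‖ + ‖Fn n r - F r‖) ^ 2 := by gcongr
      nlinarith [sq_nonneg (‖F r‖ - ‖Fn n r - F r‖)]
    rw [intervalIntegral.integral_add ((hF.intervalIntegrable_sq _ _).const_mul 2)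
      ((((hFc n).locSqIntegrable.sub hF).intervalIntegrable_sq _ _).const_mul 2),
      intervalIntegral.integral_const_mul, intervalIntegral.integral_const_mul] at h1
    have h2 := (hFa n T hT hn).trans (hle1 n)
    have h3 : ∫ r in τ..T, ‖F r‖ ^ 2 ≤ IF T := le_max_left _ _
    linarith
  have hmono : ∀ (n : ℕ) (t T : ℝ), τ ≤ t → t ≤ T →
      ∫ r in τ..t, ‖Fn n r‖ ^ 2 ≤ ∫ r in τ..T, ‖Fn n r‖ ^ 2 := fun n t T h1 h2 =>
    intervalIntegral.integral_mono_interval le_rfl h1 h2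
      (Eventually.of_forall fun r => by positivity) (((hFc n).norm.pow 2).intervalIntegrable _ _)
  -- bounds for the Yosida terms
  have hAb : ∀ T, τ ≤ T → ∃ C, 0 ≤ C ∧ ∀ n : ℕ, T ≤ n → ∀ t ∈ Icc τ T,
      1 / ((n : ℝ) + 1) * ‖A n t‖ ^ 2 ≤ C ∧ ∫ r in τ..t, ‖A n r‖ ^ 2 ≤ C := by
    intro T hT
    obtain ⟨C, hC, h⟩ := exists_yosida_bound (ι := ι) hp hb hι hε.continuous hεpos τ T
    have h0 : 0 ≤ Φ u₀ := hΦ.nonneg _ hu₀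
    refine ⟨C * (Φ u₀ + (2 * IF T + 2)), mul_nonneg hC.le (by linarith [hIF T]),
      fun n hn t ht => ?_⟩
    have h1 := h _ _ _ _ (hun n) (by rw [hun0]; exact hu₀) t ht
    have h2 : C * (Φ (un n τ) + ∫ r in τ..t, ‖Fn n r‖ ^ 2) ≤ C * (Φ u₀ + (2 * IF T + 2)) := by
      rw [hun0]
      refine mul_le_mul_of_nonneg_left ?_ hC.le
      linarith [hmono n t T ht.1 ht.2, hFnT n T hT hn]
    exact ⟨h1.1.trans h2, h1.2.trans h2⟩
  have hl0 : Tendsto (fun n : ℕ => 1 / ((n : ℝ) + 1)) atTop (𝓝 0) :=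
    tendsto_one_div_add_atTop_nhds_zero_nat
  -- convergence
  obtain ⟨u, huc, hlim⟩ := exists_continuous_limit (fun n => (hun n).cont) fun T₀ => by
    set T := max T₀ τ
    have hT : τ ≤ T := le_max_right _ _
    obtain ⟨C, hC, h⟩ := exists_yosida_stability (ι := ι) hp hb hι hε hεpos τ T
    obtain ⟨K, hK, hAK⟩ := hAb T hT
    obtain ⟨N, hN⟩ := exists_nat_ge T
    refine ⟨fun n => C * (2 * (1 / ((n : ℝ) + 1)) + 2 * K * (1 / ((n : ℝ) + 1))), ?_, N,
      fun m n hm hn t ht => ?_⟩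
    · simpa using ((hl0.const_mul 2).add (hl0.const_mul (2 * K))).const_mul C
    · have hpm : 0 < 1 / ((m : ℝ) + 1) := hlpos m
      have hpn : 0 < 1 / ((n : ℝ) + 1) := hlpos n
      have hmT : T ≤ m := hN.trans (by exact_mod_cast hm)
      have hnT : T ≤ n := hN.trans (by exact_mod_cast hn)
      rcases le_total t τ with h1 | h1
      · rw [(hun m).const t h1, (hun n).const t h1, hun0, hun0, sub_self, norm_zero,
          zero_pow two_ne_zero]
        positivity
      have ht' : t ∈ Icc τ T := ⟨h1, ht.trans (le_max_left _ _)⟩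
      refine (h _ _ _ _ _ _ _ _ (hun m) (hun n) t ht').trans ?_
      rw [hun0, hun0, sub_self, norm_zero, zero_pow two_ne_zero, zero_add, ← mul_add]
      refine mul_le_mul_of_nonneg_left ?_ hC.le
      have hGi : ∀ i : ℕ, IntervalIntegrable (fun r => ‖Fn i r - F r‖ ^ 2) volume τ t := fun i =>
        ((hFc i).locSqIntegrable.sub hF).intervalIntegrable_sq _ _
      have hAi : ∀ i : ℕ, IntervalIntegrable (fun r => ‖A i r‖ ^ 2) volume τ t := fun i =>
        ((hAc i).norm.pow 2).intervalIntegrable _ _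
      have h2 : ∫ r in τ..t, (‖Fn m r - Fn n r‖ ^ 2 + (1 / ((m : ℝ) + 1) + 1 / ((n : ℝ) + 1))
            * (‖A m r‖ ^ 2 + ‖A n r‖ ^ 2))
          ≤ ∫ r in τ..t, ((2 * ‖Fn m r - F r‖ ^ 2 + 2 * ‖Fn n r - F r‖ ^ 2)
            + (1 / ((m : ℝ) + 1) + 1 / ((n : ℝ) + 1)) * (‖A m r‖ ^ 2 + ‖A n r‖ ^ 2)) := by
        refine intervalIntegral.integral_mono_on h1
          (((((hFc m).sub (hFc n)).norm.pow 2).intervalIntegrable _ _).add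
            (((hAi m).add (hAi n)).const_mul _))
          ((((hGi m).const_mul 2).add ((hGi n).const_mul 2)).add
            (((hAi m).add (hAi n)).const_mul _)) fun r _ => ?_
        have h3 := norm_sub_le (Fn m r - F r) (Fn n r - F r)
        rw [sub_sub_sub_cancel_right] at h3
        have h4 : ‖Fn m r - Fn n r‖ ^ 2 ≤ (‖Fn m r - F r‖ + ‖Fn n r - F r‖) ^ 2 := by gcongr
        nlinarith [sq_nonneg (‖Fn m r - F r‖ - ‖Fn n r - F r‖)]
      refine h2.trans ?_
      rw [intervalIntegral.integral_add (((hGi m).const_mul 2).add ((hGi n).const_mul 2))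
          (((hAi m).add (hAi n)).const_mul _),
        intervalIntegral.integral_add ((hGi m).const_mul 2) ((hGi n).const_mul 2),
        intervalIntegral.integral_const_mul, intervalIntegral.integral_const_mul,
        intervalIntegral.integral_const_mul, intervalIntegral.integral_add (hAi m) (hAi n)]
      have h5 := (hAK m hmT t ht').2
      have h6 := (hAK n hnT t ht').2
      have h7 := hFa m t h1 (ht'.2.trans hmT)
      have h8 := hFa n t h1 (ht'.2.trans hnT)
      have h9 := mul_le_mul_of_nonneg_left (add_le_add h5 h6) (add_pos hpm hpn).le
      linarith
  set w : ℕ → ℝ → V := fun n t => proxMap (powDomain ι p) Φ (1 / ((n : ℝ) + 1)) (un n t) with hwd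
  have hu0 : ∀ t ≤ τ, u t = u₀ := fun t ht =>
    tendsto_nhds_unique ((hlim t).tendsto_at (mem_Iic.mpr le_rfl))
      (tendsto_const_nhds.congr fun n => by rw [(hun n).const t ht, hun0])
  -- The distance from `un n t` to its proximal point is `l ‖A‖` with `l = 1 / (n + 1)`. As `l ‖A‖²`
  -- is bounded, its square is of order `l`.
  have hwlim : ∀ t, τ < t → Tendsto (fun n => w n t) atTop (𝓝 (u t)) := by
    intro t ht
    obtain ⟨K, hK, hAK⟩ := hAb t ht.le
    have h1 : Tendsto (fun n => un n t - w n t) atTop (𝓝 0) := by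
      rw [tendsto_zero_iff_norm_tendsto_zero]
      have h2 : Tendsto (fun n : ℕ => Real.sqrt (K * (1 / ((n : ℝ) + 1)))) atTop (𝓝 0) := by
        have := (Real.continuous_sqrt.tendsto (K * 0)).comp (hl0.const_mul K)
        rw [mul_zero, Real.sqrt_zero] at this
        exact this
      refine squeeze_zero' (Eventually.of_forall fun n => norm_nonneg _) ?_ h2
      obtain ⟨N, hN⟩ := exists_nat_ge t
      filter_upwards [eventually_ge_atTop N] with n hn
      refine Real.le_sqrt_of_sq_le ?_
      have h3 : un n t - w n t = (1 / ((n : ℝ) + 1)) • A n t :=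
        ConvexPotential.sub_proxMap (hlpos n) (un n t)
      have h4 := (hAK n (hN.trans (by exact_mod_cast hn)) t ⟨ht.le, le_rfl⟩).1
      have h5 := hlpos n
      rw [h3, norm_smul, Real.norm_eq_abs, abs_of_pos h5]
      nlinarith
    have h2 := ((hlim t).tendsto_at (mem_Iic.mpr le_rfl)).sub h1
    simpa using h2
  obtain ⟨h1, h2⟩ := IsIntegralSolution.of_tendsto (w := w) (Fn := Fn) (F := F) hβ hι hε
    (fun n => (hun n).cont) huc hlim (fun n => (hun n).continuous_proxMap hp hb) hwlim
    (K := fun T => c T * (3 + 2 * IF T) * (1 + ‖u₀‖ ^ 2)) (fun T => by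
      rcases lt_or_ge T τ with hT | hT
      · exact Eventually.of_forall fun n => by rw [Ioc_eq_empty (not_lt.mpr hT.le)]; simp
      obtain ⟨N, hN⟩ := exists_nat_ge T
      filter_upwards [eventually_ge_atTop N] with n hn
      refine (hcb T _ _ _ _ (hun n)).trans (ENNReal.ofReal_le_ofReal ?_)
      rw [hun0, mul_assoc]
      refine mul_le_mul_of_nonneg_left ?_ (hc T).le
      have h3 := hFnT n T hT (hN.trans (by exact_mod_cast hn))
      have h4 : 0 ≤ IF T * ‖u₀‖ ^ 2 := mul_nonneg (hIF T) (by positivity)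
      nlinarith [sq_nonneg ‖u₀‖])
    (fun n => (hFc n).locSqIntegrable) hF
    (fun s t hs hst => by
      obtain ⟨N, hN⟩ := exists_nat_ge t
      refine squeeze_zero' (Eventually.of_forall fun n =>
        intervalIntegral.integral_nonneg hst fun r _ => by positivity) ?_ hl0
      filter_upwards [eventually_ge_atTop N] with n hn
      refine le_trans ?_ (hFa n t (hs.trans hst) (hN.trans (by exact_mod_cast hn)))
      exact intervalIntegral.integral_mono_interval hs hst le_rfl
        (Eventually.of_forall fun r => by positivity)
        (((hFc n).locSqIntegrable.sub hF).intervalIntegrable_sq _ _))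
    (fun n v hv s t hs hst => (hun n).integral_eq hβ hb hε hv hs hst)
  exact ⟨u, h1, hu0, h2⟩

/-- Solvability of the integrated equation. -/
theorem exists_integralSolution (hβ : MonotoneGrowth β p) (hι : ∀ v, ‖ι v‖ ≤ ‖v‖)
    (hε : ContDiff ℝ 1 ε) (hεpos : ∀ t, 0 < ε t) (hD : Dense (powDomain ι p)) (τ : ℝ)
    {F : ℝ → V} (hF : LocSqIntegrable F) (u₀ : V) :
    ∃ u, IsIntegralSolution ι ε β p τ F u ∧ ∀ t ≤ τ, u t = u₀ := by
  obtain ⟨c, hc, hex⟩ := exists_integralSolution_of_mem hβ hι hε hεpos τ hF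
  obtain ⟨x, hxD, hx⟩ := mem_closure_iff_seq_limit.mp (hD u₀)
  choose un hun hun0 hunb using fun n => hex (x n) (hxD n)
  have hd : Tendsto (fun n => ‖x n - u₀‖ ^ 2) atTop (𝓝 0) := by
    have := (tendsto_iff_norm_sub_tendsto_zero.mp hx).pow 2
    simpa using this
  -- Stability for a common forcing makes the solutions with data `x n` Cauchy. They already solve
  -- the unregularised equation, so in the passage to the limit they are their own second sequence.
  obtain ⟨u, huc, hlim⟩ := exists_continuous_limit (fun n => (hun n).cont) fun T => by
    obtain ⟨C, hC, h⟩ := IsIntegralSolution.stability (ι := ι) hβ hι hε hεpos τ T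
    refine ⟨fun n => (1 + C) * (2 * ‖x n - u₀‖ ^ 2), ?_, 0, fun m n _ _ t ht => ?_⟩
    · simpa using (hd.const_mul 2).const_mul (1 + C)
    have h3 := norm_sub_le (x m - u₀) (x n - u₀)
    rw [sub_sub_sub_cancel_right] at h3
    have h4 : ‖x m - x n‖ ^ 2 ≤ (‖x m - u₀‖ + ‖x n - u₀‖) ^ 2 := by gcongr
    have h5 : ‖x m - x n‖ ^ 2 ≤ 2 * ‖x m - u₀‖ ^ 2 + 2 * ‖x n - u₀‖ ^ 2 := by
      nlinarith [sq_nonneg (‖x m - u₀‖ - ‖x n - u₀‖)]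
    have h6 : 0 ≤ ‖x m - x n‖ ^ 2 := by positivity
    rcases le_total t τ with h1 | h1
    · rw [hun0 m t h1, hun0 n t h1]
      nlinarith
    · have h2 := h F F _ _ hF hF (hun m) (hun n) t ⟨h1, ht⟩
      simp only [sub_self, norm_zero, zero_pow two_ne_zero, intervalIntegral.integral_zero,
        add_zero] at h2
      rw [hun0 m τ le_rfl, hun0 n τ le_rfl] at h2
      nlinarith
  have hu0 : ∀ t ≤ τ, u t = u₀ := fun t ht =>
    tendsto_nhds_unique ((hlim t).tendsto_at (mem_Iic.mpr le_rfl))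
      (hx.congr fun n => (hun0 n t ht).symm)
  refine ⟨u, (IsIntegralSolution.of_tendsto (w := un) (Fn := fun _ => F) (F := F) hβ hι hε
    (fun n => (hun n).cont) huc hlim (fun n => (hun n).cont)
    (fun t _ => (hlim t).tendsto_at (mem_Iic.mpr le_rfl))
    (K := fun T => c T * (2 + ‖u₀‖ ^ 2)) (fun T => ?_) (fun _ => hF) hF
    (fun s t _ _ => by simp) fun n v hv s t hs hst => (hun n).eq v hv s t hs hst).1, hu0⟩
  have h1 : Tendsto (fun n => ‖x n‖ ^ 2) atTop (𝓝 (‖u₀‖ ^ 2)) := hx.norm.pow 2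
  filter_upwards [h1.eventually (gt_mem_nhds (lt_add_one (‖u₀‖ ^ 2)))] with n hn
  refine (hunb n T).trans (ENNReal.ofReal_le_ofReal ?_)
  exact mul_le_mul_of_nonneg_left (by linarith) (hc T).le

end Existence

/-! ### Forcing that depends causally on the solution. -/

section Causal

variable {X : Type*} [MeasurableSpace X] {μ : Measure X} [IsFiniteMeasure μ]
variable {V : Type*} [NormedAddCommGroup V] [InnerProductSpace ℝ V] [CompleteSpace V]
variable {ι : V →L[ℝ] Lp ℝ 2 μ} {ε β : ℝ → ℝ} {p τ : ℝ}

lemma IsIntegralSolution.congr {F u w : ℝ → V} (hu : IsIntegralSolution ι ε β p τ F u)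
    (hw : Continuous w) (h : ∀ t, τ ≤ t → w t = u t) : IsIntegralSolution ι ε β p τ F w := by
  refine ⟨hw, fun T => ?_, fun v hv s t hs hst => ?_⟩
  · rw [setLIntegral_congr_fun measurableSet_Ioc fun t ht => by rw [h t ht.1.le]]
    exact hu.pow T
  · rw [h t (hs.trans hst), h s hs, hu.eq v hv s t hs hst]
    refine intervalIntegral.integral_congr fun r hr => ?_
    rw [uIcc_of_le hst] at hr
    simp only [h r (hs.trans hr.1)]

/-- The evolution equation with a causal perturbation of linear growth that is Lipschitz
continuous on bounded sets has a solution. -/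
theorem exists_integralSolution_causal (hβ : MonotoneGrowth β p) (hι : ∀ v, ‖ι v‖ ≤ ‖v‖)
    (hε : ContDiff ℝ 1 ε) (hεpos : ∀ t, 0 < ε t) (hD : Dense (powDomain ι p)) {u₀ : ℝ → V}
    (hu₀ : Continuous u₀) (hconst : ∀ t, τ ≤ t → u₀ t = u₀ τ) {B₀ : ℝ} (hB₀ : ∀ t, ‖u₀ t‖ ^ 2 ≤ B₀)
    {N : (ℝ → V) → ℝ → V}
    (hN : ∀ u, Continuous u → (∀ t ≤ τ, u t = u₀ t) → LocSqIntegrable (N u))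
    (hgrow : ∀ T, ∃ C, 0 ≤ C ∧ ∀ u, Continuous u → (∀ t ≤ τ, u t = u₀ t) → ∀ r ∈ Icc τ T, ∀ B,
      (∀ s ≤ r, ‖u s‖ ^ 2 ≤ B) → ‖N u r - N u₀ r‖ ^ 2 ≤ C * (1 + B))
    (hlip : ∀ T R, ∃ C, 0 ≤ C ∧ ∀ u v, Continuous u → Continuous v → (∀ t ≤ τ, u t = u₀ t) →
      (∀ t ≤ τ, v t = u₀ t) → (∀ s ≤ T, ‖u s‖ ^ 2 ≤ R) → (∀ s ≤ T, ‖v s‖ ^ 2 ≤ R) →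
      ∀ r ∈ Icc τ T, ∀ B, 0 ≤ B → (∀ s ≤ r, ‖u s - v s‖ ≤ B) → ‖N u r - N v r‖ ^ 2 ≤ C * B ^ 2) :
    ∃ u, (∀ t ≤ τ, u t = u₀ t) ∧ IsIntegralSolution ι ε β p τ (N u) u := by
  -- The iteration map: `S w` solves the equation with the forcing frozen at `w`. Its values on
  -- curves without the prescribed history are irrelevant.
  have hS : ∀ w, ∃ Sw, Continuous w → (∀ t ≤ τ, w t = u₀ t) →
      IsIntegralSolution ι ε β p τ (N w) Sw ∧ ∀ t ≤ τ, Sw t = u₀ t := by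
    intro w
    by_cases hw : Continuous w ∧ ∀ t ≤ τ, w t = u₀ t
    · obtain ⟨u, hu, hu0⟩ := exists_integralSolution hβ hι hε hεpos hD τ (hN w hw.1 hw.2) (u₀ τ)
      -- Before `τ` the solution `u` is the constant `u₀ τ`. The added term installs the history
      -- there and vanishes after `τ`.
      refine ⟨fun t => u t + (u₀ t - u₀ τ), fun _ _ => ⟨hu.congr
        (hu.cont.add (hu₀.sub continuous_const)) fun t ht => ?_, fun t ht => ?_⟩⟩
      · simp [hconst t ht]
      · simp [hu0 t ht]
    · exact ⟨w, fun h1 h2 => absurd ⟨h1, h2⟩ hw⟩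
  choose S hS using hS
  obtain ⟨z, hz, hz0⟩ : ∃ z, IsIntegralSolution ι ε β p τ (N u₀) z ∧ ∀ t ≤ τ, z t = u₀ t :=
    ⟨S u₀, hS u₀ hu₀ fun _ _ => rfl⟩
  have hN₀ := hN u₀ hu₀ fun _ _ => rfl
  have hB₀0 : 0 ≤ B₀ := (sq_nonneg _).trans (hB₀ τ)
  choose Cs hCs hstab using fun T => IsIntegralSolution.stability (ι := ι) hβ hι hε hεpos τ T
  choose Cg hCg hgr using hgrow
  -- the a priori bound
  have hK : ∀ T, ∃ K γ, B₀ ≤ K ∧ 0 ≤ γ ∧ ∀ w, Continuous w → (∀ t ≤ τ, w t = u₀ t) →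
      (∀ t ≤ T, ‖w t‖ ^ 2 ≤ K * Real.exp (γ * max (t - τ) 0)) →
      ∀ t ≤ T, ‖S w t‖ ^ 2 ≤ K * Real.exp (γ * max (t - τ) 0) := by
    intro T
    obtain ⟨Z, hZ⟩ := (isCompact_Icc (a := τ) (b := T)).exists_bound_of_continuousOn
      hz.cont.continuousOn
    set c := Cs T * Cg T with hc
    have hc0 : 0 ≤ c := mul_nonneg (hCs T).le (hCg T)
    -- With this rate the growth of the forcing contributes at most a quarter of the bound to `‖S w
    -- - z‖²`, hence half of it to `‖S w‖²`. The other half absorbs `2 * Z ^ 2` and `2 * c * |T -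
    -- τ|`, which fixes the constant `K` below.
    set γ := 4 * c + 1 with hγ
    have hγ0 : 0 < γ := by positivity
    set K := B₀ + 4 * Z ^ 2 + 4 * c * |T - τ| with hKd
    have hK0 : 0 ≤ K := by positivity
    refine ⟨K, γ, ?_, hγ0.le, fun w hw hw0 hwb t ht => ?_⟩
    · have h1 : 0 ≤ 4 * c * |T - τ| := by positivity
      linarith [sq_nonneg Z]
    obtain ⟨hSw, hSw0⟩ := hS w hw hw0
    rcases le_total t τ with h1 | h1
    · rw [hSw0 t h1]
      refine (hB₀ t).trans ?_
      have h2 : 1 ≤ Real.exp (γ * max (t - τ) 0) :=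
        Real.one_le_exp (mul_nonneg hγ0.le (le_max_right _ _))
      have h3 : 0 ≤ 4 * c * |T - τ| := by positivity
      nlinarith [sq_nonneg Z]
    have hNw := hN w hw hw0
    have h2 := hstab T _ _ _ _ hNw hN₀ hSw hz t ⟨h1, ht⟩
    rw [hSw0 τ le_rfl, hz0 τ le_rfl, sub_self, norm_zero, zero_pow two_ne_zero, zero_add] at h2
    have hexpc : Continuous fun r => Cg T * (1 + K * Real.exp (γ * (r - τ))) := by fun_prop
    have h3 : ∫ r in τ..t, ‖N w r - N u₀ r‖ ^ 2
        ≤ ∫ r in τ..t, Cg T * (1 + K * Real.exp (γ * (r - τ))) := by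
      refine intervalIntegral.integral_mono_on h1 ((hNw.sub hN₀).intervalIntegrable_sq _ _)
        (hexpc.intervalIntegrable _ _) fun r hr => ?_
      refine hgr T w hw hw0 r ⟨hr.1, hr.2.trans ht⟩ _ fun s hs => ?_
      refine (hwb s (hs.trans (hr.2.trans ht))).trans ?_
      have h4 : max (s - τ) 0 ≤ r - τ := max_le (by linarith) (by linarith [hr.1])
      gcongr
    have hec : Continuous fun r => K * Real.exp (γ * (r - τ)) := by fun_prop
    have h5 : ∫ r in τ..t, Cg T * (1 + K * Real.exp (γ * (r - τ)))
        ≤ Cg T * (|T - τ| + K * (Real.exp (γ * (t - τ)) / γ)) := by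
      rw [intervalIntegral.integral_const_mul, intervalIntegral.integral_add (by simp)
        (hec.intervalIntegrable _ _), intervalIntegral.integral_const_mul,
        intervalIntegral.integral_const, smul_eq_mul, mul_one]
      have h6 := integral_exp_mul_sub_le hγ0 τ t
      have h7 : t - τ ≤ |T - τ| := (by linarith : t - τ ≤ T - τ).trans (le_abs_self _)
      have := hCg T
      gcongr
    have h8 : ‖S w t - z t‖ ^ 2 ≤ c * |T - τ| + c / γ * (K * Real.exp (γ * (t - τ))) := by
      refine (h2.trans (mul_le_mul_of_nonneg_left (h3.trans h5) (hCs T).le)).trans_eq ?_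
      rw [hc]; ring
    have h9 : c / γ ≤ 1 / 4 := by
      rw [div_le_iff₀ hγ0, hγ]; linarith
    have h10 : 1 ≤ Real.exp (γ * (t - τ)) := Real.one_le_exp (mul_nonneg hγ0.le (by linarith))
    have h11 : c / γ * (K * Real.exp (γ * (t - τ))) ≤ 1 / 4 * (K * Real.exp (γ * (t - τ))) := by
      gcongr
    have h12 : ‖z t‖ ^ 2 ≤ Z ^ 2 := by
      have := hZ t ⟨h1, ht⟩
      gcongr
    have h13 : ‖S w t‖ ^ 2 ≤ 2 * ‖S w t - z t‖ ^ 2 + 2 * ‖z t‖ ^ 2 := by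
      have h14 := norm_add_le (S w t - z t) (z t)
      rw [sub_add_cancel] at h14
      have h15 : ‖S w t‖ ^ 2 ≤ (‖S w t - z t‖ + ‖z t‖) ^ 2 := by gcongr
      nlinarith [sq_nonneg (‖S w t - z t‖ - ‖z t‖)]
    rw [max_eq_left (by linarith : 0 ≤ t - τ)]
    have h16 : K ≤ K * Real.exp (γ * (t - τ)) := le_mul_of_one_le_right hK0 h10
    linarith
  choose K γ hKB hγ hKinv using hK
  -- The forcing is Lipschitz only on bounded sets, so the iteration is confined to curves that obey
  -- the a priori bound for every `T` at once; this set is invariant under `S` and closed under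
  -- pointwise limits with continuous limit.
  obtain ⟨u, hu, hfix⟩ := exists_fixedPoint_of_causal (S := S) (τ := τ) (u₀ := u₀)
    (Y := {u | Continuous u ∧ (∀ t ≤ τ, u t = u₀ t) ∧
      ∀ T, ∀ t ≤ T, ‖u t‖ ^ 2 ≤ K T * Real.exp (γ T * max (t - τ) 0)})
    ⟨hu₀, fun _ _ => rfl, fun T t _ => (hB₀ t).trans ((hKB T).trans
      (le_mul_of_one_le_right (hB₀0.trans (hKB T))
        (Real.one_le_exp (mul_nonneg (hγ T) (le_max_right _ _)))))⟩
    (fun u hu => hu.1) (fun u hu => hu.2.1)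
    (fun v u hv huc hlim => ⟨huc, fun t ht => tendsto_nhds_unique (hlim t)
        (tendsto_const_nhds.congr fun n => ((hv n).2.1 t ht).symm),
      fun T t ht => le_of_tendsto ((hlim t).norm.pow 2)
        (Eventually.of_forall fun n => (hv n).2.2 T t ht)⟩)
    (fun u hu => ⟨(hS u hu.1 hu.2.1).1.cont, (hS u hu.1 hu.2.1).2,
      fun T => hKinv T u hu.1 hu.2.1 (hu.2.2 T)⟩)
    fun T => by
      obtain ⟨C, hC, hL⟩ := hlip T (K T * Real.exp (γ T * |T - τ|))
      have hc0 : 0 ≤ Cs T * C := mul_nonneg (hCs T).le hC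
      -- Distances enter squared, so the weight has rate `2 * g` and the squared contraction factor
      -- is `Cs T * C / (2 * g)`, at most `1 / 4`.
      refine ⟨2 * (Cs T * C) + 1, by positivity, fun u hu v hv d hd hduv t ht => ?_⟩
      set g := 2 * (Cs T * C) + 1 with hg
      have hg0 : 0 < g := by positivity
      obtain ⟨hSu, hSu0⟩ := hS u hu.1 hu.2.1
      obtain ⟨hSv, hSv0⟩ := hS v hv.1 hv.2.1
      rcases le_total t τ with h1 | h1
      · rw [hSu0 t h1, hSv0 t h1, sub_self, norm_zero]
        positivity
      have hKT : 0 ≤ K T := hB₀0.trans (hKB T)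
      have hbd : ∀ w : ℝ → V, (∀ t ≤ T, ‖w t‖ ^ 2 ≤ K T * Real.exp (γ T * max (t - τ) 0)) →
          ∀ s ≤ T, ‖w s‖ ^ 2 ≤ K T * Real.exp (γ T * |T - τ|) := fun w hw s hs => by
        refine (hw s hs).trans (mul_le_mul_of_nonneg_left (Real.exp_le_exp.mpr
          (mul_le_mul_of_nonneg_left ?_ (hγ T))) hKT)
        exact max_le ((by linarith : s - τ ≤ T - τ).trans (le_abs_self _)) (abs_nonneg _)
      have hNu := hN u hu.1 hu.2.1
      have hNv := hN v hv.1 hv.2.1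
      have h2 := hstab T _ _ _ _ hNu hNv hSu hSv t ⟨h1, ht⟩
      rw [hSu0 τ le_rfl, hSv0 τ le_rfl, sub_self, norm_zero, zero_pow two_ne_zero, zero_add] at h2
      have hec : Continuous fun r => C * d ^ 2 * Real.exp (2 * g * (r - τ)) := by fun_prop
      have h3 : ∫ r in τ..t, ‖N u r - N v r‖ ^ 2
          ≤ ∫ r in τ..t, C * d ^ 2 * Real.exp (2 * g * (r - τ)) := by
        refine intervalIntegral.integral_mono_on h1 ((hNu.sub hNv).intervalIntegrable_sq _ _)
          (hec.intervalIntegrable _ _) fun r hr => ?_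
        refine (hL u v hu.1 hv.1 hu.2.1 hv.2.1 (hbd u (hu.2.2 T)) (hbd v (hv.2.2 T)) r
          ⟨hr.1, hr.2.trans ht⟩ (d * Real.exp (g * (r - τ))) (by positivity)
          fun s hs => ?_).trans_eq ?_
        · refine (hduv s (hs.trans (hr.2.trans ht))).trans ?_
          gcongr
        · rw [mul_pow, ← Real.exp_nat_mul]
          push_cast
          ring_nf
      rw [intervalIntegral.integral_const_mul] at h3
      have h4 := integral_exp_mul_sub_le (by positivity : 0 < 2 * g) τ t
      have h5 : ‖S u t - S v t‖ ^ 2 ≤ (d / 2 * Real.exp (g * (t - τ))) ^ 2 := by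
        refine (h2.trans (mul_le_mul_of_nonneg_left (h3.trans
          (mul_le_mul_of_nonneg_left h4 (by positivity))) (hCs T).le)).trans ?_
        have e1 : (d / 2 * Real.exp (g * (t - τ))) ^ 2
            = 1 / 4 * (d ^ 2 * Real.exp (2 * g * (t - τ))) := by
          rw [mul_pow, ← Real.exp_nat_mul]
          push_cast
          ring_nf
        have e2 : Cs T * (C * d ^ 2 * (Real.exp (2 * g * (t - τ)) / (2 * g)))
            = Cs T * C / (2 * g) * (d ^ 2 * Real.exp (2 * g * (t - τ))) := by ring
        rw [e1, e2]
        refine mul_le_mul_of_nonneg_right ?_ (by positivity)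
        rw [div_le_iff₀ (by positivity), hg]
        linarith
      exact le_of_sq_le_sq h5 (by positivity)
  have h1 := hS u hu.1 hu.2.1
  rw [hfix] at h1
  exact ⟨u, h1.2, h1.1⟩

end Causal

/-! ### Delay segments and Carathéodory maps. -/

section Delay

/-- Composition of a Carathéodory map with a continuous curve. -/
lemma aestronglyMeasurable_comp_curve {E F : Type*} [TopologicalSpace E] [NormedAddCommGroup F]
    {g : ℝ → E → F} (hg : ∀ x, AEStronglyMeasurable (fun t => g t x) volume)
    (hc : ∀ t, Continuous (g t)) {w : ℝ → E} (hw : Continuous w) :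
    AEStronglyMeasurable (fun t => g t (w t)) volume := by
  -- Sampling the curve on the grid of step `1 / (n + 1)` leaves, on each of countably many
  -- intervals, the map `t ↦ g t x` with `x` fixed; continuity of `g t` gives convergence.
  refine aestronglyMeasurable_of_tendsto_ae atTop
    (f := fun (n : ℕ) t => g t (w (⌊((n : ℝ) + 1) * t⌋ / ((n : ℝ) + 1)))) (fun n => ?_)
    (Eventually.of_forall fun t => ?_)
  · have hU : (⋃ z : ℤ, {t : ℝ | ⌊((n : ℝ) + 1) * t⌋ = z}) = univ :=
      eq_univ_of_forall fun t => mem_iUnion.mpr ⟨_, rfl⟩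
    have hm : ∀ z : ℤ, MeasurableSet {t : ℝ | ⌊((n : ℝ) + 1) * t⌋ = z} := fun z =>
      (Int.measurable_floor.comp (measurable_const_mul _)) (measurableSet_singleton z)
    rw [← Measure.restrict_univ (μ := volume), ← hU, aestronglyMeasurable_iUnion_iff]
    intro z
    refine ((hg (w ((z : ℝ) / ((n : ℝ) + 1)))).restrict).congr ?_
    filter_upwards [ae_restrict_mem (hm z)] with t ht
    have ht' : ⌊((n : ℝ) + 1) * t⌋ = z := ht
    rw [ht']
  · refine ((hc t).tendsto _).comp ((hw.tendsto t).comp ?_)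
    have h0 : Tendsto (fun n : ℕ => 1 / ((n : ℝ) + 1)) atTop (𝓝 0) :=
      tendsto_one_div_add_atTop_nhds_zero_nat
    refine tendsto_iff_norm_sub_tendsto_zero.mpr
      (squeeze_zero (fun _ => norm_nonneg _) (fun n => ?_) h0)
    have hn : (0 : ℝ) < (n : ℝ) + 1 := by positivity
    have h1 := Int.floor_le (((n : ℝ) + 1) * t)
    have h2 := Int.lt_floor_add_one (((n : ℝ) + 1) * t)
    rw [div_sub' hn.ne', norm_div, Real.norm_of_nonneg hn.le]
    refine div_le_div_of_nonneg_right ?_ hn.le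
    rw [Real.norm_eq_abs, abs_le]
    constructor <;> linarith

variable {E : Type} [NormedAddCommGroup E] {k : ℝ}

lemma delaySegment_apply {w : ℝ → E} {t : ℝ}
    (hw : Continuous fun θ : Icc (-k) 0 => w (t + (θ : ℝ))) (θ : Icc (-k) 0) :
    delaySegment k w t θ = w (t + (θ : ℝ)) := by
  rw [delaySegment, dif_pos hw]; rfl

lemma continuous_segment {w : ℝ → E} (hw : Continuous w) (t : ℝ) :
    Continuous fun θ : Icc (-k) 0 => w (t + (θ : ℝ)) := by fun_prop

lemma continuous_delaySegment {w : ℝ → E} (hw : Continuous w) :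
    Continuous fun t => delaySegment k w t := by
  have h : Continuous fun q : ℝ × Icc (-k) 0 => w (q.1 + (q.2 : ℝ)) := by fun_prop
  refine (ContinuousMap.curry ⟨_, h⟩).continuous.congr fun t => ?_
  ext θ
  rw [delaySegment_apply (continuous_segment hw t)]
  rfl

lemma norm_delaySegment_sub_le {w w' : ℝ → E} (hw : Continuous w) (hw' : Continuous w') {t B : ℝ}
    (hB : 0 ≤ B) (h : ∀ s ∈ Icc (t - k) t, ‖w s - w' s‖ ≤ B) :
    ‖delaySegment k w t - delaySegment k w' t‖ ≤ B := by
  refine (ContinuousMap.norm_le _ hB).mpr fun θ => ?_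
  rw [ContinuousMap.sub_apply, delaySegment_apply (continuous_segment hw t),
    delaySegment_apply (continuous_segment hw' t)]
  exact h _ ⟨by linarith [θ.2.1], by linarith [θ.2.2]⟩

end Delay

/-! ### The delay equation in the energy space. -/

section DelayForcing

variable {X : Type} [MeasurableSpace X] {μ : Measure X} [IsFiniteMeasure μ]
variable {V : Type} [NormedAddCommGroup V] [InnerProductSpace ℝ V] [CompleteSpace V]

/-- The lower order terms of the equation, as an element of the energy space. -/
noncomputable def delayForcing (ι : V →L[ℝ] Lp ℝ 2 μ) (a : ℝ → ℝ) (j : Lp ℝ 2 μ) (η k : ℝ)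
    (g : ℝ → C(Icc (-k) 0, Lp ℝ 2 μ) → Lp ℝ 2 μ) (h : ℝ → V →L[ℝ] ℝ) (u : ℝ → V) (t : ℝ) : V :=
  -(a (inner ℝ j (ι (u t))) • gradOp ι (u t)) + η • ContinuousLinearMap.adjoint ι (ι (u t))
    + ContinuousLinearMap.adjoint ι (g t (delaySegment k (fun s => ι (u s)) t))
    + (InnerProductSpace.toDual ℝ V).symm (h t)

variable {ι : V →L[ℝ] Lp ℝ 2 μ} {a : ℝ → ℝ} {j : Lp ℝ 2 μ} {η k : ℝ}
  {g : ℝ → C(Icc (-k) 0, Lp ℝ 2 μ) → Lp ℝ 2 μ} {h : ℝ → V →L[ℝ] ℝ}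

lemma inner_delayForcing (u : ℝ → V) (t : ℝ) (v : V) :
    inner ℝ (delayForcing ι a j η k g h u t) v
      = -(a (inner ℝ j (ι (u t))) * inner ℝ (gradOp ι (u t)) v) + η * inner ℝ (ι (u t)) (ι v)
        + inner ℝ (g t (delaySegment k (fun s => ι (u s)) t)) (ι v) + h t v := by
  simp only [delayForcing, inner_add_left, inner_neg_left, real_inner_smul_left,
    ContinuousLinearMap.adjoint_inner_left, InnerProductSpace.toDual_symm_apply]

lemma norm_adjoint_apply_le (hι : ∀ v, ‖ι v‖ ≤ ‖v‖) (w : Lp ℝ 2 μ) :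
    ‖ContinuousLinearMap.adjoint ι w‖ ≤ ‖w‖ := by
  have h1 : ‖ι‖ ≤ 1 := ι.opNorm_le_bound zero_le_one fun v => by simpa using hι v
  refine (ContinuousLinearMap.le_opNorm _ _).trans ?_
  rw [LinearIsometryEquiv.norm_map]
  exact mul_le_of_le_one_left (norm_nonneg _) h1

lemma norm_gradOp_apply_le (hι : ∀ v, ‖ι v‖ ≤ ‖v‖) (v : V) : ‖gradOp ι v‖ ≤ 2 * ‖v‖ :=
  (ContinuousLinearMap.le_opNorm _ _).trans (by gcongr; exact norm_gradOp_le hι)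

lemma norm_sub_le_of_sq {Cg : ℝ}
    (hglip : ∀ t ν₁ ν₂, ‖g t ν₁ - g t ν₂‖ ^ 2 ≤ Cg * ‖ν₁ - ν₂‖ ^ 2) (t : ℝ)
    (ν₁ ν₂ : C(Icc (-k) 0, Lp ℝ 2 μ)) : ‖g t ν₁ - g t ν₂‖ ≤ Real.sqrt Cg * ‖ν₁ - ν₂‖ := by
  have h1 := Real.sqrt_le_sqrt (hglip t ν₁ ν₂)
  rwa [Real.sqrt_sq (norm_nonneg _), Real.sqrt_mul' _ (sq_nonneg _),
    Real.sqrt_sq (norm_nonneg _)] at h1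

lemma continuous_delay {Cg : ℝ}
    (hglip : ∀ t ν₁ ν₂, ‖g t ν₁ - g t ν₂‖ ^ 2 ≤ Cg * ‖ν₁ - ν₂‖ ^ 2) (t : ℝ) :
    Continuous (g t) := by
  refine (LipschitzWith.of_dist_le_mul (K := (Real.sqrt Cg).toNNReal) fun u v => ?_).continuous
  rw [Real.coe_toNNReal _ (Real.sqrt_nonneg _), dist_eq_norm, dist_eq_norm]
  exact norm_sub_le_of_sq hglip t u v

/-- The force `h` cancels, and the reaction and delay terms are globally Lipschitz. The nonlocal
diffusion is kept apart because it is estimated in two ways: by boundedness of `a` for growth and by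
its local Lipschitz continuity for contraction. -/
lemma norm_delayForcing_sub_le (hι : ∀ v, ‖ι v‖ ≤ ‖v‖) (hη : 0 ≤ η) {Cg : ℝ}
    (hglip : ∀ t ν₁ ν₂, ‖g t ν₁ - g t ν₂‖ ^ 2 ≤ Cg * ‖ν₁ - ν₂‖ ^ 2) {u v : ℝ → V}
    (hu : Continuous u) (hv : Continuous v) {t B : ℝ} (hB : 0 ≤ B)
    (hk : 0 ≤ k) (h1 : ∀ s ∈ Icc (t - k) t, ‖u s - v s‖ ≤ B) :
    ‖delayForcing ι a j η k g h u t - delayForcing ι a j η k g h v t‖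
      ≤ ‖a (inner ℝ j (ι (u t))) • gradOp ι (u t) - a (inner ℝ j (ι (v t))) • gradOp ι (v t)‖
        + (η + Real.sqrt Cg) * B := by
  have e : delayForcing ι a j η k g h u t - delayForcing ι a j η k g h v t
      = -(a (inner ℝ j (ι (u t))) • gradOp ι (u t) - a (inner ℝ j (ι (v t))) • gradOp ι (v t))
        + (η • ContinuousLinearMap.adjoint ι (ι (u t - v t))
        + ContinuousLinearMap.adjoint ι (g t (delaySegment k (fun s => ι (u s)) t)
          - g t (delaySegment k (fun s => ι (v s)) t))) := by
    simp only [delayForcing, map_sub, smul_sub]; abel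
  rw [e]
  refine (norm_add_le _ _).trans ?_
  rw [norm_neg]
  refine add_le_add_right ((norm_add_le _ _).trans ?_) _
  rw [add_mul]
  refine add_le_add ?_ ?_
  · rw [norm_smul, Real.norm_of_nonneg hη]
    refine mul_le_mul_of_nonneg_left ((norm_adjoint_apply_le hι _).trans ((hι _).trans ?_)) hη
    exact h1 t ⟨by linarith, le_rfl⟩
  · refine (norm_adjoint_apply_le hι _).trans ((norm_sub_le_of_sq hglip _ _ _).trans ?_)
    refine mul_le_mul_of_nonneg_left (norm_delaySegment_sub_le (ι.continuous.comp hu)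
      (ι.continuous.comp hv) hB fun s hs => ?_) (Real.sqrt_nonneg _)
    rw [Function.comp_apply, Function.comp_apply, ← map_sub]
    exact (hι _).trans (h1 s hs)

lemma locSqIntegrable_delayForcing (ha : LocallyLipschitz a) {Cg : ℝ}
    (hgmeas : ∀ ν, AEStronglyMeasurable (fun t => g t ν) volume) (hgzero : ∀ t, g t 0 = 0)
    (hglip : ∀ t ν₁ ν₂, ‖g t ν₁ - g t ν₂‖ ^ 2 ≤ Cg * ‖ν₁ - ν₂‖ ^ 2)
    (hh : ∀ b c : ℝ, MemLp h 2 (volume.restrict (Icc b c))) {u : ℝ → V} (hu : Continuous u) :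
    LocSqIntegrable (delayForcing ι a j η k g h u) := by
  have hιu : Continuous fun s => ι (u s) := ι.continuous.comp hu
  have h1 : Continuous fun t => -(a (inner ℝ j (ι (u t))) • gradOp ι (u t))
      + η • ContinuousLinearMap.adjoint ι (ι (u t)) := by
    have h2 : Continuous fun t => a (inner ℝ j (ι (u t))) :=
      ha.continuous.comp (continuous_const.inner hιu)
    have h3 : Continuous fun t => gradOp ι (u t) := (gradOp ι).continuous.comp hu
    have h4 : Continuous fun t => ContinuousLinearMap.adjoint ι (ι (u t)) :=
      (ContinuousLinearMap.adjoint ι).continuous.comp hιu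
    exact (h2.smul h3).neg.add (h4.const_smul η)
  have hseg : Continuous fun t => delaySegment k (fun s => ι (u s)) t := continuous_delaySegment hιu
  have h5 : LocSqIntegrable fun t =>
      ContinuousLinearMap.adjoint ι (g t (delaySegment k (fun s => ι (u s)) t)) := by
    intro b c
    obtain ⟨M, hM⟩ := (isCompact_Icc (a := b) (b := c)).exists_bound_of_continuousOn
      hseg.continuousOn
    have hm : MemLp (fun t => g t (delaySegment k (fun s => ι (u s)) t)) 2
        (volume.restrict (Icc b c)) := by
      refine MemLp.of_bound (aestronglyMeasurable_comp_curve hgmeas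
        (continuous_delay hglip) hseg).restrict (Real.sqrt Cg * M) ?_
      filter_upwards [ae_restrict_mem measurableSet_Icc] with t ht
      have h6 := norm_sub_le_of_sq hglip t (delaySegment k (fun s => ι (u s)) t) 0
      rw [hgzero, sub_zero, sub_zero] at h6
      exact h6.trans (mul_le_mul_of_nonneg_left (hM t ht) (Real.sqrt_nonneg _))
    exact (ContinuousLinearMap.adjoint ι).comp_memLp' hm
  have h7 : LocSqIntegrable fun t => (InnerProductSpace.toDual ℝ V).symm (h t) := fun b c =>
    (InnerProductSpace.toDual ℝ V).symm.toContinuousLinearEquiv.toContinuousLinearMap.comp_memLp'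
      (hh b c)
  exact (h1.locSqIntegrable.add h5).add h7

/-- Only the bound `|a| ≤ M` enters, so no size restriction on the curves is needed. This provides
the a priori bounds that must precede the use of a local Lipschitz constant. -/
lemma exists_norm_delayForcing_sub_le_growth (hι : ∀ v, ‖ι v‖ ≤ ‖v‖) (hη : 0 ≤ η) (hk : 0 ≤ k)
    {M Cg : ℝ} (haM : ∀ s, |a s| ≤ M)
    (hglip : ∀ t ν₁ ν₂, ‖g t ν₁ - g t ν₂‖ ^ 2 ≤ Cg * ‖ν₁ - ν₂‖ ^ 2) :
    ∃ C, 0 ≤ C ∧ ∀ u v : ℝ → V, Continuous u → Continuous v → ∀ r B, 0 ≤ B →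
      (∀ s ∈ Icc (r - k) r, ‖u s - v s‖ ≤ B) →
      ‖delayForcing ι a j η k g h u r - delayForcing ι a j η k g h v r‖ ^ 2
        ≤ C * (B ^ 2 + ‖v r‖ ^ 2) := by
  have hM : 0 ≤ M := (abs_nonneg _).trans (haM 0)
  set c := 4 * M + η + Real.sqrt Cg with hc
  have hc0 : 0 ≤ c := by positivity
  refine ⟨c ^ 2 * 2, by positivity, fun u v hu hv r B hB huv => ?_⟩
  have h1 := norm_delayForcing_sub_le (a := a) (j := j) (h := h) hι hη hglip hu hv hB hk huv
  have h2 : ∀ x : V, ∀ s, ‖a s • gradOp ι x‖ ≤ 2 * M * ‖x‖ := fun x s => by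
    rw [norm_smul, Real.norm_eq_abs]
    have h3 := norm_gradOp_apply_le hι x
    have h4 : |a s| * ‖gradOp ι x‖ ≤ M * (2 * ‖x‖) := by gcongr; exact haM s
    linarith
  have h3 := norm_sub_le (a (inner ℝ j (ι (u r))) • gradOp ι (u r))
    (a (inner ℝ j (ι (v r))) • gradOp ι (v r))
  have h4 := h2 (u r) (inner ℝ j (ι (u r)))
  have h5 := h2 (v r) (inner ℝ j (ι (v r)))
  have h7 : ‖u r‖ ≤ B + ‖v r‖ := by
    have := norm_add_le (u r - v r) (v r)
    rw [sub_add_cancel] at this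
    linarith [huv r ⟨by linarith, le_rfl⟩]
  have h6 : ‖delayForcing ι a j η k g h u r - delayForcing ι a j η k g h v r‖
      ≤ c * (B + ‖v r‖) := by
    have h8 : 0 ≤ (η + Real.sqrt Cg) * ‖v r‖ := by positivity
    have h9 : 2 * M * ‖u r‖ ≤ 2 * M * (B + ‖v r‖) := by gcongr
    have h10 : 0 ≤ 2 * M * B := by positivity
    have e : c * (B + ‖v r‖) = 4 * M * B + 4 * M * ‖v r‖ + (η + Real.sqrt Cg) * B
        + (η + Real.sqrt Cg) * ‖v r‖ := by rw [hc]; ring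
    linarith
  calc _ ≤ (c * (B + ‖v r‖)) ^ 2 := by gcongr
    _ = c ^ 2 * (B + ‖v r‖) ^ 2 := by ring
    _ ≤ c ^ 2 * (2 * (B ^ 2 + ‖v r‖ ^ 2)) :=
        mul_le_mul_of_nonneg_left (by nlinarith [sq_nonneg (B - ‖v r‖)]) (sq_nonneg c)
    _ = _ := by ring

/-- For `‖u r‖² ≤ R` the functional `l(u r)` stays in `[-N, N]`, where `a` is Lipschitz. -/
lemma exists_norm_delayForcing_sub_le (hι : ∀ v, ‖ι v‖ ≤ ‖v‖) (hη : 0 ≤ η) (hk : 0 ≤ k)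
    (ha : LocallyLipschitz a) {M Cg : ℝ} (haM : ∀ s, |a s| ≤ M)
    (hglip : ∀ t ν₁ ν₂, ‖g t ν₁ - g t ν₂‖ ^ 2 ≤ Cg * ‖ν₁ - ν₂‖ ^ 2) (R : ℝ) :
    ∃ C, 0 ≤ C ∧ ∀ u v : ℝ → V, Continuous u → Continuous v → ∀ r, ‖u r‖ ^ 2 ≤ R → ‖v r‖ ^ 2 ≤ R →
      ∀ B, 0 ≤ B → (∀ s ∈ Icc (r - k) r, ‖u s - v s‖ ≤ B) →
      ‖delayForcing ι a j η k g h u r - delayForcing ι a j η k g h v r‖ ^ 2 ≤ C * B ^ 2 := by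
  have hM : 0 ≤ M := (abs_nonneg _).trans (haM 0)
  set N := ‖j‖ * Real.sqrt R with hN
  have hN0 : 0 ≤ N := by positivity
  obtain ⟨K, hK, hKlip⟩ := exists_lipschitz_clampR ha hN0
  set c := K * ‖j‖ * (2 * Real.sqrt R) + 2 * M + (η + Real.sqrt Cg) with hc
  have hc0 : 0 ≤ c := by positivity
  refine ⟨c ^ 2, by positivity, fun u v hu hv r hbu hbv B hB huv => ?_⟩
  have hr : r ∈ Icc (r - k) r := ⟨by linarith, le_rfl⟩
  have hl : ∀ x : V, ‖x‖ ^ 2 ≤ R → |inner ℝ j (ι x)| ≤ N := fun x hx =>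
    (abs_real_inner_le_norm _ _).trans (mul_le_mul_of_nonneg_left
      ((hι x).trans (Real.le_sqrt_of_sq_le hx)) (norm_nonneg _))
  have h1 := norm_delayForcing_sub_le (a := a) (j := j) (h := h) hι hη hglip hu hv hB hk huv
  have h2 := hKlip (inner ℝ j (ι (u r))) (inner ℝ j (ι (v r)))
  rw [clampR_of_abs_le (hl _ hbu), clampR_of_abs_le (hl _ hbv),
    ← inner_sub_right, ← map_sub] at h2
  have h3 : |inner ℝ j (ι (u r - v r))| ≤ ‖j‖ * B :=
    (abs_real_inner_le_norm _ _).trans (mul_le_mul_of_nonneg_left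
      ((hι _).trans (huv r hr)) (norm_nonneg _))
  have h4 : ‖a (inner ℝ j (ι (u r))) • gradOp ι (u r)
      - a (inner ℝ j (ι (v r))) • gradOp ι (v r)‖
      ≤ (K * ‖j‖ * (2 * Real.sqrt R) + 2 * M) * B := by
    have e : a (inner ℝ j (ι (u r))) • gradOp ι (u r)
        - a (inner ℝ j (ι (v r))) • gradOp ι (v r)
        = (a (inner ℝ j (ι (u r))) - a (inner ℝ j (ι (v r)))) • gradOp ι (u r)
          + a (inner ℝ j (ι (v r))) • gradOp ι (u r - v r) := by
      rw [map_sub, smul_sub, sub_smul]; abel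
    rw [e]
    refine (norm_add_le _ _).trans ?_
    rw [norm_smul, norm_smul, Real.norm_eq_abs, Real.norm_eq_abs, add_mul]
    refine add_le_add ?_ ?_
    · calc _ ≤ (K * (‖j‖ * B)) * (2 * Real.sqrt R) := by
            refine mul_le_mul (h2.trans (mul_le_mul_of_nonneg_left h3 hK))
              ((norm_gradOp_apply_le hι _).trans (mul_le_mul_of_nonneg_left
                (Real.le_sqrt_of_sq_le hbu) zero_le_two)) (norm_nonneg _) (by positivity)
        _ = _ := by ring
    · calc _ ≤ M * (2 * B) := mul_le_mul (haM _) ((norm_gradOp_apply_le hι _).trans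
            (mul_le_mul_of_nonneg_left (huv r hr) zero_le_two)) (norm_nonneg _) hM
        _ = _ := by ring
  rw [← mul_pow]
  refine pow_le_pow_left₀ (norm_nonneg _) (h1.trans ?_) 2
  rw [hc, add_mul _ (η + Real.sqrt Cg)]
  linarith

/-- Solvability of the evolution equation with delay. -/
theorem exists_delaySolution {ε β : ℝ → ℝ} {p : ℝ} (hβ : MonotoneGrowth β p)
    (hι : ∀ v, ‖ι v‖ ≤ ‖v‖) (hε : ContDiff ℝ 1 ε) (hεpos : ∀ t, 0 < ε t)
    (hD : Dense (powDomain ι p)) (hη : 0 ≤ η) (hk : 0 ≤ k) (ha : LocallyLipschitz a) {M Cg : ℝ}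
    (haM : ∀ s, |a s| ≤ M)
    (hgmeas : ∀ ν, AEStronglyMeasurable (fun t => g t ν) volume) (hgzero : ∀ t, g t 0 = 0)
    (hglip : ∀ t ν₁ ν₂, ‖g t ν₁ - g t ν₂‖ ^ 2 ≤ Cg * ‖ν₁ - ν₂‖ ^ 2)
    (hh : ∀ b c : ℝ, MemLp h 2 (volume.restrict (Icc b c))) {τ : ℝ} {u₀ : ℝ → V}
    (hu₀ : Continuous u₀) (hconst : ∀ t, τ ≤ t → u₀ t = u₀ τ) {B₀ : ℝ}
    (hB₀ : ∀ t, ‖u₀ t‖ ^ 2 ≤ B₀) :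
    ∃ u, (∀ t ≤ τ, u t = u₀ t) ∧
      IsIntegralSolution ι ε β p τ (delayForcing ι a j η k g h u) u := by
  have hB₀0 : 0 ≤ B₀ := (sq_nonneg _).trans (hB₀ τ)
  refine exists_integralSolution_causal hβ hι hε hεpos hD hu₀ hconst hB₀
    (fun u hu _ => locSqIntegrable_delayForcing ha hgmeas hgzero hglip hh hu) (fun T => ?_)
    fun T R => ?_
  · obtain ⟨C, hC, hgr⟩ :=
      exists_norm_delayForcing_sub_le_growth (j := j) (h := h) hι hη hk haM hglip
    refine ⟨C * (2 + 3 * B₀), by positivity, fun u hu _ r _ B hB => ?_⟩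
    have hB0 : 0 ≤ B := (sq_nonneg _).trans (hB r le_rfl)
    refine (hgr u u₀ hu hu₀ r (Real.sqrt B + Real.sqrt B₀) (by positivity) fun s hs =>
      (norm_sub_le _ _).trans (add_le_add (Real.le_sqrt_of_sq_le (hB s hs.2))
        (Real.le_sqrt_of_sq_le (hB₀ s)))).trans ?_
    rw [mul_assoc]
    refine mul_le_mul_of_nonneg_left ?_ hC
    nlinarith [sq_nonneg (Real.sqrt B - Real.sqrt B₀), mul_nonneg hB0 hB₀0, hB₀ r,
      Real.sq_sqrt hB0, Real.sq_sqrt hB₀0]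
  · obtain ⟨C, hC, hl⟩ :=
      exists_norm_delayForcing_sub_le (j := j) (h := h) hι hη hk ha haM hglip R
    exact ⟨C, hC, fun u v hu hv _ _ hbu hbv r hr B hB huv =>
      hl u v hu hv r (hbu r hr.2) (hbv r hr.2) B hB fun s hs => huv s hs.2⟩

/-- Let `m` be the maximum of `‖z s‖² exp(-γ (s - τ))` over `[τ - k, T]`. The majorant `m exp(γ (r -
τ))` increases in `r`, hence also dominates the delayed values. If the maximum is attained before
`τ`, the history bounds `m`; otherwise the choice `γ > 2 * (C * D)` makes the integral at most half
of the value at the maximum point, where it is absorbed. -/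
lemma exists_bound_of_delayed_inequality {k C D τ T : ℝ} (hk : 0 ≤ k) (hC : 0 ≤ C) (hD : 0 ≤ D) :
    ∃ K, 0 < K ∧ ∀ (z : ℝ → V) (δ d : ℝ), Continuous z → 0 ≤ d →
      (∀ s ∈ Icc (τ - k) τ, ‖z s‖ ^ 2 ≤ δ) →
      (∀ t ∈ Icc τ T, ∀ B : ℝ → ℝ, Continuous B →
        (∀ r ∈ Icc τ t, ∀ s ∈ Icc (r - k) r, ‖z s‖ ^ 2 ≤ B r) →
        ‖z t‖ ^ 2 ≤ C * (δ + d + ∫ r in τ..t, D * B r)) →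
      ∀ t ∈ Icc (τ - k) T, ‖z t‖ ^ 2 ≤ K * (δ + d) := by
  set γ := 2 * (C * D) + 1 with hγ
  have hCD : 0 ≤ C * D := mul_nonneg hC hD
  have hγ0 : 0 < γ := by positivity
  refine ⟨(2 * C + 1) * Real.exp (γ * (|T - τ| + k)), by positivity,
    fun z δ d hz hd h0 hineq t ht => ?_⟩
  have hδ : 0 ≤ δ := (sq_nonneg _).trans (h0 τ ⟨by linarith, le_rfl⟩)
  have hcont : Continuous fun s => ‖z s‖ ^ 2 * Real.exp (-(γ * (s - τ))) :=
    (hz.norm.pow 2).mul (by fun_prop)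
  obtain ⟨s₀, hs₀, hmax⟩ := (isCompact_Icc (a := τ - k) (b := T)).exists_isMaxOn ⟨t, ht⟩
    hcont.continuousOn
  set m := ‖z s₀‖ ^ 2 * Real.exp (-(γ * (s₀ - τ))) with hm
  have hm0 : 0 ≤ m := by positivity
  have hb : ∀ s ∈ Icc (τ - k) T, ‖z s‖ ^ 2 ≤ m * Real.exp (γ * (s - τ)) := by
    intro s hs
    have h1 : ‖z s‖ ^ 2 * Real.exp (-(γ * (s - τ))) ≤ m := hmax hs
    have h2 := mul_le_mul_of_nonneg_right h1 (Real.exp_pos (γ * (s - τ))).le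
    rwa [mul_assoc, ← Real.exp_add, neg_add_cancel, Real.exp_zero, mul_one] at h2
  have hek : 1 ≤ Real.exp (γ * k) := Real.one_le_exp (by positivity)
  have hmb : m ≤ (2 * C + 1) * (δ + d) * Real.exp (γ * k) := by
    have h3 : 0 ≤ δ + d := by linarith
    rcases le_total s₀ τ with h1 | h1
    · calc m ≤ δ * Real.exp (γ * k) := by
            rw [hm]
            refine mul_le_mul (h0 s₀ ⟨hs₀.1, h1⟩) (Real.exp_le_exp.mpr ?_) (Real.exp_pos _).le hδ
            nlinarith [hs₀.1]
        _ ≤ _ := by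
            refine mul_le_mul_of_nonneg_right ?_ (Real.exp_pos _).le
            nlinarith
    · have hBc : Continuous fun r => m * Real.exp (γ * (r - τ)) := by fun_prop
      have h2 := hineq s₀ ⟨h1, hs₀.2⟩ _ hBc fun r hr s hs => by
        refine (hb s ⟨by linarith [hr.1, hs.1], hs.2.trans (hr.2.trans hs₀.2)⟩).trans ?_
        have := hs.2
        gcongr
      rw [intervalIntegral.integral_const_mul, intervalIntegral.integral_const_mul] at h2
      have h4 := integral_exp_mul_sub_le hγ0 τ s₀
      have h5 : C * (D * (m * ∫ r in τ..s₀, Real.exp (γ * (r - τ))))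
          ≤ 1 / 2 * (m * Real.exp (γ * (s₀ - τ))) := by
        calc _ ≤ C * (D * (m * (Real.exp (γ * (s₀ - τ)) / γ))) := by gcongr
          _ = C * D / γ * (m * Real.exp (γ * (s₀ - τ))) := by ring
          _ ≤ _ := by
            refine mul_le_mul_of_nonneg_right ?_ (by positivity)
            rw [div_le_iff₀ hγ0, hγ]
            linarith
      have e1 : m * Real.exp (γ * (s₀ - τ)) = ‖z s₀‖ ^ 2 := by
        rw [hm, mul_assoc, ← Real.exp_add, neg_add_cancel, Real.exp_zero, mul_one]
      rw [e1] at h5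
      have h6 : ‖z s₀‖ ^ 2 ≤ 2 * C * (δ + d) := by nlinarith
      have h7 : Real.exp (-(γ * (s₀ - τ))) ≤ 1 :=
        Real.exp_le_one_iff.mpr (by have := mul_nonneg hγ0.le (sub_nonneg.mpr h1); linarith)
      have h8 : m ≤ ‖z s₀‖ ^ 2 := by
        rw [hm]; exact mul_le_of_le_one_right (sq_nonneg _) h7
      refine (h8.trans h6).trans ?_
      refine le_trans ?_ (le_mul_of_one_le_right (by positivity) hek)
      nlinarith
  refine (hb t ht).trans ?_
  have h9 : Real.exp (γ * (t - τ)) ≤ Real.exp (γ * |T - τ|) := Real.exp_le_exp.mpr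
    (mul_le_mul_of_nonneg_left ((by linarith [ht.2] : t - τ ≤ T - τ).trans (le_abs_self _)) hγ0.le)
  refine (mul_le_mul hmb h9 (Real.exp_pos _).le (hm0.trans hmb)).trans_eq ?_
  rw [mul_add γ, Real.exp_add]
  ring

/-- Solutions of the evolution equation with delay depend Lipschitz continuously on the initial
segment, uniformly on bounded sets of initial segments. -/
theorem exists_delay_stability {ε β : ℝ → ℝ} {p : ℝ} (hβ : MonotoneGrowth β p)
    (hι : ∀ v, ‖ι v‖ ≤ ‖v‖) (hε : ContDiff ℝ 1 ε) (hεpos : ∀ t, 0 < ε t)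
    (hD : Dense (powDomain ι p)) (hη : 0 ≤ η) (hk : 0 ≤ k) (ha : LocallyLipschitz a) {M Cg : ℝ}
    (haM : ∀ s, |a s| ≤ M)
    (hgmeas : ∀ ν, AEStronglyMeasurable (fun t => g t ν) volume) (hgzero : ∀ t, g t 0 = 0)
    (hglip : ∀ t ν₁ ν₂, ‖g t ν₁ - g t ν₂‖ ^ 2 ≤ Cg * ‖ν₁ - ν₂‖ ^ 2)
    (hh : ∀ b c : ℝ, MemLp h 2 (volume.restrict (Icc b c))) (τ T R : ℝ) :
    ∃ K, 0 < K ∧ ∀ u₁ u₂ : ℝ → V,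
      IsIntegralSolution ι ε β p τ (delayForcing ι a j η k g h u₁) u₁ →
      IsIntegralSolution ι ε β p τ (delayForcing ι a j η k g h u₂) u₂ →
      (∀ s ∈ Icc (τ - k) τ, ‖u₁ s‖ ^ 2 ≤ R) → (∀ s ∈ Icc (τ - k) τ, ‖u₂ s‖ ^ 2 ≤ R) →
      ∀ δ, (∀ s ∈ Icc (τ - k) τ, ‖u₁ s - u₂ s‖ ^ 2 ≤ δ) →
      ∀ t ∈ Icc (τ - k) T, ‖u₁ t - u₂ t‖ ^ 2 ≤ K * δ := by
  have hF := fun {u : ℝ → V} (hu : Continuous u) =>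
    locSqIntegrable_delayForcing (ι := ι) (j := j) (η := η) ha hgmeas hgzero hglip hh hu
  obtain ⟨Cs, hCs, hstab⟩ := IsIntegralSolution.stability (ι := ι) hβ hι hε hεpos τ T
  -- A reference solution with zero history. Comparison with it through the growth estimate bounds
  -- every solution with history bounded by `R`; only then is a Lipschitz constant of the forcing
  -- available.
  obtain ⟨z, hz0, hz⟩ := exists_delaySolution (j := j) hβ hι hε hεpos hD hη hk ha haM hgmeas hgzero
    hglip hh (τ := τ) (u₀ := fun _ => (0 : V)) continuous_const (fun _ _ => rfl) (B₀ := 0)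
    (fun _ => by simp)
  obtain ⟨Z, hZ⟩ := (isCompact_Icc (a := τ - k) (b := T)).exists_bound_of_continuousOn
    hz.cont.continuousOn
  obtain ⟨Cg', hCg', hgr⟩ :=
    exists_norm_delayForcing_sub_le_growth (j := j) (h := h) hι hη hk haM hglip
  -- boundedness of solutions
  obtain ⟨K₁, hK₁, hB₁⟩ := exists_bound_of_delayed_inequality (V := V) (τ := τ) (T := T) hk hCs.le hCg'
  set d := |T - τ| * (Cg' * Z ^ 2) with hd
  have hd0 : 0 ≤ d := by positivity
  set R' := 2 * (K₁ * (|R| + d)) + 2 * Z ^ 2 with hR'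
  have hbound : ∀ u : ℝ → V, IsIntegralSolution ι ε β p τ (delayForcing ι a j η k g h u) u →
      (∀ s ∈ Icc (τ - k) τ, ‖u s‖ ^ 2 ≤ R) → ∀ t ∈ Icc (τ - k) T, ‖u t‖ ^ 2 ≤ R' := by
    intro u hu hR t ht
    have h1 := hB₁ (fun s => u s - z s) |R| d (hu.cont.sub hz.cont) hd0 (fun s hs => by
      rw [hz0 s hs.2, sub_zero]; exact (hR s hs).trans (le_abs_self _))
      (fun t ht B hBc hB => by
        refine (hstab _ _ _ _ (hF hu.cont) (hF hz.cont) hu hz t ht).trans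
          (mul_le_mul_of_nonneg_left ?_ hCs.le)
        have h2 : ‖u τ - z τ‖ ^ 2 ≤ |R| := by
          rw [hz0 τ le_rfl, sub_zero]
          exact (hR τ ⟨by linarith, le_rfl⟩).trans (le_abs_self _)
        have hDc : Continuous fun r => Cg' * B r := hBc.const_mul _
        have h3 : ∫ r in τ..t, ‖delayForcing ι a j η k g h u r - delayForcing ι a j η k g h z r‖ ^ 2
            ≤ ∫ r in τ..t, (Cg' * B r + Cg' * Z ^ 2) := by
          refine intervalIntegral.integral_mono_on ht.1
            (((hF hu.cont).sub (hF hz.cont)).intervalIntegrable_sq _ _)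
            ((hDc.add continuous_const).intervalIntegrable _ _) fun r hr => ?_
          have hBr : 0 ≤ B r := (sq_nonneg _).trans (hB r hr r ⟨by linarith, le_rfl⟩)
          refine (hgr u z hu.cont hz.cont r (Real.sqrt (B r)) (Real.sqrt_nonneg _)
            fun s hs => Real.le_sqrt_of_sq_le (hB r hr s hs)).trans ?_
          rw [Real.sq_sqrt hBr, ← mul_add]
          have h4 : ‖z r‖ ^ 2 ≤ Z ^ 2 := by
            have := hZ r ⟨by linarith [hr.1], hr.2.trans ht.2⟩
            gcongr
          gcongr
        rw [intervalIntegral.integral_add (hDc.intervalIntegrable _ _) (by simp),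
          intervalIntegral.integral_const (Cg' * Z ^ 2), smul_eq_mul] at h3
        have h5 : (t - τ) * (Cg' * Z ^ 2) ≤ d := by
          rw [hd]
          refine mul_le_mul_of_nonneg_right ?_ (by positivity)
          exact (by linarith [ht.2] : t - τ ≤ T - τ).trans (le_abs_self _)
        linarith) t ht
    have h6 : ‖z t‖ ^ 2 ≤ Z ^ 2 := by
      have := hZ t ht
      gcongr
    have h7 := norm_add_le (u t - z t) (z t)
    rw [sub_add_cancel] at h7
    have h8 : ‖u t‖ ^ 2 ≤ (‖u t - z t‖ + ‖z t‖) ^ 2 := by gcongr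
    nlinarith [sq_nonneg (‖u t - z t‖ - ‖z t‖)]
  obtain ⟨CL, hCL, hlip⟩ :=
    exists_norm_delayForcing_sub_le (j := j) (h := h) hι hη hk ha haM hglip R'
  obtain ⟨K, hK, hB⟩ := exists_bound_of_delayed_inequality (V := V) (τ := τ) (T := T) hk hCs.le hCL
  refine ⟨K, hK, fun u₁ u₂ hu₁ hu₂ hR₁ hR₂ δ hδ t ht => ?_⟩
  have h1 := hB (fun s => u₁ s - u₂ s) δ 0 (hu₁.cont.sub hu₂.cont) le_rfl hδ
    (fun t ht B hBc hB => by
      refine (hstab _ _ _ _ (hF hu₁.cont) (hF hu₂.cont) hu₁ hu₂ t ht).trans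
        (mul_le_mul_of_nonneg_left ?_ hCs.le)
      rw [add_zero]
      refine add_le_add (hδ τ ⟨by linarith, le_rfl⟩) (intervalIntegral.integral_mono_on ht.1
        (((hF hu₁.cont).sub (hF hu₂.cont)).intervalIntegrable_sq _ _)
        ((hBc.const_mul _).intervalIntegrable _ _) fun r hr => ?_)
      have hBr : 0 ≤ B r := (sq_nonneg _).trans (hB r hr r ⟨by linarith, le_rfl⟩)
      have hr' : r ∈ Icc (τ - k) T := ⟨by linarith [hr.1], hr.2.trans ht.2⟩
      refine (hlip u₁ u₂ hu₁.cont hu₂.cont r (hbound u₁ hu₁ hR₁ r hr') (hbound u₂ hu₂ hR₂ r hr')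
        (Real.sqrt (B r)) (Real.sqrt_nonneg _) fun s hs =>
          Real.le_sqrt_of_sq_le (hB r hr s hs)).trans_eq ?_
      rw [Real.sq_sqrt hBr]) t ht
  rwa [add_zero] at h1

end DelayForcing

/-! ### Distributional and integrated forms of a scalar equation. -/

section Distributions

lemma setIntegral_Ioi_eq_intervalIntegral {f : ℝ → ℝ} {τ T : ℝ} (hT : τ ≤ T)
    (hf : ∀ t, T < t → f t = 0) : ∫ t in Ioi τ, f t = ∫ t in τ..T, f t := by
  rw [intervalIntegral.integral_of_le hT]
  refine setIntegral_eq_of_subset_of_forall_sdiff_eq_zero measurableSet_Ioi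
    (fun t ht => ht.1) fun t ht => hf t ?_
  by_contra hc
  exact ht.2 ⟨ht.1, not_lt.mp hc⟩

lemma deriv_eq_zero_of_forall_lt {ψ : ℝ → ℝ} {T c : ℝ} (hψ : ∀ t, T < t → ψ t = c) {t : ℝ}
    (ht : T < t) : deriv ψ t = 0 := by
  have h : ψ =ᶠ[𝓝 t] fun _ => c := by
    filter_upwards [Ioi_mem_nhds ht] with s hs using hψ s hs
  rw [h.deriv_eq, deriv_const]

/-- The derivative of the transition function, rescaled to `[s, s + 1 / (n + 1)]`. -/
noncomputable def bumpKernel (s : ℝ) (n : ℕ) (r : ℝ) : ℝ :=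
  ((n : ℝ) + 1) * deriv Real.smoothTransition (((n : ℝ) + 1) * (r - s))

/-- The transition function, rescaled to `[s, s + 1 / (n + 1)]`. -/
noncomputable def smoothStep (s : ℝ) (n : ℕ) (r : ℝ) : ℝ :=
  Real.smoothTransition (((n : ℝ) + 1) * (r - s))

lemma contDiff_smoothStep (s : ℝ) (n : ℕ) : ContDiff ℝ ∞ (smoothStep s n) :=
  (Real.smoothTransition.contDiff (n := ⊤)).comp (by fun_prop)

lemma hasDerivAt_smoothStep (s : ℝ) (n : ℕ) (r : ℝ) :
    HasDerivAt (smoothStep s n) (bumpKernel s n r) r := by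
  have h1 : HasDerivAt (fun r : ℝ => ((n : ℝ) + 1) * (r - s)) ((n : ℝ) + 1) r := by
    simpa using ((hasDerivAt_id r).sub_const s).const_mul ((n : ℝ) + 1)
  have h2 : HasDerivAt Real.smoothTransition
      (deriv Real.smoothTransition (((n : ℝ) + 1) * (r - s))) (((n : ℝ) + 1) * (r - s)) :=
    ((Real.smoothTransition.contDiff (n := 1)).differentiable one_ne_zero _).hasDerivAt
  exact (h2.comp r h1).congr_deriv (mul_comm _ _)

lemma continuous_bumpKernel (s : ℝ) (n : ℕ) : Continuous (bumpKernel s n) := by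
  have h := (Real.smoothTransition.contDiff (n := 1)).continuous_deriv le_rfl
  exact continuous_const.mul (h.comp (by fun_prop))

lemma bumpKernel_nonneg (s : ℝ) (n : ℕ) (r : ℝ) : 0 ≤ bumpKernel s n r :=
  mul_nonneg (by positivity) Real.smoothTransition.monotone.deriv_nonneg

lemma smoothStep_of_le {s r : ℝ} (n : ℕ) (h : r ≤ s) : smoothStep s n r = 0 :=
  Real.smoothTransition.zero_of_nonpos (mul_nonpos_of_nonneg_of_nonpos (by positivity) (by linarith))

lemma smoothStep_of_ge {s r : ℝ} {n : ℕ} (h : s + 1 / ((n : ℝ) + 1) ≤ r) : smoothStep s n r = 1 := by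
  refine Real.smoothTransition.one_of_one_le ?_
  have h1 : 1 / ((n : ℝ) + 1) ≤ r - s := by linarith
  rwa [div_le_iff₀' (by positivity)] at h1

lemma bumpKernel_of_lt {s r : ℝ} (n : ℕ) (h : r < s) : bumpKernel s n r = 0 := by
  have h1 : smoothStep s n =ᶠ[𝓝 r] fun _ => 0 := by
    filter_upwards [Iio_mem_nhds h] with x hx using smoothStep_of_le n (le_of_lt hx)
  rw [← (hasDerivAt_smoothStep s n r).deriv, h1.deriv_eq, deriv_const]

lemma bumpKernel_of_gt {s r : ℝ} {n : ℕ} (h : s + 1 / ((n : ℝ) + 1) < r) : bumpKernel s n r = 0 := by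
  rw [← (hasDerivAt_smoothStep s n r).deriv]
  exact deriv_eq_zero_of_forall_lt (fun t ht => smoothStep_of_ge (le_of_lt ht)) h

/-- The kernels are nonnegative, are supported in `[s, s + 1 / (n + 1)]`, and integrate to one as
soon as that interval lies inside `(τ, T)`. -/
lemma tendsto_integral_bumpKernel {E : ℝ → ℝ} (hE : Continuous E) {τ s T : ℝ} (hs : τ < s)
    (hT : s < T) : Tendsto (fun n => ∫ r in τ..T, E r * bumpKernel s n r) atTop (𝓝 (E s)) := by
  have hτT : τ ≤ T := (hs.trans hT).le
  have h0 : Tendsto (fun n : ℕ => 1 / ((n : ℝ) + 1)) atTop (𝓝 0) :=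
    tendsto_one_div_add_atTop_nhds_zero_nat
  have h := tendsto_setIntegral_peak_smul_of_integrableOn_of_tendsto (μ := volume) (l := atTop)
    (s := Ioc τ T) (t := Ioc τ T) (x₀ := s) (φ := bumpKernel s) (g := E) (a := E s)
    measurableSet_Ioc measurableSet_Ioc Subset.rfl self_mem_nhdsWithin
    (by simp) (Eventually.of_forall fun n r _ => bumpKernel_nonneg s n r)
    (fun U hU hsU => ?_) ?_
    (Eventually.of_forall fun n => (continuous_bumpKernel s n).aestronglyMeasurable)
    ((hE.integrableOn_Icc).mono_set Ioc_subset_Icc_self)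
    (hE.continuousAt.continuousWithinAt)
  · refine h.congr fun n => ?_
    rw [intervalIntegral.integral_of_le hτT]
    simp only [smul_eq_mul, mul_comm]
  · rw [Metric.tendstoUniformlyOn_iff]
    intro e he
    obtain ⟨d, hd, hball⟩ := Metric.isOpen_iff.mp hU s hsU
    filter_upwards [h0.eventually (gt_mem_nhds hd)] with n hn r hr
    have hr2 : d ≤ |r - s| := by
      by_contra hc
      exact hr.2 (hball (by rw [Metric.mem_ball, Real.dist_eq]; linarith))
    have : bumpKernel s n r = 0 := by
      rcases le_abs.mp hr2 with h1 | h1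
      · exact bumpKernel_of_gt (by linarith)
      · exact bumpKernel_of_lt n (by linarith)
    rw [this]
    simpa using he
  · have h1 : ∀ n : ℕ, ∫ r in Ioc τ T, bumpKernel s n r = smoothStep s n T - smoothStep s n τ := by
      intro n
      rw [← intervalIntegral.integral_of_le hτT]
      exact intervalIntegral.integral_eq_sub_of_hasDerivAt
        (fun r _ => hasDerivAt_smoothStep s n r) ((continuous_bumpKernel s n).intervalIntegrable _ _)
    refine tendsto_const_nhds.congr' ?_
    filter_upwards [h0.eventually (gt_mem_nhds (sub_pos.mpr hT))] with n hn
    rw [h1, smoothStep_of_le n hs.le, smoothStep_of_ge (by linarith), sub_zero]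

lemma tendsto_integral_mul_smoothStep_sub {G : ℝ → ℝ} {τ s t T : ℝ} (hs : τ ≤ s) (hst : s ≤ t)
    (hT : t ≤ T) (hG : IntervalIntegrable G volume τ T) :
    Tendsto (fun n => ∫ r in τ..T, G r * (smoothStep s n r - smoothStep t n r)) atTop
      (𝓝 (∫ r in s..t, G r)) := by
  have h0 : Tendsto (fun n : ℕ => 1 / ((n : ℝ) + 1)) atTop (𝓝 0) :=
    tendsto_one_div_add_atTop_nhds_zero_nat
  have hτT : τ ≤ T := hs.trans (hst.trans hT)
  have hst' : ∀ x, τ ≤ x → Tendsto (fun n => ∫ r in τ..T, G r * smoothStep x n r) atTop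
      (𝓝 (∫ r in τ..T, (Ioi x).indicator G r)) := by
    intro x _
    refine intervalIntegral.tendsto_integral_filter_of_dominated_convergence (fun r => |G r|)
      (Eventually.of_forall fun n => ?_) (Eventually.of_forall fun n => Eventually.of_forall
        fun r _ => ?_) hG.abs (Eventually.of_forall fun r _ => ?_)
    · exact (intervalIntegrable_iff.mp hG).aestronglyMeasurable.mul
        (contDiff_smoothStep x n).continuous.aestronglyMeasurable
    · rw [norm_mul, Real.norm_eq_abs, Real.norm_eq_abs]
      refine mul_le_of_le_one_right (abs_nonneg _) ?_
      rw [smoothStep, abs_of_nonneg (Real.smoothTransition.nonneg _)]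
      exact Real.smoothTransition.le_one _
    · rcases le_or_gt r x with h1 | h1
      · rw [indicator_of_notMem (by simpa using h1)]
        exact tendsto_const_nhds.congr fun n => by rw [smoothStep_of_le n h1, mul_zero]
      · rw [indicator_of_mem (by simpa using h1)]
        refine tendsto_const_nhds.congr' ?_
        filter_upwards [h0.eventually (gt_mem_nhds (sub_pos.mpr h1))] with n hn
        rw [smoothStep_of_ge (by linarith), mul_one]
  have hGm : ∀ x n, IntervalIntegrable (fun r => G r * smoothStep x n r) volume τ T := fun x n =>
    hG.mul_continuousOn (contDiff_smoothStep x n).continuous.continuousOn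
  have hind : ∀ x, τ ≤ x → x ≤ T → ∫ r in τ..T, (Ioi x).indicator G r = ∫ r in x..T, G r := by
    intro x h1 h2
    rw [intervalIntegral.integral_of_le hτT, intervalIntegral.integral_of_le h2,
      setIntegral_indicator measurableSet_Ioi]
    congr 2
    ext r
    simp only [mem_inter_iff, mem_Ioc, mem_Ioi]
    constructor
    · rintro ⟨⟨_, h3⟩, h4⟩; exact ⟨h4, h3⟩
    · rintro ⟨h3, h4⟩; exact ⟨⟨h1.trans_lt h3, h4⟩, h3⟩
  have h := (hst' s hs).sub (hst' t (hs.trans hst))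
  rw [hind s hs (hst.trans hT), hind t (hs.trans hst) hT] at h
  have hsub : ∀ x y, τ ≤ x → x ≤ y → y ≤ T → IntervalIntegrable G volume x y := fun x y h1 h2 h3 =>
    hG.mono_set (by rw [uIcc_of_le h2, uIcc_of_le hτT]; exact Icc_subset_Icc h1 h3)
  have e : (∫ r in s..T, G r) - ∫ r in t..T, G r = ∫ r in s..t, G r := by
    rw [← intervalIntegral.integral_add_adjacent_intervals (hsub s t hs hst hT)
      (hsub t T (hs.trans hst) hT le_rfl), add_sub_cancel_right]
  rw [e] at h
  refine h.congr fun n => ?_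
  rw [← intervalIntegral.integral_sub (hGm s n) (hGm t n)]
  simp only [mul_sub]

lemma eq_zero_of_notMem_tsupport_subset {ψ : ℝ → ℝ} {τ : ℝ} (hψ : tsupport ψ ⊆ Ioi τ) {t : ℝ}
    (ht : t ≤ τ) : ψ t = 0 := image_eq_zero_of_notMem_tsupport fun h => not_lt.mpr ht (hψ h)

/-- For continuous `E`, the equation `E' + A = B` holds in the sense of distributions on
`(τ, ∞)` if and only if it holds in integrated form on `[τ, ∞)`. -/
theorem distributional_iff_integral {E A B : ℝ → ℝ} {τ : ℝ} (hE : Continuous E)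
    (hA : Continuous A) (hB : ∀ T, τ ≤ T → IntervalIntegrable B volume τ T) :
    (∀ ψ : ℝ → ℝ, ContDiff ℝ ∞ ψ → HasCompactSupport ψ → tsupport ψ ⊆ Ioi τ →
      ∫ t in Ioi τ, (-(E t * deriv ψ t) + A t * ψ t) = ∫ t in Ioi τ, B t * ψ t) ↔
    ∀ s t, τ ≤ s → s ≤ t → E t - E s = ∫ r in s..t, (B r - A r) := by
  have hBA : ∀ T, τ ≤ T → IntervalIntegrable (fun r => B r - A r) volume τ T := fun T hT =>
    (hB T hT).sub (hA.intervalIntegrable _ _)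
  constructor
  · intro H
    have key : ∀ s t, τ < s → s < t → E t - E s = ∫ r in s..t, (B r - A r) := by
      intro s t hs hst
      set T := t + 1 with hTd
      have hT : t < T := by linarith
      have hτT : τ ≤ T := by linarith
      have hle1 : ∀ n : ℕ, 1 / ((n : ℝ) + 1) ≤ 1 := fun n => by
        rw [div_le_one (by positivity)]; linarith [n.cast_nonneg (α := ℝ)]
      -- Smooth approximations of the indicator of `(s, t]`. Their derivatives are differences of
      -- approximate identities at `s` and `t`, so the tested equation converges to the increment of
      -- `E`.
      set ψ : ℕ → ℝ → ℝ := fun n r => smoothStep s n r - smoothStep t n r with hψ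
      have hψd : ∀ n r, deriv (ψ n) r = bumpKernel s n r - bumpKernel t n r := fun n r =>
        ((hasDerivAt_smoothStep s n r).sub (hasDerivAt_smoothStep t n r)).deriv
      have hψT : ∀ n r, T < r → ψ n r = 0 := fun n r hr => by
        have := hle1 n
        simp only [hψ]
        rw [smoothStep_of_ge (by linarith), smoothStep_of_ge (by linarith), sub_self]
      have hsupp : ∀ n, tsupport (ψ n) ⊆ Icc s T := fun n => by
        refine closure_minimal (fun r hr => ?_) isClosed_Icc
        by_contra hc
        refine hr ?_
        rcases lt_or_ge r s with h1 | h1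
        · simp only [hψ]
          rw [smoothStep_of_le n h1.le, smoothStep_of_le n (h1.trans hst).le, sub_self]
        · refine hψT n r ?_
          by_contra hc2
          exact hc ⟨h1, not_lt.mp hc2⟩
      have hψc : ∀ n, ContDiff ℝ ∞ (ψ n) := fun n =>
        (contDiff_smoothStep s n).sub (contDiff_smoothStep t n)
      have heq : ∀ n, -((∫ r in τ..T, E r * bumpKernel s n r) - ∫ r in τ..T, E r * bumpKernel t n r)
          = ∫ r in τ..T, (B r - A r) * (smoothStep s n r - smoothStep t n r) := by
        intro n
        have h1 := H (ψ n) (hψc n)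
          (HasCompactSupport.of_support_subset_isCompact isCompact_Icc
            ((subset_tsupport _).trans (hsupp n)))
          ((hsupp n).trans fun r hr => hs.trans_le hr.1)
        rw [setIntegral_Ioi_eq_intervalIntegral hτT fun r hr => by
            rw [hψT n r hr, deriv_eq_zero_of_forall_lt (hψT n) hr]; ring,
          setIntegral_Ioi_eq_intervalIntegral hτT fun r hr => by rw [hψT n r hr, mul_zero]] at h1
        simp only [hψd] at h1
        have hcs : Continuous fun r => E r * bumpKernel s n r := hE.mul (continuous_bumpKernel s n)
        have hct : Continuous fun r => E r * bumpKernel t n r := hE.mul (continuous_bumpKernel t n)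
        have hAψ : Continuous fun r => A r * ψ n r := hA.mul (hψc n).continuous
        have hEψ : Continuous fun r => -(E r * (bumpKernel s n r - bumpKernel t n r)) :=
          (hE.mul ((continuous_bumpKernel s n).sub (continuous_bumpKernel t n))).neg
        have hBψ : IntervalIntegrable (fun r => B r * ψ n r) volume τ T :=
          (hB T hτT).mul_continuousOn (hψc n).continuous.continuousOn
        rw [intervalIntegral.integral_add (hEψ.intervalIntegrable _ _)
          (hAψ.intervalIntegrable _ _), intervalIntegral.integral_neg] at h1
        have e1 : ∫ r in τ..T, E r * (bumpKernel s n r - bumpKernel t n r)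
            = (∫ r in τ..T, E r * bumpKernel s n r) - ∫ r in τ..T, E r * bumpKernel t n r := by
          rw [← intervalIntegral.integral_sub (hcs.intervalIntegrable _ _)
            (hct.intervalIntegrable _ _)]
          simp only [mul_sub]
        have e2 : ∫ r in τ..T, (B r - A r) * (smoothStep s n r - smoothStep t n r)
            = (∫ r in τ..T, B r * ψ n r) - ∫ r in τ..T, A r * ψ n r := by
          rw [← intervalIntegral.integral_sub hBψ (hAψ.intervalIntegrable _ _)]
          simp only [hψ, sub_mul]
        rw [e1] at h1
        rw [e2]
        linarith
      have hl := ((tendsto_integral_bumpKernel hE hs (hst.trans hT)).sub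
        (tendsto_integral_bumpKernel hE (hs.trans hst) hT)).neg
      have hr := tendsto_integral_mul_smoothStep_sub hs.le hst.le hT.le (hBA T hτT)
      have := tendsto_nhds_unique hl (hr.congr fun n => (heq n).symm)
      linarith
    have hcont : ∀ T, τ ≤ T → ContinuousOn (fun s => E s - ∫ r in τ..s, (B r - A r)) (Icc τ T) := by
      intro T hT
      have := intervalIntegral.continuousOn_primitive_interval' (hBA T hT) left_mem_uIcc
      rw [uIcc_of_le hT] at this
      exact hE.continuousOn.sub this
    -- Test functions vanish near `τ`, so the identity is first known only for `s > τ`; continuity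
    -- of `E` and of the primitive extends it to `s = τ`.
    have hconst : ∀ t, τ < t → E t - ∫ r in τ..t, (B r - A r) = E τ := by
      intro t ht
      have h1 := (hcont t ht.le) τ ⟨le_rfl, ht.le⟩
      have h2 : Tendsto (fun s => E s - ∫ r in τ..s, (B r - A r)) (𝓝[Ioo τ t] τ) (𝓝 (E τ)) := by
        have h3 := h1.tendsto.mono_left (nhdsWithin_mono τ Ioo_subset_Icc_self)
        simpa using h3
      have : (𝓝[Ioo τ t] τ).NeBot := by
        rw [← mem_closure_iff_nhdsWithin_neBot, closure_Ioo ht.ne]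
        exact ⟨le_rfl, ht.le⟩
      refine tendsto_nhds_unique (tendsto_const_nhds.congr' ?_) h2
      filter_upwards [self_mem_nhdsWithin] with s hs
      have h4 := key s t hs.1 hs.2
      have h5 := intervalIntegral.integral_add_adjacent_intervals (hBA s hs.1.le)
        ((hBA t ht.le).mono_set (by
          rw [uIcc_of_le hs.2.le, uIcc_of_le ht.le]; exact Icc_subset_Icc hs.1.le le_rfl))
      linarith
    have hall : ∀ t, τ ≤ t → E t - E τ = ∫ r in τ..t, (B r - A r) := by
      intro t ht
      rcases ht.eq_or_lt with h | h
      · subst h; simp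
      · linarith [hconst t h]
    intro s t hs hst
    have h5 := intervalIntegral.integral_add_adjacent_intervals (hBA s hs)
      ((hBA t (hs.trans hst)).mono_set (by
        rw [uIcc_of_le hst, uIcc_of_le (hs.trans hst)]; exact Icc_subset_Icc hs le_rfl))
    linarith [hall s hs, hall t (hs.trans hst)]
  · intro H ψ hψ hψc hψs
    obtain ⟨T₀, hT₀⟩ := hψc.isCompact.bddAbove
    set T := max T₀ τ with hTd
    have hT : τ ≤ T := le_max_right _ _
    have hψT : ∀ t, T < t → ψ t = 0 := fun t ht => image_eq_zero_of_notMem_tsupport fun h =>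
      not_lt.mpr (hT₀ h) ((le_max_left _ _).trans_lt ht)
    have hψ0 : ψ τ = 0 := eq_zero_of_notMem_tsupport_subset hψs le_rfl
    have hψT1 : ψ (T + 1) = 0 := hψT _ (by linarith)
    have hT1 : τ ≤ T + 1 := by linarith
    rw [setIntegral_Ioi_eq_intervalIntegral hT1 fun r hr => by
        rw [hψT r (by linarith), deriv_eq_zero_of_forall_lt hψT (by linarith)]; ring,
      setIntegral_Ioi_eq_intervalIntegral hT1 fun r hr => by
        rw [hψT r (by linarith), mul_zero]]
    have hψ1 : ContDiff ℝ 1 ψ := hψ.of_le (by exact_mod_cast le_top)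
    have hψ' : Continuous (deriv ψ) := hψ1.continuous_deriv le_rfl
    set G : ℝ → ℝ := fun r => B r - A r with hG
    have hGi := hBA (T + 1) hT1
    set P : ℝ → ℝ := fun t => ∫ r in τ..t, G r with hP
    -- As `B` is merely integrable, the primitive is only absolutely continuous, and integration by
    -- parts is used at that level of regularity.
    have hPac : AbsolutelyContinuousOnInterval P τ (T + 1) :=
      hGi.absolutelyContinuousOnInterval_intervalIntegral left_mem_uIcc
    have hψac : AbsolutelyContinuousOnInterval ψ τ (T + 1) :=
      hψ1.contDiffOn.absolutelyContinuousOnInterval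
    have hparts := hPac.integral_mul_deriv_eq_deriv_mul hψac
    rw [hψT1, hψ0, mul_zero, mul_zero, sub_zero, zero_sub] at hparts
    have hder : ∫ r in τ..T + 1, deriv P r * ψ r = ∫ r in τ..T + 1, G r * ψ r := by
      refine intervalIntegral.integral_congr_ae ?_
      filter_upwards [hGi.ae_hasDerivAt_integral] with r hr hr2
      rw [(hr (uIoc_subset_uIcc hr2) τ left_mem_uIcc).deriv]
    rw [hder] at hparts
    have hEP : ∫ r in τ..T + 1, E r * deriv ψ r = ∫ r in τ..T + 1, P r * deriv ψ r := by
      have h1 : ∫ r in τ..T + 1, E r * deriv ψ r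
          = ∫ r in τ..T + 1, (E τ * deriv ψ r + P r * deriv ψ r) := by
        refine intervalIntegral.integral_congr fun r hr => ?_
        rw [uIcc_of_le hT1] at hr
        have h2 := H τ r le_rfl hr.1
        simp only [hP, hG]
        rw [← h2]; ring
      have hPi : IntervalIntegrable (fun r => P r * deriv ψ r) volume τ (T + 1) :=
        (hPac.continuousOn.mul hψ'.continuousOn).intervalIntegrable
      have hci : IntervalIntegrable (fun r => E τ * deriv ψ r) volume τ (T + 1) :=
        (hψ'.const_mul _).intervalIntegrable _ _
      rw [h1, intervalIntegral.integral_add hci hPi, intervalIntegral.integral_const_mul,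
        intervalIntegral.integral_deriv_eq_sub (fun r _ => hψ1.differentiable one_ne_zero r)
          (hψ'.intervalIntegrable _ _), hψT1, hψ0]
      ring
    have hAψ : Continuous fun r => A r * ψ r := hA.mul hψ.continuous
    have hEψ : Continuous fun r => -(E r * deriv ψ r) := (hE.mul hψ').neg
    have hBψ : IntervalIntegrable (fun r => B r * ψ r) volume τ (T + 1) :=
      (hB _ hT1).mul_continuousOn hψ.continuous.continuousOn
    have hGψ : ∫ r in τ..T + 1, G r * ψ r
        = (∫ r in τ..T + 1, B r * ψ r) - ∫ r in τ..T + 1, A r * ψ r := by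
      rw [← intervalIntegral.integral_sub hBψ (hAψ.intervalIntegrable _ _)]
      simp only [hG, sub_mul]
    rw [intervalIntegral.integral_add (hEψ.intervalIntegrable _ _) (hAψ.intervalIntegrable _ _),
      intervalIntegral.integral_neg, hEP, hparts, hGψ]
    ring

end Distributions

/-! ### The space `H₀¹(Ω)` and its embedding into `L²(Ω)`. -/

section EnergySpace

variable {n : ℕ} {Ω : Set (EuclideanSpace ℝ (Fin n))}

instance H01.completeSpace : CompleteSpace (H01 Ω) := by
  unfold H01 H01Sub; infer_instance

namespace H01

lemma inner_eq (u v : H01 Ω) :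
    inner ℝ u v = inner ℝ u.val v.val + inner ℝ u.grad v.grad := by
  rw [Submodule.coe_inner, WithLp.prod_inner_apply]; rfl

lemma norm_sq_eq (u : H01 Ω) : ‖u‖ ^ 2 = ‖u.val‖ ^ 2 + ‖u.grad‖ ^ 2 := by
  rw [← real_inner_self_eq_norm_sq, inner_eq, real_inner_self_eq_norm_sq,
    real_inner_self_eq_norm_sq]

lemma norm_val_le (u : H01 Ω) : ‖u.val‖ ≤ ‖u‖ :=
  le_of_sq_le_sq (by rw [norm_sq_eq]; linarith [sq_nonneg ‖u.grad‖]) (norm_nonneg _)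

lemma norm_grad_le (u : H01 Ω) : ‖u.grad‖ ≤ ‖u‖ :=
  le_of_sq_le_sq (by rw [norm_sq_eq]; linarith [sq_nonneg ‖u.val‖]) (norm_nonneg _)

/-- The embedding `H₀¹(Ω) → L²(Ω)`. -/
noncomputable def valL : H01 Ω →L[ℝ] L2 Ω :=
  LinearMap.mkContinuous ⟨⟨val, fun _ _ => rfl⟩, fun _ _ => rfl⟩ 1 fun u => by
    rw [one_mul]; exact norm_val_le u

/-- The weak gradient as a continuous linear map. -/
noncomputable def gradL : H01 Ω →L[ℝ] L2Vec Ω :=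
  LinearMap.mkContinuous ⟨⟨grad, fun _ _ => rfl⟩, fun _ _ => rfl⟩ 1 fun u => by
    rw [one_mul]; exact norm_grad_le u

lemma valL_apply (u : H01 Ω) : valL u = u.val := rfl

lemma norm_valL_le (u : H01 Ω) : ‖valL u‖ ≤ ‖u‖ := norm_val_le u

lemma inner_gradOp_valL (u v : H01 Ω) :
    inner ℝ (gradOp valL u) v = inner ℝ u.grad v.grad := by
  rw [inner_gradOp, inner_eq, valL_apply, valL_apply, add_sub_cancel_left]

lemma inner_energyOp_valL (e : ℝ) (u v : H01 Ω) :
    inner ℝ (energyOp valL e u) v = inner ℝ u.val v.val + e * inner ℝ u.grad v.grad := by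
  rw [inner_energyOp, inner_gradOp_valL, valL_apply, valL_apply]

end H01

lemma powInt_lt_top_of_mem_span [IsFiniteMeasure (volume.restrict Ω)] {p : ℝ} (hp : 2 ≤ p)
    {w : WithLp 2 (L2 Ω × L2Vec Ω)} (hw : w ∈ Submodule.span ℝ (testPairs Ω)) :
    powInt p w.fst < ⊤ := by
  induction hw using Submodule.span_induction with
  | mem w hw =>
    obtain ⟨φ, hφ, hc, -, hφw, -⟩ := hw
    obtain ⟨C, hC⟩ := hc.exists_bound_of_continuous hφ.continuous
    calc powInt p w.fst = ∫⁻ x in Ω, ENNReal.ofReal (|φ x| ^ p) := by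
          refine lintegral_congr_ae ?_
          filter_upwards [hφw] with x hx
          rw [hx]
      _ ≤ ∫⁻ _ in Ω, ENNReal.ofReal (C ^ p) := by
          refine lintegral_mono fun x => ENNReal.ofReal_le_ofReal ?_
          exact Real.rpow_le_rpow (abs_nonneg _) (hC x) (by linarith)
      _ < ⊤ := by
          rw [lintegral_const]
          exact ENNReal.mul_lt_top ENNReal.ofReal_lt_top (measure_lt_top _ _)
  | zero =>
    change powInt p (0 : L2 Ω) < ⊤
    rw [powInt_zero hp]; simp
  | add x y _ _ hx hy => exact powInt_add_lt_top hp hx hy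
  | smul c x _ hx => exact powInt_smul_lt_top hp c hx

/-- Test functions are bounded and `Ω` has finite measure, so their span lies in `Lᵖ`; it is dense
by the definition of `H₀¹(Ω)`. Neither a regular boundary nor a Sobolev embedding is involved. -/
lemma dense_powDomain_valL [IsFiniteMeasure (volume.restrict Ω)] {p : ℝ} (hp : 2 ≤ p) :
    Dense (powDomain (H01.valL (Ω := Ω)) p) := by
  intro u
  have hu : (u : WithLp 2 (L2 Ω × L2Vec Ω)) ∈ closure (Submodule.span ℝ (testPairs Ω) : Set _) := u.2
  rw [Metric.mem_closure_iff] at hu ⊢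
  intro e he
  obtain ⟨w, hw, hd⟩ := hu e he
  exact ⟨⟨w, Submodule.le_topologicalClosure _ hw⟩, powInt_lt_top_of_mem_span hp hw, hd⟩

lemma memLp_iff_powInt {p : ℝ} (hp : 2 ≤ p) (v : L2 Ω) :
    MemLp v (ENNReal.ofReal p) (volume.restrict Ω) ↔ powInt p v < ⊤ := by
  have hp0 : 0 < p := by linarith
  have h : eLpNorm v (ENNReal.ofReal p) (volume.restrict Ω) < ⊤ ↔ powInt p v < ⊤ := by
    rw [eLpNorm_lt_top_iff_lintegral_rpow_enorm_lt_top (by simpa using hp0) ENNReal.ofReal_ne_top,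
      ENNReal.toReal_ofReal hp0.le]
    refine iff_of_eq (congrArg (· < ⊤) (lintegral_congr fun x => ?_))
    rw [← ofReal_norm, ENNReal.ofReal_rpow_of_nonneg (norm_nonneg _) hp0.le,
      Real.norm_eq_abs]
  rw [← h]
  exact ⟨fun hv => hv.2, fun hv => ⟨Lp.aestronglyMeasurable v, hv⟩⟩

end EnergySpace

/-! ### The monotone function attached to the reaction term. -/

section Nonlinearity

/-- The one-sided Lipschitz bound on `f` is monotonicity of `η r - f r`, and the upper bound on `f r
* r` is its coercivity. Growth follows for `|r| > 1` by dividing the two-sided bound by `|r|`, and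
for `|r| ≤ 1` by compactness. -/
lemma monotoneGrowth_of_dissipative {f : ℝ → ℝ} (hf : ContDiff ℝ 1 f) {η C₀ C₁ C₂ p : ℝ}
    (hη : 0 < η) (hC₀ : 0 < C₀) (hC₁ : 0 < C₁) (hC₂ : 0 < C₂) (hp : 2 ≤ p)
    (hfmono : ∀ r s, (f r - f s) * (r - s) ≤ η * (r - s) ^ 2)
    (hflow : ∀ r, -C₀ - C₁ * |r| ^ p ≤ f r * r) (hfup : ∀ r, f r * r ≤ C₀ - C₂ * |r| ^ p) :
    MonotoneGrowth (fun r => η * r - f r) p where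
  two_le := hp
  contDiff := (contDiff_const.mul contDiff_id).sub hf
  mono := by
    intro s r hsr
    rcases hsr.eq_or_lt with h | h
    · rw [h]
    have h1 := hfmono r s
    have h2 : 0 < r - s := sub_pos.mpr h
    have h3 : f r - f s ≤ η * (r - s) := by
      refine le_of_mul_le_mul_right ?_ h2
      linarith
    simp only
    linarith
  growth := by
    obtain ⟨B, hB⟩ := (isCompact_Icc (a := (-1 : ℝ)) (b := 1)).exists_bound_of_continuousOn
      hf.continuous.continuousOn
    have hB0 : 0 ≤ B := (norm_nonneg _).trans (hB 0 (by norm_num))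
    refine ⟨η + B + C₀ + C₁ + C₂, by positivity, fun r => ?_⟩
    have hr0 : 0 ≤ |r| ^ (p - 1) := by positivity
    have h1 : |r| ≤ 1 + |r| ^ (p - 1) := le_one_add_rpow (by linarith) (abs_nonneg r)
    have h2 : |f r| ≤ (B + C₀ + C₁ + C₂) * (1 + |r| ^ (p - 1)) := by
      rcases le_or_gt |r| 1 with h | h
      · have h3 : |f r| ≤ B := hB r (abs_le.mp h)
        nlinarith [mul_nonneg hB0 hr0, mul_nonneg (add_pos (add_pos hC₀ hC₁) hC₂).le hr0]
      · have h3 : |f r| * |r| ≤ C₀ + (C₁ + C₂) * |r| ^ p := by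
          rw [← abs_mul, abs_le]
          have h4 : 0 ≤ |r| ^ p := by positivity
          constructor
          · nlinarith [hflow r, mul_nonneg hC₂.le h4]
          · nlinarith [hfup r, mul_nonneg hC₁.le h4, mul_nonneg hC₂.le h4]
        have hr : 0 < |r| := by linarith
        have h4 : |r| ^ p = |r| ^ (p - 1) * |r| := by
          rw [← Real.rpow_add_one hr.ne']; congr 1; ring
        have h5 : |f r| * |r| ≤ (C₀ + (C₁ + C₂) * |r| ^ (p - 1)) * |r| := by
          rw [h4] at h3
          nlinarith
        have h6 := le_of_mul_le_mul_right h5 hr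
        nlinarith [mul_nonneg hB0 hr0, mul_nonneg hC₀.le hr0]
    have h3 : |η * r - f r| ≤ η * |r| + |f r| := by
      refine (abs_sub _ _).trans ?_
      rw [abs_mul, abs_of_pos hη]
    nlinarith [mul_le_mul_of_nonneg_left h1 hη.le]
  coercive := ⟨C₂, C₀, hC₂, hC₀, fun r => by nlinarith [hfup r, mul_nonneg hη.le (mul_self_nonneg r)]⟩

end Nonlinearity

/-! ### Weak solutions as solutions of the integrated equation. -/

section WeakSolutions

variable {n : ℕ} {Ω : Set (EuclideanSpace ℝ (Fin n))} {k p τ η : ℝ} {ε a f : ℝ → ℝ} {j : L2 Ω}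
  {g : ℝ → C(Icc (-k) 0, L2 Ω) → L2 Ω} {h : ℝ → Hneg1 Ω} {φ : CH k Ω} {u w : ℝ → H01 Ω}

lemma delaySegment_congr {E : Type} [NormedAddCommGroup E] {x y : ℝ → E} {t : ℝ}
    (hxy : ∀ s ∈ Icc (t - k) t, x s = y s) : delaySegment k x t = delaySegment k y t := by
  have e : (fun θ : Icc (-k) 0 => x (t + (θ : ℝ))) = fun θ : Icc (-k) 0 => y (t + (θ : ℝ)) :=
    funext fun θ => hxy _ ⟨by linarith [θ.2.1], by linarith [θ.2.2]⟩
  by_cases hc : Continuous fun θ : Icc (-k) 0 => y (t + (θ : ℝ))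
  · ext θ
    rw [delaySegment_apply hc, delaySegment_apply (e ▸ hc)]
    exact congrFun e θ
  · rw [delaySegment, delaySegment, dif_neg hc, dif_neg (e ▸ hc)]

lemma IsWeakSolution.congr (hu : IsWeakSolution p ε a f j g h τ φ u) (hk : 0 ≤ k)
    (huw : ∀ t, τ - k ≤ t → w t = u t) : IsWeakSolution p ε a f j g h τ φ w where
  continuousOn := hu.continuousOn.congr fun t ht => huw t ht
  sq_integrable T hT := (hu.sq_integrable T hT).congr_fun
    (fun t ht => by rw [huw t (by linarith [ht.1])]) measurableSet_Ioo
  pow_integrable T hT := by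
    rw [setLIntegral_congr_fun measurableSet_Ioo fun t ht => by rw [huw t (by linarith [ht.1])]]
    exact hu.pow_integrable T hT
  initial θ := by rw [huw _ (by linarith [θ.2.1]), hu.initial]
  equation v hv ψ hψ hψc hψs := by
    refine Eq.trans ?_ ((hu.equation v hv ψ hψ hψc hψs).trans ?_)
    · refine setIntegral_congr_fun measurableSet_Ioi fun t (ht : τ < t) => ?_
      rw [huw t (by linarith)]
    · refine setIntegral_congr_fun measurableSet_Ioi fun t (ht : τ < t) => ?_
      rw [huw t (by linarith), delaySegment_congr (x := fun s => (w s).val)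
        (y := fun s => (u s).val) fun s hs => by rw [huw s (by linarith [hs.1])]]

lemma inner_L2_eq (u : H01 Ω) : ∫ x in Ω, j x * u.val x = inner ℝ j (H01.valL u) := by
  rw [L2.inner_def]
  refine integral_congr_ae (Eventually.of_forall fun x => ?_)
  simp only [RCLike.inner_apply, conj_trivial, H01.valL_apply]
  ring

variable [IsFiniteMeasure (volume.restrict Ω)]

/-- The right-hand side of the integrated equation, in the two notations. -/
lemma forcing_sub_nonlinear_eq (hβ : MonotoneGrowth (fun r => η * r - f r) p) {t : ℝ}
    (ht : powInt p (H01.valL (u t)) < ⊤) {v : H01 Ω} (hv : powInt p (H01.valL v) < ⊤) :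
    deriv ε t * inner ℝ (gradOp H01.valL (u t)) v
        + inner ℝ (delayForcing H01.valL a j η k g h u t) v
        - ∫ x in Ω, (η * H01.valL (u t) x - f (H01.valL (u t) x)) * H01.valL v x
      = ((∫ x in Ω, f ((u t).val x) * v.val x)
          + inner ℝ (g t (delaySegment k (fun s => (u s).val) t)) v.val + h t v)
        - (a (∫ x in Ω, j x * (u t).val x) - deriv ε t) * inner ℝ (u t).grad v.grad := by
  have hβi := hβ.integrable_comp_mul ht hv
  have hi : Integrable (fun x => η * (H01.valL (u t) x * H01.valL v x)) (volume.restrict Ω) :=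
    ((L2.integrable_inner (𝕜 := ℝ) (H01.valL v) (H01.valL (u t))).congr
      (Eventually.of_forall fun x => by simp [RCLike.inner_apply])).const_mul η
  -- The decomposition `f r = η * r - β r`; the linear part is the one included in `delayForcing`.
  have e1 : ∫ x in Ω, f ((u t).val x) * v.val x
      = η * inner ℝ (H01.valL (u t)) (H01.valL v)
        - ∫ x in Ω, (η * H01.valL (u t) x - f (H01.valL (u t) x)) * H01.valL v x := by
    have e2 : inner ℝ (H01.valL (u t)) (H01.valL v)
        = ∫ x in Ω, H01.valL (u t) x * H01.valL v x := by
      rw [L2.inner_def]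
      refine integral_congr_ae (Eventually.of_forall fun x => ?_)
      simp only [RCLike.inner_apply, conj_trivial]
      ring
    rw [e2, ← integral_const_mul, ← integral_sub hi hβi]
    refine integral_congr_ae (Eventually.of_forall fun x => ?_)
    simp only [H01.valL_apply]
    ring
  rw [e1, inner_delayForcing, H01.inner_gradOp_valL, inner_L2_eq]
  simp only [H01.valL_apply]
  ring

lemma pow_Ioo_eq_powInt (T : ℝ) :
    ∫⁻ t in Ioo τ T, ∫⁻ x in Ω, ENNReal.ofReal (|(u t).val x| ^ p)
      = ∫⁻ t in Ioc τ T, powInt p (H01.valL (u t)) := by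
  rw [restrict_Ioo_eq_restrict_Ioc]; rfl

lemma normH_sq (hεpos : ∀ t, 0 < ε t) (t : ℝ) (x : H01 Ω) :
    normH ε t x ^ 2 = ‖x.val‖ ^ 2 + ε t * ‖x.grad‖ ^ 2 :=
  Real.sq_sqrt (by have := hεpos t; positivity)

/-- For curves that are continuous on the whole line, weak solutions are the solutions of the
abstract evolution equation in integrated form. -/
theorem isWeakSolution_iff (hβ : MonotoneGrowth (fun r => η * r - f r) p) (hε : ContDiff ℝ 1 ε)
    (hεpos : ∀ t, 0 < ε t) (ha : LocallyLipschitz a) {Cg : ℝ}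
    (hgmeas : ∀ ν, AEStronglyMeasurable (fun t => g t ν) volume) (hgzero : ∀ t, g t 0 = 0)
    (hglip : ∀ t ν₁ ν₂, ‖g t ν₁ - g t ν₂‖ ^ 2 ≤ Cg * ‖ν₁ - ν₂‖ ^ 2)
    (hh : ∀ b c : ℝ, MemLp h 2 (volume.restrict (Icc b c))) (hu : Continuous u) :
    IsWeakSolution p ε a f j g h τ φ u ↔ (∀ θ : Icc (-k) 0, u (τ + (θ : ℝ)) = φ θ) ∧
      IsIntegralSolution H01.valL ε (fun r => η * r - f r) p τ
        (delayForcing H01.valL a j η k g h u) u := by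
  have hp := hβ.two_le
  have hval : Continuous fun t => H01.valL (u t) := H01.valL.continuous.comp hu
  have hgrad : Continuous fun t => (u t).grad := H01.gradL.continuous.comp hu
  have hF : LocSqIntegrable (delayForcing H01.valL a j η k g h u) :=
    locSqIntegrable_delayForcing ha hgmeas hgzero hglip hh hu
  have hpow : (∀ T, τ < T →
      ∫⁻ t in Ioo τ T, ∫⁻ x in Ω, ENNReal.ofReal (|(u t).val x| ^ p) < ⊤) ↔
      ∀ T, ∫⁻ t in Ioc τ T, powInt p (H01.valL (u t)) < ⊤ := by
    simp only [pow_Ioo_eq_powInt]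
    refine ⟨fun H T => ?_, fun H T _ => H T⟩
    rcases lt_or_ge τ T with hT | hT
    · exact H T hT
    · rw [Ioc_eq_empty (not_lt.mpr hT)]; simp
  have key : (∀ T, ∫⁻ t in Ioc τ T, powInt p (H01.valL (u t)) < ⊤) → ∀ v : H01 Ω,
      powInt p (H01.valL v) < ⊤ →
      ((∀ ψ : ℝ → ℝ, ContDiff ℝ ∞ ψ → HasCompactSupport ψ → tsupport ψ ⊆ Ioi τ →
        (∫ t in Ioi τ,
          (-((inner ℝ (u t).val v.val + ε t * inner ℝ (u t).grad v.grad) * deriv ψ t)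
            + (a (∫ x in Ω, j x * (u t).val x) - deriv ε t)
                * inner ℝ (u t).grad v.grad * ψ t))
        = ∫ t in Ioi τ,
            ((∫ x in Ω, f ((u t).val x) * v.val x)
              + inner ℝ (g t (delaySegment k (fun s => (u s).val) t)) v.val + h t v) * ψ t) ↔
      ∀ s t, τ ≤ s → s ≤ t →
        inner ℝ (energyOp H01.valL (ε t) (u t)) v - inner ℝ (energyOp H01.valL (ε s) (u s)) v =
          ∫ r in s..t, (deriv ε r * inner ℝ (gradOp H01.valL (u r)) v
            + inner ℝ (delayForcing H01.valL a j η k g h u r) v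
            - ∫ x in Ω, (η * H01.valL (u r) x - f (H01.valL (u r) x)) * H01.valL v x)) := by
    intro hfin v hv
    have hE : Continuous fun t => inner ℝ (u t).val v.val + ε t * inner ℝ (u t).grad v.grad :=
      (hval.inner continuous_const).add (hε.continuous.mul (hgrad.inner continuous_const))
    have hA : Continuous fun t => (a (∫ x in Ω, j x * (u t).val x) - deriv ε t)
        * inner ℝ (u t).grad v.grad := by
      simp only [inner_L2_eq]
      exact ((ha.continuous.comp (continuous_const.inner hval)).sub
        (hε.continuous_deriv le_rfl)).mul (hgrad.inner continuous_const)
    have hae : ∀ T, ∀ᵐ t ∂(volume.restrict (Ioc τ T)), powInt p (H01.valL (u t)) < ⊤ := fun T =>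
      ae_lt_top' (aemeasurable_powInt hp hval.aestronglyMeasurable) (hfin T).ne
    set Y : ℝ → ℝ := fun r => deriv ε r * inner ℝ (gradOp H01.valL (u r)) v
            + inner ℝ (delayForcing H01.valL a j η k g h u r) v
            - ∫ x in Ω, (η * H01.valL (u r) x - f (H01.valL (u r) x)) * H01.valL v x with hY
    set B : ℝ → ℝ := fun t => (∫ x in Ω, f ((u t).val x) * v.val x)
              + inner ℝ (g t (delaySegment k (fun s => (u s).val) t)) v.val + h t v with hB
    set A : ℝ → ℝ := fun t => (a (∫ x in Ω, j x * (u t).val x) - deriv ε t)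
        * inner ℝ (u t).grad v.grad with hAd
    have hYB : ∀ T, ∀ᵐ t ∂(volume.restrict (Ioc τ T)), Y t = B t - A t := fun T => by
      filter_upwards [hae T] with t ht
      exact forcing_sub_nonlinear_eq hβ ht hv
    have hYi : ∀ T, τ ≤ T → IntervalIntegrable Y volume τ T := by
      intro T hT
      refine (((continuous_deriv_mul_inner hε hu continuous_const).intervalIntegrable _ _).add
        (hF.intervalIntegrable_inner continuous_const _ _)).sub ?_
      rw [intervalIntegrable_iff_integrableOn_Ioc_of_le hT]
      exact hβ.integrable_integral hval.aestronglyMeasurable (hfin T) hv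
    -- Integrability of `B` is not known termwise; it is inherited from `Y + A`, with which `B`
    -- agrees almost everywhere.
    have hBi : ∀ T, τ ≤ T → IntervalIntegrable B volume τ T := by
      intro T hT
      refine ((hYi T hT).add (hA.intervalIntegrable _ _)).congr_ae ?_
      rw [uIoc_of_le hT]
      filter_upwards [hYB T] with t ht
      rw [ht, sub_add_cancel]
    rw [distributional_iff_integral hE hA hBi]
    simp only [H01.inner_energyOp_valL]
    refine forall_congr' fun s => forall_congr' fun t => forall_congr' fun hs =>
      forall_congr' fun hst => ?_
    have e : ∫ r in s..t, Y r = ∫ r in s..t, (B r - A r) := by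
      refine intervalIntegral.integral_congr_ae_restrict ?_
      rw [uIoc_of_le hst]
      exact ae_restrict_of_ae_restrict_of_subset (Ioc_subset_Ioc_left hs) (hYB t)
    rw [e]
  constructor
  · intro H
    have hfin := hpow.mp H.pow_integrable
    exact ⟨H.initial, hu, hfin, fun v hv =>
      (key hfin v hv).mp (H.equation v ((memLp_iff_powInt hp _).mpr hv))⟩
  · rintro ⟨hi, H⟩
    refine ⟨hu.continuousOn, fun T _ => ?_, hpow.mpr H.pow, hi, fun v hv =>
      (key H.pow v ((memLp_iff_powInt hp _).mp hv)).mpr (H.eq v ((memLp_iff_powInt hp _).mp hv))⟩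
    have hc : Continuous fun t => normH ε t (u t) ^ 2 := by
      simp only [normH_sq hεpos]
      exact (hval.norm.pow 2).add (hε.continuous.mul (hgrad.norm.pow 2))
    exact hc.integrableOn_Icc.mono_set Ioo_subset_Icc_self

end WeakSolutions

/-! ### Norms of segments and restarting of solutions. -/

section Dynamics

variable {n : ℕ} {Ω : Set (EuclideanSpace ℝ (Fin n))} {k τ : ℝ} {ε : ℝ → ℝ}

lemma normCH_sq_le (hk : 0 ≤ k) {L D : ℝ} (hL : ∀ t, |ε t| ≤ L) {t : ℝ} {φ : CH k Ω}
    (hφ : ∀ θ, ‖φ θ‖ ^ 2 ≤ D) : normCH ε t φ ^ 2 ≤ (1 + L) * D := by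
  have : Nonempty (Icc (-k) 0) := ⟨⟨0, by linarith, le_rfl⟩⟩
  have h1 : ⨆ θ : Icc (-k) 0, ‖(φ θ).val‖ ≤ Real.sqrt D := ciSup_le fun θ =>
    (H01.norm_val_le _).trans (Real.le_sqrt_of_sq_le (hφ θ))
  have h2 : ⨆ θ : Icc (-k) 0, ‖(φ θ).grad‖ ≤ Real.sqrt D := ciSup_le fun θ =>
    (H01.norm_grad_le _).trans (Real.le_sqrt_of_sq_le (hφ θ))
  have h3 : ⨆ θ : Icc (-k) 0, |ε (t + (θ : ℝ))| ≤ L := ciSup_le fun θ => hL _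
  have h4 : 0 ≤ ⨆ θ : Icc (-k) 0, ‖(φ θ).val‖ := Real.iSup_nonneg fun θ => norm_nonneg _
  have h5 : 0 ≤ ⨆ θ : Icc (-k) 0, ‖(φ θ).grad‖ := Real.iSup_nonneg fun θ => norm_nonneg _
  have h6 : 0 ≤ ⨆ θ : Icc (-k) 0, |ε (t + (θ : ℝ))| := Real.iSup_nonneg fun θ => abs_nonneg _
  have hD : 0 ≤ D := (sq_nonneg _).trans (hφ ⟨0, by linarith, le_rfl⟩)
  have hs := Real.sq_sqrt hD
  rw [normCH, Real.sq_sqrt (by positivity), add_mul, one_mul]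
  have h7 := pow_le_pow_left₀ h4 h1 2
  have h8 := pow_le_pow_left₀ h5 h2 2
  rw [hs] at h7 h8
  exact add_le_add h7 (mul_le_mul h3 h8 (sq_nonneg _) (h6.trans h3))

/-- The weight of the gradient is at least `ε t`, as `θ = 0` shows, so the time-dependent norm
dominates the norm of `H₀¹` with constant at most `min 1 (ε t)`. -/
lemma le_normCH_sq (hk : 0 ≤ k) {L e : ℝ} (hL : ∀ t, |ε t| ≤ L) (he1 : e ≤ 1) {t : ℝ}
    (het : e ≤ ε t) (φ : CH k Ω) (θ : Icc (-k) 0) : e * ‖φ θ‖ ^ 2 ≤ normCH ε t φ ^ 2 := by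
  have h1 : ‖(φ θ).val‖ ≤ ⨆ θ : Icc (-k) 0, ‖(φ θ).val‖ :=
    le_ciSup (f := fun θ : Icc (-k) 0 => ‖(φ θ).val‖) ⟨‖φ‖, by
      rintro _ ⟨θ, rfl⟩; exact (H01.norm_val_le _).trans (φ.norm_coe_le_norm θ)⟩ θ
  have h2 : ‖(φ θ).grad‖ ≤ ⨆ θ : Icc (-k) 0, ‖(φ θ).grad‖ :=
    le_ciSup (f := fun θ : Icc (-k) 0 => ‖(φ θ).grad‖) ⟨‖φ‖, by
      rintro _ ⟨θ, rfl⟩; exact (H01.norm_grad_le _).trans (φ.norm_coe_le_norm θ)⟩ θ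
  have h3 : ε t ≤ ⨆ θ : Icc (-k) 0, |ε (t + (θ : ℝ))| := by
    refine (le_abs_self _).trans ?_
    have := le_ciSup (f := fun θ : Icc (-k) 0 => |ε (t + (θ : ℝ))|)
      ⟨L, by rintro _ ⟨θ, rfl⟩; exact hL _⟩ ⟨0, by linarith, le_rfl⟩
    simpa using this
  have h6 : 0 ≤ ⨆ θ : Icc (-k) 0, |ε (t + (θ : ℝ))| := Real.iSup_nonneg fun θ => abs_nonneg _
  rw [normCH, Real.sq_sqrt (by positivity), H01.norm_sq_eq, mul_add]
  refine add_le_add ?_ ?_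
  · calc e * ‖(φ θ).val‖ ^ 2 ≤ 1 * ‖(φ θ).val‖ ^ 2 := by gcongr
      _ ≤ _ := by rw [one_mul]; gcongr
  · calc e * ‖(φ θ).grad‖ ^ 2
        ≤ (⨆ θ : Icc (-k) 0, |ε (t + (θ : ℝ))|) * ‖(φ θ).grad‖ ^ 2 := by
          gcongr; exact het.trans h3
      _ ≤ _ := by gcongr

lemma normCH_nonneg (t : ℝ) (φ : CH k Ω) : 0 ≤ normCH ε t φ := Real.sqrt_nonneg _

lemma IsIntegralSolution.restart {X : Type*} [MeasurableSpace X] {μ : Measure X}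
    [IsFiniteMeasure μ] {V : Type*} [NormedAddCommGroup V] [InnerProductSpace ℝ V]
    [CompleteSpace V] {ι : V →L[ℝ] Lp ℝ 2 μ} {β : ℝ → ℝ} {p s : ℝ} {F u : ℝ → V}
    (hu : IsIntegralSolution ι ε β p τ F u) (hs : τ ≤ s) : IsIntegralSolution ι ε β p s F u :=
  ⟨hu.cont, fun T => (lintegral_mono_set (Ioc_subset_Ioc_left hs)).trans_lt (hu.pow T),
    fun v hv r t hr hrt => hu.eq v hv r t (hs.trans hr) hrt⟩

end Dynamics

/-! ### Uniqueness, continuous dependence and the continuous process. -/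

theorem theorem3p2 {n : ℕ} (hn : 3 ≤ n)
    -- the bounded domain
    (Ω : Set (EuclideanSpace ℝ (Fin n)))
    (hΩo : IsOpen Ω) (hΩc : IsConnected Ω) (hΩb : Bornology.IsBounded Ω)
    -- the length of the delay
    (k : ℝ) (hk : 0 < k)
    -- the time-dependent coefficient
    (ε : ℝ → ℝ) (hε : ContDiff ℝ 1 ε) (hεpos : ∀ t, 0 < ε t) (hεlim : Tendsto ε atTop (𝓝 1))
    (L : ℝ) (hL : 0 < L) (hεL : ∀ t, |ε t| + |deriv ε t| ≤ L)
    -- the nonlocal diffusion coefficient and the functional inside it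
    (a : ℝ → ℝ) (ha : LocallyLipschitz a) (m M : ℝ) (hm : 0 < m) (hM : 0 < M)
    (hmε : ∀ t, (3 + L + deriv ε t) / 2 < m) (hma : ∀ s, m ≤ a s) (haM : ∀ s, a s ≤ M)
    (j : L2 Ω)
    -- the nonlinearity
    (f : ℝ → ℝ) (hf : ContDiff ℝ 1 f) (η C₀ C₁ C₂ p : ℝ) (hη : 0 < η) (hC₀ : 0 < C₀)
    (hC₁ : 0 < C₁) (hC₂ : 0 < C₂) (hp : 2 ≤ p)
    (hfmono : ∀ r s, (f r - f s) * (r - s) ≤ η * (r - s) ^ 2)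
    (hflow : ∀ r, -C₀ - C₁ * |r| ^ p ≤ f r * r) (hfup : ∀ r, f r * r ≤ C₀ - C₂ * |r| ^ p)
    -- the delay operator
    (g : ℝ → C(Icc (-k) 0, L2 Ω) → L2 Ω)
    (hgmeas : ∀ ν, AEStronglyMeasurable (fun t => g t ν) volume)
    (hgzero : ∀ t, g t 0 = 0) (Cg : ℝ) (hCg : 0 < Cg)
    (hglip : ∀ t ν₁ ν₂, ‖g t ν₁ - g t ν₂‖ ^ 2 ≤ Cg * ‖ν₁ - ν₂‖ ^ 2)
    -- the external force, locally square integrable with values in the dual of `H₀¹(Ω)`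
    (h : ℝ → Hneg1 Ω) (hh : ∀ b c : ℝ, MemLp h 2 (volume.restrict (Icc b c))) :
    -- uniqueness
    (∀ (τ : ℝ) (φ : CH k Ω) (u v : ℝ → H01 Ω),
      IsWeakSolution p ε a f j g h τ φ u → IsWeakSolution p ε a f j g h τ φ v →
        EqOn u v (Ici (τ - k))) ∧
    -- continuous dependence, with a Gronwall estimate uniform on bounded sets of data
    (∀ τ T R : ℝ, ∃ C : ℝ, 0 < C ∧ ∀ (φ₁ φ₂ : CH k Ω) (u₁ u₂ : ℝ → H01 Ω),
      normCH ε τ φ₁ ≤ R → normCH ε τ φ₂ ≤ R →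
      IsWeakSolution p ε a f j g h τ φ₁ u₁ → IsWeakSolution p ε a f j g h τ φ₂ u₂ →
        ∀ t ∈ Icc τ T, normCH ε t (delaySegment k u₁ t - delaySegment k u₂ t) ^ 2
          ≤ Real.exp (C * (t + k - τ)) * normCH ε τ (φ₁ - φ₂) ^ 2) ∧
    -- the continuous process `U(t, τ)`, for `τ ≤ t`, of the problem
    (∃ U : ℝ → ℝ → CH k Ω → CH k Ω,
      (∀ τ φ, U τ τ φ = φ) ∧
      (∀ τ s t, τ ≤ s → s ≤ t → ∀ φ, U t s (U s τ φ) = U t τ φ) ∧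
      (∀ τ φ, (∃ u, IsWeakSolution p ε a f j g h τ φ u) ∧
        ∀ u, IsWeakSolution p ε a f j g h τ φ u → ∀ t, τ ≤ t → U t τ φ = delaySegment k u t) ∧
      (∀ τ t, τ ≤ t → ∀ φ₀ : CH k Ω, ∀ e : ℝ, 0 < e → ∃ δ : ℝ, 0 < δ ∧ ∀ φ : CH k Ω,
        normCH ε τ (φ - φ₀) < δ → normCH ε t (U t τ φ - U t τ φ₀) < e)) := by
  have : IsFiniteMeasure (volume.restrict Ω) :=
    ⟨by rw [Measure.restrict_apply_univ]; exact hΩb.measure_lt_top⟩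
  have hk0 := hk.le
  have hβ : MonotoneGrowth (fun r => η * r - f r) p :=
    monotoneGrowth_of_dissipative hf hη hC₀ hC₁ hC₂ hp hfmono hflow hfup
  have haM' : ∀ s, |a s| ≤ M := fun s => by
    rw [abs_of_nonneg (hm.le.trans (hma s))]; exact haM s
  have hεb : ∀ t, |ε t| ≤ L := fun t => by linarith [hεL t, abs_nonneg (deriv ε t)]
  have hD : Dense (powDomain (H01.valL (Ω := Ω)) p) := dense_powDomain_valL hp
  have hι := H01.norm_valL_le (Ω := Ω)
  set IS : ℝ → (ℝ → H01 Ω) → Prop := fun τ u =>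
    IsIntegralSolution H01.valL ε (fun r => η * r - f r) p τ
      (delayForcing H01.valL a j η k g h u) u with hIS
  have hiff : ∀ (τ : ℝ) (φ : CH k Ω) (u : ℝ → H01 Ω), Continuous u →
      (IsWeakSolution p ε a f j g h τ φ u ↔ (∀ θ : Icc (-k) 0, u (τ + (θ : ℝ)) = φ θ) ∧ IS τ u) :=
    fun τ φ u hu => isWeakSolution_iff hβ hε hεpos ha hgmeas hgzero hglip hh hu
  -- A weak solution matters only on `[τ - k, ∞)`. Freezing it at its value at `τ - k` for earlier
  -- times gives a curve continuous on the whole line, as the integrated theory requires.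
  have hext : ∀ (τ : ℝ) (φ : CH k Ω) (u : ℝ → H01 Ω), IsWeakSolution p ε a f j g h τ φ u →
      ∃ w, Continuous w ∧ (∀ t, τ - k ≤ t → w t = u t) ∧
        (∀ θ : Icc (-k) 0, w (τ + (θ : ℝ)) = φ θ) ∧ IS τ w := by
    intro τ φ u hu
    have hw : Continuous fun t => u (max t (τ - k)) :=
      hu.continuousOn.comp_continuous (by fun_prop) fun t => mem_Ici.mpr (le_max_right _ _)
    have hwu : ∀ t, τ - k ≤ t → u (max t (τ - k)) = u t := fun t ht => by rw [max_eq_left ht]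
    obtain ⟨h1, h2⟩ := (hiff τ φ _ hw).mp (hu.congr hk0 hwu)
    exact ⟨_, hw, hwu, h1, h2⟩
  have hinit : ∀ (τ : ℝ) (φ : CH k Ω) (w : ℝ → H01 Ω), (∀ θ : Icc (-k) 0, w (τ + (θ : ℝ)) = φ θ) →
      ∀ s (hs : s ∈ Icc (τ - k) τ), w s = φ ⟨s - τ, by linarith [hs.1], by linarith [hs.2]⟩ :=
    fun τ φ w hw s hs => by
      rw [← hw]; congr 1; simp
  have hstab : ∀ τ T R, ∃ K, 0 < K ∧ ∀ (φ₁ φ₂ : CH k Ω) (u₁ u₂ : ℝ → H01 Ω),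
      IsWeakSolution p ε a f j g h τ φ₁ u₁ → IsWeakSolution p ε a f j g h τ φ₂ u₂ →
      (∀ θ, ‖φ₁ θ‖ ^ 2 ≤ R) → (∀ θ, ‖φ₂ θ‖ ^ 2 ≤ R) →
      ∀ δ, (∀ θ, ‖(φ₁ - φ₂) θ‖ ^ 2 ≤ δ) → ∀ t ∈ Icc (τ - k) T, ‖u₁ t - u₂ t‖ ^ 2 ≤ K * δ := by
    intro τ T R
    obtain ⟨K, hK, hS⟩ := exists_delay_stability (j := j) hβ hι hε hεpos hD hη.le hk0 ha haM' hgmeas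
      hgzero hglip hh τ T R
    refine ⟨K, hK, fun φ₁ φ₂ u₁ u₂ hu₁ hu₂ hR₁ hR₂ δ hδ t ht => ?_⟩
    obtain ⟨w₁, -, hwu₁, hi₁, hs₁⟩ := hext τ φ₁ u₁ hu₁
    obtain ⟨w₂, -, hwu₂, hi₂, hs₂⟩ := hext τ φ₂ u₂ hu₂
    rw [← hwu₁ t ht.1, ← hwu₂ t ht.1]
    refine hS w₁ w₂ hs₁ hs₂ (fun s hs => ?_) (fun s hs => ?_) δ (fun s hs => ?_) t ht
    · rw [hinit τ φ₁ w₁ hi₁ s hs]; exact hR₁ _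
    · rw [hinit τ φ₂ w₂ hi₂ s hs]; exact hR₂ _
    · rw [hinit τ φ₁ w₁ hi₁ s hs, hinit τ φ₂ w₂ hi₂ s hs, ← ContinuousMap.sub_apply]; exact hδ _
  have huniq : ∀ (τ : ℝ) (φ : CH k Ω) (u v : ℝ → H01 Ω),
      IsWeakSolution p ε a f j g h τ φ u → IsWeakSolution p ε a f j g h τ φ v →
        EqOn u v (Ici (τ - k)) := by
    intro τ φ u v hu hv t ht
    obtain ⟨K, hK, hS⟩ := hstab τ t (‖φ‖ ^ 2)
    have hR : ∀ θ, ‖φ θ‖ ^ 2 ≤ ‖φ‖ ^ 2 := fun θ => by gcongr; exact φ.norm_coe_le_norm θ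
    have h1 := hS φ φ u v hu hv hR hR 0 (fun θ => by simp) t ⟨ht, le_rfl⟩
    rw [mul_zero] at h1
    have h2 : ‖u t - v t‖ = 0 := by
      have := le_antisymm h1 (sq_nonneg _)
      exact pow_eq_zero_iff two_ne_zero |>.mp this
    exact sub_eq_zero.mp (norm_eq_zero.mp h2)
  have hseg : ∀ (τ : ℝ) (φ : CH k Ω) (u : ℝ → H01 Ω), IsWeakSolution p ε a f j g h τ φ u →
      ∀ t, τ ≤ t → ∀ θ, delaySegment k u t θ = u (t + (θ : ℝ)) := by
    intro τ φ u hu t ht θ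
    refine delaySegment_apply ?_ θ
    exact hu.continuousOn.comp_continuous (by fun_prop) fun θ => by
      have := θ.2.1
      simp only [mem_Ici]
      linarith
  have hdep : ∀ τ T R : ℝ, ∃ C : ℝ, 0 < C ∧ ∀ (φ₁ φ₂ : CH k Ω) (u₁ u₂ : ℝ → H01 Ω),
      normCH ε τ φ₁ ≤ R → normCH ε τ φ₂ ≤ R →
      IsWeakSolution p ε a f j g h τ φ₁ u₁ → IsWeakSolution p ε a f j g h τ φ₂ u₂ →
        ∀ t ∈ Icc τ T, normCH ε t (delaySegment k u₁ t - delaySegment k u₂ t) ^ 2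
          ≤ Real.exp (C * (t + k - τ)) * normCH ε τ (φ₁ - φ₂) ^ 2 := by
    intro τ T R
    set e := min 1 (ε τ) with he
    have he0 : 0 < e := lt_min one_pos (hεpos τ)
    obtain ⟨K, hK, hS⟩ := hstab τ T (R ^ 2 / e)
    set Q := (1 + L) * (K / e) with hQ
    have hQ0 : 0 < Q := by positivity
    -- Stability gives a fixed Lipschitz constant `Q` on `[τ, T]`. It fits the exponential form
    -- because `t + k - τ ≥ k`, whence `Q ≤ (Q / k) (t + k - τ) ≤ exp((Q / k) (t + k - τ))`.
    refine ⟨Q / k, by positivity, fun φ₁ φ₂ u₁ u₂ hR₁ hR₂ hu₁ hu₂ t ht => ?_⟩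
    have hle : ∀ (φ : CH k Ω) (B : ℝ), normCH ε τ φ ≤ B → ∀ θ, ‖φ θ‖ ^ 2 ≤ B ^ 2 / e :=
      fun φ B hB θ => by
        rw [le_div_iff₀' he0]
        refine (le_normCH_sq hk0 hεb (min_le_left _ _) (min_le_right _ _) φ θ).trans ?_
        exact pow_le_pow_left₀ (normCH_nonneg _ _) hB 2
    have h1 := hS φ₁ φ₂ u₁ u₂ hu₁ hu₂ (hle φ₁ R hR₁) (hle φ₂ R hR₂) _
      (hle (φ₁ - φ₂) _ le_rfl)
    have h2 := normCH_sq_le hk0 hεb (t := t) (φ := delaySegment k u₁ t - delaySegment k u₂ t)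
      fun θ => by
        rw [ContinuousMap.sub_apply, hseg τ φ₁ u₁ hu₁ t ht.1, hseg τ φ₂ u₂ hu₂ t ht.1]
        exact h1 (t + (θ : ℝ)) ⟨by linarith [θ.2.1, ht.1], by linarith [θ.2.2, ht.2]⟩
    refine h2.trans ?_
    have h3 : (1 + L) * (K * (normCH ε τ (φ₁ - φ₂) ^ 2 / e))
        = Q * normCH ε τ (φ₁ - φ₂) ^ 2 := by rw [hQ]; ring
    rw [h3]
    refine mul_le_mul_of_nonneg_right ?_ (sq_nonneg _)
    have h4 : Q ≤ Q / k * (t + k - τ) := by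
      rw [div_mul_eq_mul_div, le_div_iff₀ hk]
      exact mul_le_mul_of_nonneg_left (by linarith [ht.1]) hQ0.le
    linarith [Real.add_one_le_exp (Q / k * (t + k - τ))]
  have hexist : ∀ (τ : ℝ) (φ : CH k Ω), ∃ u, Continuous u ∧ IsWeakSolution p ε a f j g h τ φ u := by
    intro τ φ
    -- The datum extended by constants to both sides of `[τ - k, τ]`, hence continuous and bounded
    -- by `‖φ‖`.
    set u₀ : ℝ → H01 Ω := fun t => φ (projIcc (-k) 0 (by linarith) (t - τ)) with hu₀
    have hu₀c : Continuous u₀ := φ.continuous.comp (continuous_projIcc.comp (by fun_prop))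
    obtain ⟨u, hu, hs⟩ := exists_delaySolution (j := j) hβ hι hε hεpos hD hη.le hk0 ha haM' hgmeas
      hgzero hglip hh (τ := τ) hu₀c (fun t ht => by
        simp only [hu₀]
        rw [projIcc_of_right_le _ (by linarith), projIcc_of_right_le _ (by linarith)])
      (B₀ := ‖φ‖ ^ 2) (fun t => by
        have := φ.norm_coe_le_norm (projIcc (-k) 0 (by linarith) (t - τ))
        simp only [hu₀]
        gcongr)
    refine ⟨u, hs.cont, (hiff τ φ u hs.cont).mpr ⟨fun θ => ?_, hs⟩⟩
    rw [hu _ (by linarith [θ.2.2])]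
    simp only [hu₀]
    rw [add_sub_cancel_left, projIcc_val]
  refine ⟨huniq, hdep, ?_⟩
  choose sol hsolc hsol using hexist
  have hU : ∀ τ φ, ∀ u, IsWeakSolution p ε a f j g h τ φ u → ∀ t, τ ≤ t →
      delaySegment k (sol τ φ) t = delaySegment k u t := fun τ φ u hu t ht =>
    delaySegment_congr fun s hs => huniq τ φ _ _ (hsol τ φ) hu (by
      rw [mem_Ici]; linarith [hs.1])
  refine ⟨fun t τ φ => delaySegment k (sol τ φ) t, fun τ φ => ?_, fun τ s t hs ht φ => ?_,
    fun τ φ => ⟨⟨_, hsol τ φ⟩, hU τ φ⟩, fun τ t ht φ₀ e he => ?_⟩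
  · ext1 θ
    rw [hseg τ φ _ (hsol τ φ) τ le_rfl, (hsol τ φ).initial]
  -- Restarted at `s`, the solution issued from `φ` is a weak solution whose datum is its own
  -- segment at `s`; uniqueness identifies it with the chosen one.
  · refine hU s _ (sol τ φ) ((hiff s _ _ (hsolc τ φ)).mpr ⟨fun θ => ?_, ?_⟩) t ht
    · rw [hseg τ φ _ (hsol τ φ) s hs]
    · exact ((hiff τ φ _ (hsolc τ φ)).mp (hsol τ φ)).2.restart hs
  · set e₀ := min 1 (ε τ) with he₀
    have he₀0 : 0 < e₀ := lt_min one_pos (hεpos τ)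
    -- The dependence estimate needs one bound for all data considered. In the unit ball around `φ₀`
    -- for the norm at time `τ`, the difference `φ - φ₀` is pointwise at most `√(1 / e₀)`, so `P`
    -- bounds every such `φ`.
    set P := ‖φ₀‖ + Real.sqrt (1 / e₀) with hP
    have hP0 : 0 ≤ P := by positivity
    set R := Real.sqrt ((1 + L) * P ^ 2) with hR
    obtain ⟨C, hC, hS⟩ := hdep τ t R
    set E := Real.exp (C * (t + k - τ)) with hE
    have hE1 : 1 ≤ E := Real.one_le_exp (mul_nonneg hC.le (by linarith))
    have hE0 : 0 < E := by linarith
    have hbd : ∀ φ : CH k Ω, (∀ θ, ‖φ θ‖ ≤ P) → normCH ε τ φ ≤ R := fun φ hφ =>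
      Real.le_sqrt_of_sq_le (normCH_sq_le hk0 hεb fun θ => by
        have := hφ θ
        gcongr)
    -- The estimate is for squares and would call for `√E`; since `E ≥ 1`, the cruder factor `E` is
    -- enough. The `1` keeps `φ` in the ball where `R` applies.
    refine ⟨min 1 (e / E), lt_min one_pos (div_pos he hE0), fun φ hφ => ?_⟩
    have hφ1 : normCH ε τ (φ - φ₀) ≤ 1 := hφ.le.trans (min_le_left _ _)
    have hφ2 : normCH ε τ (φ - φ₀) < e / E := hφ.trans_le (min_le_right _ _)
    have h0 := normCH_nonneg (ε := ε) τ (φ - φ₀)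
    have h1 := hS φ φ₀ _ _ (hbd φ fun θ => ?_) (hbd φ₀ fun θ =>
      (φ₀.norm_coe_le_norm θ).trans (le_add_of_nonneg_right (Real.sqrt_nonneg _)))
      (hsol τ φ) (hsol τ φ₀) t ⟨ht, le_rfl⟩
    · refine lt_of_pow_lt_pow_left₀ 2 he.le (h1.trans_lt ?_)
      rw [lt_div_iff₀ hE0] at hφ2
      calc E * normCH ε τ (φ - φ₀) ^ 2 ≤ E * (E * normCH ε τ (φ - φ₀) ^ 2) :=
            mul_le_mul_of_nonneg_left (le_mul_of_one_le_left (sq_nonneg _) hE1) hE0.le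
        _ = (normCH ε τ (φ - φ₀) * E) ^ 2 := by ring
        _ < e ^ 2 := pow_lt_pow_left₀ hφ2 (mul_nonneg h0 hE0.le) two_ne_zero
    · have h2 := le_normCH_sq hk0 hεb (min_le_left 1 (ε τ)) (min_le_right 1 (ε τ)) (φ - φ₀) θ
      have h3 : ‖(φ - φ₀) θ‖ ≤ Real.sqrt (1 / e₀) := by
        refine Real.le_sqrt_of_sq_le ?_
        rw [le_div_iff₀' he₀0]
        exact h2.trans (pow_le_one₀ h0 hφ1)
      have h4 := norm_add_le (φ₀ θ) ((φ - φ₀) θ)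
      rw [ContinuousMap.sub_apply, add_sub_cancel, ← ContinuousMap.sub_apply] at h4
      linarith [φ₀.norm_coe_le_norm θ]
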